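/- Let $n\ge 2$ be an integer, $r\in[1,\infty)$ and $s\in(n/2,n)$ with $\frac1{2r}+\frac n{2s}>1$. A pair $(p,q)$ is called admissible if $\frac1p+\frac n{2q}=\frac n4$, $p,q\in[2,\infty]$ and $(n,p,q)\ne(2,2,\infty)$. Then there exist a real-valued potential $V\in L^r(0,1;L^s(\mathbb R^n))$ and a complex-valued function $u\in C([0,1];L^2(\mathbb R^n))$ which solves $$ i\,\partial_t u-\Delta u+V(t,x)\,u=0 $$ on $[0,1]$ in the integral sense $$ u(t)=e^{-it\Delta}u(0)+i\int_0^t e^{-i(t-\tau)\Delta}\,V(\tau)u(\tau)\,d\tau\qquad (0\le t\le 1), $$ such that for every admissible pair $(p,q)$ with $p<\infty$ one has $$ u\in L^p(0,T;L^q(\mathbb R^n))\ \text{ for all } 0<T<1,\qquad\text{but}\qquad u\notin L^p(0,1;L^q(\mathbb R^n)). $$ Here the integral identity is understood between tempered distributions: for every $t\in[0,1]$ and every Schwartz function $\varphi$, the function $(\tau,x)\mapsto V(\tau,x)\,u(\tau,x)\,(e^{-i(t-\tau)\Delta}\varphi)(x)$ is integrable on $(0,t)\times\mathbb R^n$ and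 $$ \int u(t)\,\varphi\,dx=\int u(0)\,e^{-it\Delta}\varphi\,dx+i\int_0^t\!\!\int V(\tau)u(\tau)\,e^{-i(t-\tau)\Delta}\varphi\,dx\,d\tau, $$ where $e^{-it\Delta}$ is the Fourier multiplier with symbol $e^{it|\xi|^2}$ (with $\xi$ the angular frequency, so that $-\Delta$ has symbol $|\xi|^2$). -/

import Mathlib

open MeasureTheory Set Filter Topology
open scoped ENNReal SchwartzMap FourierTransform

/-- The pair `(p, q)` is Schrödinger admissible in dimension `n`:
`1/p + n/(2q) = n/4`, `p, q ∈ [2, ∞]` and `(n, p, q) ≠ (2, 2, ∞)` (with `1/∞ = 0`). -/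
def SchrodingerAdmissible (n : ℕ) (p q : ℝ≥0∞) : Prop :=
  p⁻¹ + (n : ℝ≥0∞) / 2 * q⁻¹ = (n : ℝ≥0∞) / 4 ∧ 2 ≤ p ∧ 2 ≤ q ∧
    ¬ (n = 2 ∧ p = 2 ∧ q = ∞)

/-- The mixed space-time norm of `f` in `L^p(I; L^q(ℝⁿ))`: the `L^p(I)` norm of
`t ↦ ‖f(t, ·)‖_{L^q}`, as an element of `[0, ∞]`. -/
noncomputable def mixedNorm {n : ℕ} {F : Type*} [NormedAddCommGroup F] (I : Set ℝ)
    (p q : ℝ≥0∞) (f : ℝ → EuclideanSpace ℝ (Fin n) → F) : ℝ≥0∞ :=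
  eLpNorm (fun t => eLpNorm (f t) q volume) p (volume.restrict I)

/-- `f ∈ L^p(I; L^q(ℝⁿ))`: `f` is measurable on `I × ℝⁿ` and has finite mixed norm. -/
def MemMixed {n : ℕ} {F : Type*} [NormedAddCommGroup F] (I : Set ℝ)
    (p q : ℝ≥0∞) (f : ℝ → EuclideanSpace ℝ (Fin n) → F) : Prop :=
  AEStronglyMeasurable (Function.uncurry f) ((volume.restrict I).prod volume) ∧
    mixedNorm I p q f < ∞

/-- `u ∈ C(I; L²(ℝⁿ))`, for a (jointly measurable) function `u` on `I × ℝⁿ`: the slices `u(t, ·)`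
are the values of a continuous curve in the Banach space `L²`. -/
def MemContL2 {n : ℕ} (I : Set ℝ) (u : ℝ → EuclideanSpace ℝ (Fin n) → ℂ) : Prop :=
  AEStronglyMeasurable (Function.uncurry u) ((volume.restrict I).prod volume) ∧
    ∃ U : ℝ → Lp ℂ 2 (volume : Measure (EuclideanSpace ℝ (Fin n))),
      ContinuousOn U I ∧ ∀ t ∈ I, U t =ᵐ[volume] u t

/-- The free evolution `e^{-itΔ} φ` of a Schwartz function: the Fourier multiplier with symbol
`e^{it(2π|ξ|)²}`. The function `w(t) = e^{-itΔ} φ` solves `i w_t - Δ w = 0`, `w(0) = φ`. -/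
noncomputable def freeEvolution {n : ℕ} (t : ℝ) (φ : 𝓢(EuclideanSpace ℝ (Fin n), ℂ)) :
    EuclideanSpace ℝ (Fin n) → ℂ :=
  𝓕⁻ (fun ξ : EuclideanSpace ℝ (Fin n) =>
    Complex.exp (Complex.I * (((2 * Real.pi * ‖ξ‖) ^ 2 * t : ℝ) : ℂ)) *
      𝓕 (φ : EuclideanSpace ℝ (Fin n) → ℂ) ξ)

/-- `u` solves `i u_t - Δ u + V(t,x) u = 0` on the time interval `[0, T]`, in integral form:
`u(t) = e^{-itΔ} u(0) + i ∫₀ᵗ e^{-i(t-τ)Δ} V(τ) u(τ) dτ` for every `t ∈ [0, T]`.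
As `V(τ) u(τ)` need not lie in `L²`, the identity is read between tempered distributions, that is,
after pairing with an arbitrary Schwartz function `φ`; the operators `e^{-itΔ}` are moved to `φ`,
since they are symmetric for the pairing `∫ f φ dx`. The pairing in the integral term is required
to converge absolutely. -/
def IsIntegralSolution {n : ℕ} (T : ℝ) (V : ℝ → EuclideanSpace ℝ (Fin n) → ℝ)
    (u : ℝ → EuclideanSpace ℝ (Fin n) → ℂ) : Prop :=
  ∀ t ∈ Icc (0 : ℝ) T, ∀ φ : 𝓢(EuclideanSpace ℝ (Fin n), ℂ),
    Integrable (fun z : ℝ × EuclideanSpace ℝ (Fin n) =>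
        (V z.1 z.2 : ℂ) * u z.1 z.2 * freeEvolution (t - z.1) φ z.2)
      ((volume.restrict (Ioo 0 t)).prod volume) ∧
    ∫ x, u t x * φ x = (∫ x, u 0 x * freeEvolution t φ x) +
      Complex.I * ∫ τ in Ioo 0 t, ∫ x, (V τ x : ℂ) * u τ x * freeEvolution (t - τ) φ x

/-! A function `u = R e^{iφ}` with `R > 0` and `φ` real solves `i ∂ₜu - Δu + V u = 0` with a real
`V` exactly when `∂ₜR² = 2 div (R² ∇φ)`; the potential is then `V = ∂ₜφ + ΔR / R - |∇φ|²`. Write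
`y = |x|²`, `w = √(y² + θ(t))`, `σ = y + w`, and take the phase `φ = θ' / (16 σ)`. Its flow
transports `N = w / y + 1 - log σ`, and `w y^{-n/2-1} h(N)` solves the continuity equation for
every `h`. For `h(N) = (N + e^{1-N})^{-(n+2)/2}` this is a smooth function of `x` as long as
`θ > 0`, while at `θ = 0` it is of size `|x|^{-n} |log |x||^{-(n+2)/2}` near the origin, so that
`u(t)` still converges in `L²` as `θ → 0`. The potential is bounded by a constant times
`(1 - log θ)² / w`.

With `θ = (1 - t)^{2α}` the solution concentrates at scale `|x| ~ (1 - t)^{α/2}`. Up to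
logarithms, `‖u(t)‖_q ~ (1 - t)^{-α/p}` for every admissible pair, which is not in `L^p` when
`α > 1`, and `‖V(t)‖_s ~ (1 - t)^{-α(1 - n/(2s))}`, which is in `L^r` when
`α (1 - n/(2s)) r < 1`. Both hold for `α` slightly larger than `1` because `(1 - n/(2s)) r < 1`. -/

open Module (finrank)

/-- The smoothed absolute value `w = √(y² + θ)`. -/
noncomputable def smoothAbs (θ y : ℝ) : ℝ := √(y ^ 2 + θ)

/-- The positive root `σ` of `σ² = 2 y σ + θ`, where `w` is `smoothAbs θ y`. -/
noncomputable def charRoot (θ y : ℝ) : ℝ := y + smoothAbs θ y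

/-- The function `Q = y (N + e^{1 - N})` with `N = w / y + 1 - log σ` (where `w` is `smoothAbs θ y`
and `σ` is `charRoot θ y`), written so that it makes sense and is smooth also at `y = 0`. -/
noncomputable def coreDenom (θ y : ℝ) : ℝ :=
  smoothAbs θ y + y * (1 - Real.log (charRoot θ y)) +
    y * charRoot θ y * expNegInvGlue (y / smoothAbs θ y)

/-- The derivative of `coreDenom θ y` with respect to `y`. -/
noncomputable def coreDenomY (θ y : ℝ) : ℝ :=
  1 - Real.log (charRoot θ y) + charRoot θ y ^ 2 / smoothAbs θ y *
    ((y / smoothAbs θ y)⁻¹ * expNegInvGlue (y / smoothAbs θ y))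

/-- The second derivative of `coreDenom θ y` with respect to `y`. -/
noncomputable def coreDenomYY (θ y : ℝ) : ℝ :=
  -(smoothAbs θ y)⁻¹ + charRoot θ y ^ 2 / smoothAbs θ y *
    ((2 / smoothAbs θ y - y / smoothAbs θ y ^ 2) *
        ((y / smoothAbs θ y)⁻¹ * expNegInvGlue (y / smoothAbs θ y)) +
      θ / smoothAbs θ y ^ 3 * (((y / smoothAbs θ y)⁻¹ ^ 3 - (y / smoothAbs θ y)⁻¹ ^ 2) *
        expNegInvGlue (y / smoothAbs θ y)))

theorem hasDerivAt_expNegInvGlue (z : ℝ) :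
    HasDerivAt expNegInvGlue (z⁻¹ ^ 2 * expNegInvGlue z) z := by
  simpa using expNegInvGlue.hasDerivAt_polynomial_eval_inv_mul 1 z

theorem hasDerivAt_inv_mul_expNegInvGlue (z : ℝ) :
    HasDerivAt (fun z => z⁻¹ * expNegInvGlue z)
      ((z⁻¹ ^ 3 - z⁻¹ ^ 2) * expNegInvGlue z) z := by
  convert expNegInvGlue.hasDerivAt_polynomial_eval_inv_mul Polynomial.X z using 1
  · simp
  · simp only [Polynomial.derivative_X, Polynomial.eval_mul, Polynomial.eval_pow,
      Polynomial.eval_X, Polynomial.eval_sub, Polynomial.eval_one]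
    ring

theorem inv_mul_expNegInvGlue (z : ℝ) :
    z⁻¹ * expNegInvGlue z = z * (z⁻¹ ^ 2 * expNegInvGlue z) := by
  rcases eq_or_ne z 0 with rfl | hz
  · simp
  · field_simp

theorem expNegInvGlue_eq_mul (z : ℝ) : expNegInvGlue z = z * (z⁻¹ * expNegInvGlue z) := by
  rcases eq_or_ne z 0 with rfl | hz
  · simp
  · field_simp

section derivatives
variable {θ y : ℝ}

theorem smoothAbs_pos (hθ : 0 < θ) (y : ℝ) : 0 < smoothAbs θ y :=
  Real.sqrt_pos.2 (by positivity)

theorem smoothAbs_sq (hθ : 0 ≤ θ) (y : ℝ) : smoothAbs θ y ^ 2 = y ^ 2 + θ :=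
  Real.sq_sqrt (by positivity)

theorem charRoot_pos (hθ : 0 < θ) (y : ℝ) : 0 < charRoot θ y := by
  have h : |y| < smoothAbs θ y := Real.lt_sqrt_of_sq_lt (by rw [sq_abs]; linarith)
  rw [charRoot]
  linarith [neg_abs_le y]

variable {z θ' y' : ℝ} {T Y : ℝ → ℝ}

theorem hasDerivAt_smoothAbs (hT : HasDerivAt T θ' z) (hY : HasDerivAt Y y' z) (hpos : 0 < T z) :
    HasDerivAt (fun z => smoothAbs (T z) (Y z))
      ((2 * Y z * y' + θ') / (2 * smoothAbs (T z) (Y z))) z := by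
  refine (((hY.pow 2).add hT).sqrt (ne_of_gt ?_)).congr_deriv ?_
  · simp only [Pi.add_apply, Pi.pow_apply]
    positivity
  · simp [smoothAbs]

theorem hasDerivAt_charRoot (hT : HasDerivAt T θ' z) (hY : HasDerivAt Y y' z) (hpos : 0 < T z) :
    HasDerivAt (fun z => charRoot (T z) (Y z))
      ((2 * charRoot (T z) (Y z) * y' + θ') / (2 * smoothAbs (T z) (Y z))) z := by
  refine (hY.add (hasDerivAt_smoothAbs hT hY hpos)).congr_deriv ?_
  have := smoothAbs_pos hpos (Y z)
  rw [charRoot]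
  field_simp
  ring

theorem hasDerivAt_div_smoothAbs (hT : HasDerivAt T θ' z) (hY : HasDerivAt Y y' z)
    (hpos : 0 < T z) :
    HasDerivAt (fun z => Y z / smoothAbs (T z) (Y z))
      ((2 * T z * y' - Y z * θ') / (2 * smoothAbs (T z) (Y z) ^ 3)) z := by
  have hw := smoothAbs_pos hpos (Y z)
  refine (hY.div (hasDerivAt_smoothAbs hT hY hpos) hw.ne').congr_deriv ?_
  have hw2 := smoothAbs_sq hpos.le (Y z)
  field_simp
  linear_combination (2 * y') * hw2

theorem hasDerivAt_coreDenom (hT : HasDerivAt T θ' z) (hY : HasDerivAt Y y' z) (hpos : 0 < T z) :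
    HasDerivAt (fun z => coreDenom (T z) (Y z))
      (coreDenomY (T z) (Y z) * y' +
        ((charRoot (T z) (Y z))⁻¹ - expNegInvGlue (Y z / smoothAbs (T z) (Y z))) / 2 * θ') z := by
  have hw := smoothAbs_pos hpos (Y z)
  have hs := charRoot_pos hpos (Y z)
  have dw := hasDerivAt_smoothAbs hT hY hpos
  have ds := hasDerivAt_charRoot hT hY hpos
  have dg := (hasDerivAt_expNegInvGlue _).comp z (hasDerivAt_div_smoothAbs hT hY hpos)
  refine ((dw.add (hY.mul ((ds.log hs.ne').const_sub 1))).add ((hY.mul ds).mul dg)).congr_deriv ?_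
  have hθ : T z = smoothAbs (T z) (Y z) ^ 2 - Y z ^ 2 := by
    rw [smoothAbs_sq hpos.le]; ring
  have hg₁ := inv_mul_expNegInvGlue (Y z / smoothAbs (T z) (Y z))
  have hg₀ := expNegInvGlue_eq_mul (Y z / smoothAbs (T z) (Y z))
  simp only [Function.comp_apply, Pi.mul_apply, coreDenomY]
  have hs' : charRoot (T z) (Y z) = Y z + smoothAbs (T z) (Y z) := rfl
  generalize (Y z / smoothAbs (T z) (Y z))⁻¹ ^ 2 *
    expNegInvGlue (Y z / smoothAbs (T z) (Y z)) = e at *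
  generalize (Y z / smoothAbs (T z) (Y z))⁻¹ *
    expNegInvGlue (Y z / smoothAbs (T z) (Y z)) = e₁ at *
  generalize expNegInvGlue (Y z / smoothAbs (T z) (Y z)) = e₀ at *
  generalize smoothAbs (T z) (Y z) = w at *
  generalize charRoot (T z) (Y z) = s at *
  rw [hθ, hg₀, hg₁, hs']
  rw [hs'] at hs
  generalize Real.log (Y z + w) = l
  field_simp
  ring

theorem hasDerivAt_coreDenomY (hθ : 0 < θ) (y : ℝ) :
    HasDerivAt (coreDenomY θ) (coreDenomYY θ y) y := by
  have hw := smoothAbs_pos hθ y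
  have hs := charRoot_pos hθ y
  have dw := hasDerivAt_smoothAbs (hasDerivAt_const y θ) (hasDerivAt_id y) hθ
  have ds := hasDerivAt_charRoot (hasDerivAt_const y θ) (hasDerivAt_id y) hθ
  have dg := (hasDerivAt_inv_mul_expNegInvGlue _).comp y
    (hasDerivAt_div_smoothAbs (hasDerivAt_const y θ) (hasDerivAt_id y) hθ)
  refine (((ds.log hs.ne').const_sub 1).add (((ds.pow 2).div dw hw.ne').mul dg)).congr_deriv ?_
  have hs' : charRoot θ y = y + smoothAbs θ y := rfl
  simp only [id, Function.comp_apply, coreDenomYY, Pi.pow_apply, Pi.div_apply]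
  generalize (y / smoothAbs θ y)⁻¹ * expNegInvGlue (y / smoothAbs θ y) = e₁
  generalize ((y / smoothAbs θ y)⁻¹ ^ 3 - (y / smoothAbs θ y)⁻¹ ^ 2) *
    expNegInvGlue (y / smoothAbs θ y) = e₂
  generalize smoothAbs θ y = w at *
  generalize charRoot θ y = s at *
  subst hs'
  field_simp
  ring

theorem mul_coreDenomY_add_smoothAbs_sub (hθ : 0 < θ) (y : ℝ) :
    y * coreDenomY θ y + smoothAbs θ y -
      charRoot θ y * smoothAbs θ y * expNegInvGlue (y / smoothAbs θ y) = coreDenom θ y := by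
  have hw := smoothAbs_pos hθ y
  have hg := expNegInvGlue_eq_mul (y / smoothAbs θ y)
  simp only [coreDenom, coreDenomY]
  generalize (y / smoothAbs θ y)⁻¹ * expNegInvGlue (y / smoothAbs θ y) = e₁ at *
  rw [hg, charRoot]
  field_simp
  ring

end derivatives

theorem inv_pow_mul_expNegInvGlue_nonneg {z : ℝ} (hz : 0 ≤ z) (k : ℕ) :
    0 ≤ z⁻¹ ^ k * expNegInvGlue z :=
  mul_nonneg (pow_nonneg (inv_nonneg.2 hz) k) (expNegInvGlue.nonneg z)

theorem inv_pow_mul_expNegInvGlue_le {z : ℝ} (hz : 0 ≤ z) (k : ℕ) :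
    z⁻¹ ^ k * expNegInvGlue z ≤ k.factorial := by
  have hk : (0 : ℝ) < k.factorial := mod_cast k.factorial_pos
  rcases hz.eq_or_lt with rfl | hz
  · simp
  · have h := Real.pow_div_factorial_le_exp z⁻¹ (inv_nonneg.2 hz.le) k
    rw [expNegInvGlue, if_neg hz.not_ge, Real.exp_neg, ← div_eq_mul_inv,
      div_le_iff₀ (Real.exp_pos _), mul_comm]
    rwa [div_le_iff₀ hk] at h

theorem abs_inv_mul_expNegInvGlue_le {z : ℝ} (hz : 0 ≤ z) : |z⁻¹ * expNegInvGlue z| ≤ 1 := by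
  rw [← pow_one z⁻¹, abs_of_nonneg (inv_pow_mul_expNegInvGlue_nonneg hz 1)]
  simpa using inv_pow_mul_expNegInvGlue_le hz 1

theorem abs_inv_pow_sub_mul_expNegInvGlue_le {z : ℝ} (hz : 0 ≤ z) :
    |(z⁻¹ ^ 3 - z⁻¹ ^ 2) * expNegInvGlue z| ≤ 6 := by
  have h₂ : z⁻¹ ^ 2 * expNegInvGlue z ≤ 2 := inv_pow_mul_expNegInvGlue_le hz 2
  have h₃ : z⁻¹ ^ 3 * expNegInvGlue z ≤ 6 := inv_pow_mul_expNegInvGlue_le hz 3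
  rw [sub_mul, abs_le]
  constructor <;> linarith [inv_pow_mul_expNegInvGlue_nonneg hz 2,
    inv_pow_mul_expNegInvGlue_nonneg hz 3]

theorem one_add_half_exp_neg_le (x : ℝ) : 1 + Real.exp (-x) / 2 ≤ 1 + x + Real.exp (-x) := by
  have h := Real.add_one_le_exp (-x / 2)
  have hsq : Real.exp (-x) = Real.exp (-x / 2) ^ 2 := by
    rw [← Real.exp_nat_mul]; ring_nf
  rw [hsq]
  linarith [sq_nonneg (Real.exp (-x / 2) - 2)]

theorem one_add_half_abs_le (x : ℝ) : 1 + |x| / 2 ≤ 1 + x + Real.exp (-x) := by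
  rcases abs_cases x with ⟨h, hx⟩ | ⟨h, hx⟩
  · linarith [Real.exp_pos (-x)]
  · linarith [one_add_half_exp_neg_le x, Real.add_one_le_exp (-x)]

section bounds
variable {θ y : ℝ}

theorem smoothAbs_nonneg (θ y : ℝ) : 0 ≤ smoothAbs θ y := Real.sqrt_nonneg _

theorem le_smoothAbs (hθ : 0 ≤ θ) (y : ℝ) : y ≤ smoothAbs θ y :=
  Real.le_sqrt_of_sq_le (by linarith)

theorem sqrt_le_smoothAbs (θ y : ℝ) : √θ ≤ smoothAbs θ y :=
  Real.sqrt_le_sqrt (by linarith [sq_nonneg y])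

theorem smoothAbs_pos_of_pos (hθ : 0 ≤ θ) (hy : 0 < y) : 0 < smoothAbs θ y :=
  hy.trans_le (le_smoothAbs hθ y)

theorem smoothAbs_le_of_le_sq (hy : 0 ≤ y) (h : θ ≤ y ^ 2) : smoothAbs θ y ≤ 3 / 2 * y :=
  Real.sqrt_le_iff.2 ⟨by positivity, by nlinarith⟩

theorem smoothAbs_le_of_sq_le (h : y ^ 2 ≤ θ) : smoothAbs θ y ≤ 3 / 2 * √θ := by
  have hθ : 0 ≤ θ := (sq_nonneg y).trans h
  exact Real.sqrt_le_iff.2 ⟨by positivity, by rw [mul_pow, Real.sq_sqrt hθ]; linarith⟩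

theorem charRoot_le_of_sq_le (h : y ^ 2 ≤ θ) : charRoot θ y ≤ 5 / 2 * √θ := by
  rw [charRoot]
  linarith [smoothAbs_le_of_sq_le h, Real.le_sqrt_of_sq_le h]

theorem smoothAbs_le_charRoot (hy : 0 ≤ y) : smoothAbs θ y ≤ charRoot θ y :=
  le_add_of_nonneg_left hy

theorem charRoot_le (hθ : 0 ≤ θ) : charRoot θ y ≤ 2 * smoothAbs θ y := by
  rw [charRoot]
  linarith [le_smoothAbs hθ y]

theorem coreDenom_eq_mul (hθ : 0 ≤ θ) (hy : 0 < y) :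
    coreDenom θ y = y * (1 + (smoothAbs θ y / y - Real.log (charRoot θ y)) +
      Real.exp (-(smoothAbs θ y / y - Real.log (charRoot θ y)))) := by
  have hw := smoothAbs_pos_of_pos hθ hy
  have hs : 0 < charRoot θ y := hw.trans_le (smoothAbs_le_charRoot hy.le)
  rw [coreDenom, expNegInvGlue, if_neg (div_pos hy hw).not_ge, inv_div, neg_sub,
    sub_eq_add_neg (Real.log _) (_ / _), Real.exp_add, Real.exp_log hs]
  field_simp
  ring

theorem log_charRoot_le (hθ : 0 < θ) (h : y ^ 2 ≤ θ) :
    Real.log (charRoot θ y) ≤ 23 / 25 + Real.log θ / 2 := by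
  have hlog : Real.log (5 / 2) ≤ 23 / 25 := by
    rw [Real.log_div (by norm_num) (by norm_num)]
    linarith [Real.log_five_lt_d9, Real.log_two_gt_d9]
  calc Real.log (charRoot θ y) ≤ Real.log (5 / 2 * √θ) :=
        Real.log_le_log (charRoot_pos hθ y) (charRoot_le_of_sq_le h)
    _ = Real.log (5 / 2) + Real.log θ / 2 := by
        rw [Real.log_mul (by norm_num) (Real.sqrt_pos.2 hθ).ne', Real.log_sqrt hθ.le]
    _ ≤ 23 / 25 + Real.log θ / 2 := by linarith

theorem le_log_charRoot (hθ : 0 < θ) (hy : 0 ≤ y) : Real.log θ / 2 ≤ Real.log (charRoot θ y) := by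
  rw [← Real.log_sqrt hθ.le]
  exact Real.log_le_log (Real.sqrt_pos.2 hθ)
    ((sqrt_le_smoothAbs θ y).trans (smoothAbs_le_charRoot hy))

theorem le_coreDenom_of_sq_le (hθ : 0 < θ) (hθ₁ : θ ≤ 1) (hy : 0 ≤ y) (h : y ^ 2 ≤ θ) :
    smoothAbs θ y + 2 / 25 * (y * (1 - Real.log θ)) ≤ coreDenom θ y := by
  have hL : 2 / 25 * (1 - Real.log θ) ≤ 1 - Real.log (charRoot θ y) := by
    linarith [log_charRoot_le hθ h, Real.log_nonpos hθ.le hθ₁]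
  have hg : 0 ≤ y * charRoot θ y * expNegInvGlue (y / smoothAbs θ y) :=
    mul_nonneg (mul_nonneg hy (charRoot_pos hθ y).le) (expNegInvGlue.nonneg _)
  rw [coreDenom]
  linarith [mul_le_mul_of_nonneg_left hL hy]

theorem coreDenom_le_of_sq_le (hθ : 0 < θ) (hθ₁ : θ ≤ 1) (hy : 0 ≤ y) (h : y ^ 2 ≤ θ) :
    coreDenom θ y ≤ 5 * (√θ * (1 - Real.log θ)) := by
  have hτ : 0 < √θ := Real.sqrt_pos.2 hθ
  have hτ₁ : √θ ≤ 1 := Real.sqrt_le_one.2 hθ₁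
  have hyτ : y ≤ √θ := Real.le_sqrt_of_sq_le h
  have hlog : Real.log θ ≤ 0 := Real.log_nonpos hθ.le hθ₁
  have hmid : y * (1 - Real.log (charRoot θ y)) ≤ √θ * (1 - Real.log θ) := by
    have h₀ : 0 ≤ 1 - Real.log (charRoot θ y) := by linarith [log_charRoot_le hθ h]
    exact mul_le_mul hyτ (by linarith [le_log_charRoot hθ hy]) h₀ hτ.le
  have hlast : y * charRoot θ y * expNegInvGlue (y / smoothAbs θ y) ≤ 5 / 2 * √θ := by
    have hg : expNegInvGlue (y / smoothAbs θ y) ≤ 1 := by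
      simpa using inv_pow_mul_expNegInvGlue_le (div_nonneg hy (smoothAbs_pos hθ y).le) 0
    calc y * charRoot θ y * expNegInvGlue (y / smoothAbs θ y) ≤ 1 * (5 / 2 * √θ) * 1 := by
          gcongr
          · exact expNegInvGlue.nonneg _
          · exact (charRoot_pos hθ y).le
          · exact hyτ.trans hτ₁
          · exact charRoot_le_of_sq_le h
      _ = 5 / 2 * √θ := by ring
  rw [coreDenom]
  linarith [smoothAbs_le_of_sq_le h, mul_nonpos_of_nonneg_of_nonpos hτ.le hlog]

theorem le_coreDenom_of_le_sq (hθ : 0 ≤ θ) (hy : 0 < y) (h : θ ≤ y ^ 2) :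
    y * (1 + |Real.log y|) / 4 ≤ coreDenom θ y := by
  have hw₁ := le_smoothAbs hθ y
  have hw₂ := smoothAbs_le_of_le_sq hy.le h
  have hlog : Real.log (charRoot θ y) - Real.log y ∈ Icc 0 1 := by
    have hs : charRoot θ y / y ∈ Icc 2 (5 / 2) := by
      rw [charRoot, mem_Icc, le_div_iff₀ hy, div_le_iff₀ hy]
      constructor <;> linarith
    rw [← Real.log_div (hy.trans_le (hw₁.trans (smoothAbs_le_charRoot hy.le))).ne' hy.ne']
    refine ⟨Real.log_nonneg (by linarith [hs.1]), ?_⟩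
    rw [Real.log_le_iff_le_exp (by linarith [hs.1])]
    linarith [hs.2, Real.exp_one_gt_d9]
  have hratio : smoothAbs θ y / y ∈ Icc 1 (3 / 2) := by
    rw [mem_Icc, le_div_iff₀ hy, div_le_iff₀ hy]
    constructor <;> linarith
  set x := smoothAbs θ y / y - Real.log (charRoot θ y)
  have habs : |Real.log y| ≤ |x| + 3 / 2 := by
    have hclose : |x + Real.log y| ≤ 3 / 2 := by
      rw [abs_le]
      constructor <;> linarith [hlog.1, hlog.2, hratio.1, hratio.2]
    calc |Real.log y| = |(x + Real.log y) - x| := by ring_nf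
      _ ≤ |x + Real.log y| + |x| := abs_sub _ _
      _ ≤ |x| + 3 / 2 := by linarith
  rw [coreDenom_eq_mul hθ hy, mul_div_assoc]
  gcongr
  linarith [one_add_half_abs_le x, abs_nonneg x]

theorem one_div_five_le_exp_neg_three_div_two : (1 / 5 : ℝ) ≤ Real.exp (-(3 / 2)) := by
  have hsq : Real.exp (3 / 2) ^ 2 ≤ 5 ^ 2 := by
    calc Real.exp (3 / 2) ^ 2 = Real.exp 1 ^ 3 := by
          rw [← Real.exp_nat_mul, ← Real.exp_nat_mul]; norm_num
      _ ≤ 2.7182818286 ^ 3 := by gcongr; exact Real.exp_one_lt_d9.le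
      _ ≤ 5 ^ 2 := by norm_num
  rw [Real.exp_neg, one_div]
  gcongr
  exact (abs_le_of_sq_le_sq' hsq (by norm_num)).2

theorem smoothAbs_mul_one_add_le (hθ : 0 ≤ θ) (hθ₁ : θ ≤ 1) (hy : 0 ≤ y)
    (hw : 0 < smoothAbs θ y) :
    smoothAbs θ y * (1 + smoothAbs θ y) ≤ 20 * coreDenom θ y := by
  rcases le_or_gt (y ^ 2) θ with h | h
  · have hθ₀ : 0 < θ := by
      refine hθ.lt_of_ne ?_
      rintro rfl
      rw [smoothAbs, add_zero, Real.sqrt_sq hy] at hw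
      exact (pow_pos hw 2).not_ge h
    have hw₁ : smoothAbs θ y ≤ 3 / 2 :=
      (smoothAbs_le_of_sq_le h).trans (by linarith [Real.sqrt_le_one.2 hθ₁])
    have hL : 0 ≤ y * (1 - Real.log θ) :=
      mul_nonneg hy (by linarith [Real.log_nonpos hθ hθ₁])
    nlinarith [le_coreDenom_of_sq_le hθ₀ hθ₁ hy h]
  · have hy₀ : 0 < y := hy.lt_of_ne (by rintro rfl; linarith [zero_pow (M₀ := ℝ) two_ne_zero])
    have hwy := smoothAbs_le_of_le_sq hy h.le
    have hs := smoothAbs_le_charRoot (θ := θ) hy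
    have hexp : smoothAbs θ y / 5 ≤
        Real.exp (-(smoothAbs θ y / y - Real.log (charRoot θ y))) := by
      have hratio : -(3 / 2) ≤ -(smoothAbs θ y / y) := neg_le_neg ((div_le_iff₀ hy₀).2 hwy)
      rw [neg_sub, sub_eq_add_neg, Real.exp_add, Real.exp_log (hw.trans_le hs), div_eq_mul_one_div]
      exact mul_le_mul hs (one_div_five_le_exp_neg_three_div_two.trans (Real.exp_le_exp.2 hratio))
        (by norm_num) (hw.le.trans hs)
    have hQ : y * (1 + smoothAbs θ y / 10) ≤ coreDenom θ y := by
      rw [coreDenom_eq_mul hθ hy₀]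
      refine mul_le_mul_of_nonneg_left ?_ hy
      linarith [one_add_half_exp_neg_le (smoothAbs θ y / y - Real.log (charRoot θ y))]
    nlinarith

theorem coreDenom_pos (hθ : 0 ≤ θ) (hθ₁ : θ ≤ 1) (hy : 0 ≤ y) (hw : 0 < smoothAbs θ y) :
    0 < coreDenom θ y := by
  have := smoothAbs_mul_one_add_le hθ hθ₁ hy hw
  have : 0 < smoothAbs θ y * (1 + smoothAbs θ y) := by positivity
  linarith

theorem abs_coreDenomY_mul_smoothAbs_le (hθ : 0 < θ) (hθ₁ : θ ≤ 1) (hy : 0 ≤ y) :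
    |coreDenomY θ y| * smoothAbs θ y ≤ 120 * (1 - Real.log θ) * coreDenom θ y := by
  have hw := smoothAbs_pos hθ y
  have hs := charRoot_pos hθ y
  have hs₂ := charRoot_le (y := y) hθ.le
  have hL : 1 ≤ 1 - Real.log θ := by linarith [Real.log_nonpos hθ.le hθ₁]
  have hz : 0 ≤ y / smoothAbs θ y := by positivity
  have hlog : |1 - Real.log (charRoot θ y)| ≤ (1 - Real.log θ) + 2 * smoothAbs θ y := by
    rw [abs_le]
    constructor <;> linarith [le_log_charRoot hθ hy, Real.log_le_sub_one_of_pos hs]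
  have hflat : |charRoot θ y ^ 2 / smoothAbs θ y *
      ((y / smoothAbs θ y)⁻¹ * expNegInvGlue (y / smoothAbs θ y))| ≤ 4 * smoothAbs θ y := by
    rw [abs_mul, abs_of_pos (by positivity)]
    calc _ ≤ (2 * smoothAbs θ y) ^ 2 / smoothAbs θ y * 1 := by
          gcongr
          exact abs_inv_mul_expNegInvGlue_le hz
      _ = 4 * smoothAbs θ y := by field_simp; norm_num
  have habs : |coreDenomY θ y| ≤ 6 * (1 - Real.log θ) * (1 + smoothAbs θ y) := by
    refine (abs_add_le _ _).trans ?_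
    nlinarith
  calc |coreDenomY θ y| * smoothAbs θ y
      ≤ 6 * (1 - Real.log θ) * (1 + smoothAbs θ y) * smoothAbs θ y := by gcongr
    _ = 6 * (1 - Real.log θ) * (smoothAbs θ y * (1 + smoothAbs θ y)) := by ring
    _ ≤ 6 * (1 - Real.log θ) * (20 * coreDenom θ y) :=
        mul_le_mul_of_nonneg_left (smoothAbs_mul_one_add_le hθ.le hθ₁ hy hw) (by positivity)
    _ = 120 * (1 - Real.log θ) * coreDenom θ y := by ring

theorem abs_coreDenomYY_mul_smoothAbs_sq_le (hθ : 0 < θ) (hθ₁ : θ ≤ 1) (hy : 0 ≤ y) :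
    |coreDenomYY θ y| * smoothAbs θ y ^ 2 ≤ 720 * coreDenom θ y := by
  have hw := smoothAbs_pos hθ y
  have hyw := le_smoothAbs hθ.le y
  have hz : 0 ≤ y / smoothAbs θ y := by positivity
  have hB : |charRoot θ y ^ 2 / smoothAbs θ y| ≤ 4 * smoothAbs θ y := by
    rw [abs_of_nonneg (by positivity), div_le_iff₀ hw]
    nlinarith [charRoot_pos hθ y, charRoot_le (y := y) hθ.le]
  have hc₁ : |2 / smoothAbs θ y - y / smoothAbs θ y ^ 2| ≤ 3 / smoothAbs θ y := by
    rw [show 2 / smoothAbs θ y - y / smoothAbs θ y ^ 2 =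
      (2 - y / smoothAbs θ y) / smoothAbs θ y by field_simp, abs_div, abs_of_pos hw]
    have : y / smoothAbs θ y ≤ 1 := (div_le_one hw).2 hyw
    gcongr
    rw [abs_le]
    constructor <;> linarith
  have hc₂ : |θ / smoothAbs θ y ^ 3| ≤ 1 / smoothAbs θ y := by
    rw [abs_of_pos (by positivity), div_le_div_iff₀ (by positivity) hw]
    nlinarith [smoothAbs_sq hθ.le y, sq_nonneg y]
  have habs : |coreDenomYY θ y| ≤ 1 / smoothAbs θ y +
      4 * smoothAbs θ y * (3 / smoothAbs θ y * 1 + 1 / smoothAbs θ y * 6) := by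
    refine (abs_add_le _ _).trans (add_le_add ?_ ?_)
    · rw [abs_neg, abs_inv, abs_of_pos hw, one_div]
    · rw [abs_mul]
      gcongr
      refine (abs_add_le _ _).trans (add_le_add ?_ ?_)
      · rw [abs_mul]
        gcongr
        exact abs_inv_mul_expNegInvGlue_le hz
      · rw [abs_mul]
        gcongr
        exact abs_inv_pow_sub_mul_expNegInvGlue_le hz
  calc |coreDenomYY θ y| * smoothAbs θ y ^ 2
      ≤ (1 / smoothAbs θ y + 4 * smoothAbs θ y * (3 / smoothAbs θ y * 1 +
          1 / smoothAbs θ y * 6)) * smoothAbs θ y ^ 2 := by gcongr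
    _ = smoothAbs θ y * (1 + 36 * smoothAbs θ y) := by field_simp; ring
    _ ≤ 36 * (smoothAbs θ y * (1 + smoothAbs θ y)) := by nlinarith
    _ ≤ 720 * coreDenom θ y := by linarith [smoothAbs_mul_one_add_le hθ.le hθ₁ hy hw]

end bounds

/-- The exponent `κ` for which `√w Q ^ (-κ)` solves the continuity equation in dimension `n`. -/
noncomputable def coreExponent (n : ℕ) : ℝ := (n + 2) / 4

theorem coreExponent_pos (n : ℕ) : 0 < coreExponent n := by
  rw [coreExponent]
  positivity

/-- The logarithm of the amplitude `√w Q ^ (-κ)` of the solution, as a function of `θ` and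
`y = |x|²`. -/
noncomputable def logAmplitude (n : ℕ) (θ y : ℝ) : ℝ :=
  Real.log (smoothAbs θ y) / 2 - coreExponent n * Real.log (coreDenom θ y)

/-- The derivative of `logAmplitude n θ y` with respect to `y`. -/
noncomputable def logAmplitudeY (n : ℕ) (θ y : ℝ) : ℝ :=
  y / (2 * smoothAbs θ y ^ 2) - coreExponent n * (coreDenomY θ y / coreDenom θ y)

/-- The second derivative of `logAmplitude n θ y` with respect to `y`. -/
noncomputable def logAmplitudeYY (n : ℕ) (θ y : ℝ) : ℝ :=
  1 / (2 * smoothAbs θ y ^ 2) - y ^ 2 / smoothAbs θ y ^ 4 -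
    coreExponent n * (coreDenomYY θ y / coreDenom θ y - (coreDenomY θ y / coreDenom θ y) ^ 2)

/-- The phase of the solution; `θ₁` stands for the time derivative of `θ`. -/
noncomputable def phase (θ θ₁ y : ℝ) : ℝ := θ₁ / (16 * charRoot θ y)

/-- The derivative of `phase θ θ₁ y` with respect to `y`. -/
noncomputable def phaseY (θ θ₁ y : ℝ) : ℝ := -θ₁ / (16 * charRoot θ y * smoothAbs θ y)

/-- The second derivative of `phase θ θ₁ y` with respect to `y`. -/
noncomputable def phaseYY (θ θ₁ y : ℝ) : ℝ := θ₁ / (16 * smoothAbs θ y ^ 3)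

/-- The time derivative of the phase; `θ₁` and `θ₂` stand for the first two time derivatives
of `θ`. -/
noncomputable def phaseT (θ θ₁ θ₂ y : ℝ) : ℝ :=
  θ₂ / (16 * charRoot θ y) - θ₁ ^ 2 / (32 * charRoot θ y ^ 2 * smoothAbs θ y)

/-- The solution as a function of `θ`, of its time derivative `θ₁`, and of `y = |x|²`. -/
noncomputable def profile (n : ℕ) (θ θ₁ y : ℝ) : ℂ :=
  Complex.exp (logAmplitude n θ y + Complex.I * phase θ θ₁ y)

/-- The derivative of `profile n θ θ₁ y` with respect to `y`. -/
noncomputable def profileY (n : ℕ) (θ θ₁ y : ℝ) : ℂ :=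
  (logAmplitudeY n θ y + Complex.I * phaseY θ θ₁ y) * profile n θ θ₁ y

/-- The second derivative of `profile n θ θ₁ y` with respect to `y`. -/
noncomputable def profileYY (n : ℕ) (θ θ₁ y : ℝ) : ℂ :=
  (logAmplitudeYY n θ y + Complex.I * phaseYY θ θ₁ y +
    (logAmplitudeY n θ y + Complex.I * phaseY θ θ₁ y) ^ 2) * profile n θ θ₁ y

/-- The potential as a function of `θ`, of its first two time derivatives `θ₁` and `θ₂`, and of
`y = |x|²`. On radial functions of `x ∈ ℝⁿ` the Laplacian is `4 y ∂²/∂y² + 2 n ∂/∂y`. -/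
noncomputable def radialPotential (n : ℕ) (θ θ₁ θ₂ y : ℝ) : ℝ :=
  4 * y * (logAmplitudeYY n θ y + logAmplitudeY n θ y ^ 2 - phaseY θ θ₁ y ^ 2) +
    2 * n * logAmplitudeY n θ y + phaseT θ θ₁ θ₂ y

section equation
variable {n : ℕ} {θ θ₁ θ₂ y : ℝ}

theorem hasDerivAt_logAmplitude (hθ : 0 < θ) (hθ₁ : θ ≤ 1) (hy : 0 ≤ y) :
    HasDerivAt (logAmplitude n θ) (logAmplitudeY n θ y) y := by
  have hw := smoothAbs_pos hθ y
  have hQ := coreDenom_pos hθ.le hθ₁ hy hw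
  have dw := hasDerivAt_smoothAbs (hasDerivAt_const y θ) (hasDerivAt_id y) hθ
  have dQ := hasDerivAt_coreDenom (hasDerivAt_const y θ) (hasDerivAt_id y) hθ
  refine (((dw.log hw.ne').div_const 2).sub ((dQ.log hQ.ne').const_mul
    (coreExponent n))).congr_deriv ?_
  simp only [id, logAmplitudeY]
  field_simp
  ring

theorem hasDerivAt_logAmplitudeY (hθ : 0 < θ) (hθ₁ : θ ≤ 1) (hy : 0 ≤ y) :
    HasDerivAt (logAmplitudeY n θ) (logAmplitudeYY n θ y) y := by
  have hw := smoothAbs_pos hθ y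
  have hQ := coreDenom_pos hθ.le hθ₁ hy hw
  have dw := hasDerivAt_smoothAbs (hasDerivAt_const y θ) (hasDerivAt_id y) hθ
  have dQ := hasDerivAt_coreDenom (hasDerivAt_const y θ) (hasDerivAt_id y) hθ
  have dQY := hasDerivAt_coreDenomY hθ y
  refine (((hasDerivAt_id y).div ((dw.pow 2).const_mul 2)
    (mul_pos (by norm_num) (pow_pos hw 2)).ne').sub
    ((dQY.div dQ hQ.ne').const_mul (coreExponent n))).congr_deriv ?_
  simp only [id, logAmplitudeYY, Pi.pow_apply]
  field_simp
  ring

theorem hasDerivAt_phase (hθ : 0 < θ) (y : ℝ) :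
    HasDerivAt (phase θ θ₁) (phaseY θ θ₁ y) y := by
  have hw := smoothAbs_pos hθ y
  have hs := charRoot_pos hθ y
  have ds := hasDerivAt_charRoot (hasDerivAt_const y θ) (hasDerivAt_id y) hθ
  refine ((hasDerivAt_const y θ₁).div (ds.const_mul 16)
    (mul_pos (by norm_num) hs).ne').congr_deriv ?_
  simp only [id, phaseY]
  field_simp
  ring

theorem hasDerivAt_phaseY (hθ : 0 < θ) (y : ℝ) :
    HasDerivAt (phaseY θ θ₁) (phaseYY θ θ₁ y) y := by
  have hw := smoothAbs_pos hθ y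
  have hs := charRoot_pos hθ y
  have dw := hasDerivAt_smoothAbs (hasDerivAt_const y θ) (hasDerivAt_id y) hθ
  have ds := hasDerivAt_charRoot (hasDerivAt_const y θ) (hasDerivAt_id y) hθ
  refine ((hasDerivAt_const y (-θ₁)).div ((ds.const_mul 16).mul dw)
    (mul_pos (mul_pos (by norm_num) hs) hw).ne').congr_deriv ?_
  simp only [id, Pi.mul_apply, phaseYY]
  have hs' : charRoot θ y = y + smoothAbs θ y := rfl
  field_simp
  rw [hs']
  ring

theorem hasDerivAt_profile (hθ : 0 < θ) (hθ₁ : θ ≤ 1) (hy : 0 ≤ y) :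
    HasDerivAt (profile n θ θ₁) (profileY n θ θ₁ y) y :=
  ((hasDerivAt_logAmplitude hθ hθ₁ hy).ofReal_comp.add
    ((hasDerivAt_phase hθ y).ofReal_comp.const_mul Complex.I)).cexp.congr_deriv (mul_comm _ _)

theorem hasDerivAt_profileY (hθ : 0 < θ) (hθ₁ : θ ≤ 1) (hy : 0 ≤ y) :
    HasDerivAt (profileY n θ θ₁) (profileYY n θ θ₁ y) y := by
  refine (((hasDerivAt_logAmplitudeY hθ hθ₁ hy).ofReal_comp.add
    ((hasDerivAt_phaseY hθ y).ofReal_comp.const_mul Complex.I)).mul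
    (hasDerivAt_profile hθ hθ₁ hy)).congr_deriv ?_
  simp only [profileY, profileYY, Pi.add_apply]
  ring

/-- The continuity equation `∂ₜ|u|² = 2 div (|u|² ∇φ)` of the radial amplitude, in terms of
`log |u|`. -/
theorem continuity_equation (hθ : 0 < θ) (hθ₁ : θ ≤ 1) (hy : 0 ≤ y) :
    θ₁ * (1 / (4 * smoothAbs θ y ^ 2) - coreExponent n *
      (((charRoot θ y)⁻¹ - expNegInvGlue (y / smoothAbs θ y)) / (2 * coreDenom θ y))) =
      4 * y * (phaseYY θ θ₁ y + 2 * logAmplitudeY n θ y * phaseY θ θ₁ y) +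
        2 * n * phaseY θ θ₁ y := by
  have hw := smoothAbs_pos hθ y
  have hs := charRoot_pos hθ y
  have hQ := coreDenom_pos hθ.le hθ₁ hy hw
  have heuler := mul_coreDenomY_add_smoothAbs_sub hθ y
  have hs' : charRoot θ y = y + smoothAbs θ y := rfl
  have hQY : y * (coreDenomY θ y / coreDenom θ y) = 1 - (smoothAbs θ y -
      charRoot θ y * smoothAbs θ y * expNegInvGlue (y / smoothAbs θ y)) / coreDenom θ y := by
    field_simp
    linarith
  have hlog : y * logAmplitudeY n θ y = y ^ 2 / (2 * smoothAbs θ y ^ 2) - coreExponent n *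
      (1 - (smoothAbs θ y - charRoot θ y * smoothAbs θ y *
        expNegInvGlue (y / smoothAbs θ y)) / coreDenom θ y) := by
    rw [logAmplitudeY, ← hQY]
    ring
  rw [show ∀ a b c d e : ℝ, 4 * y * (a + 2 * b * c) + d * e =
    4 * y * a + 8 * (y * b) * c + d * e by intros; ring, hlog, phaseYY, phaseY, coreExponent]
  clear heuler hQY hlog
  generalize expNegInvGlue (y / smoothAbs θ y) = g
  generalize coreDenom θ y = Q at *
  generalize smoothAbs θ y = w at *
  generalize charRoot θ y = s at *
  subst hs'
  field_simp
  ring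

theorem hasDerivAt_profile_comp {T : ℝ → ℝ} {T₁ : ℝ → ℝ} {t : ℝ} (hT : HasDerivAt T (T₁ t) t)
    (hT₁ : HasDerivAt T₁ θ₂ t) (hpos : 0 < T t) (hle : T t ≤ 1) (hy : 0 ≤ y) :
    HasDerivAt (fun t => profile n (T t) (T₁ t) y)
      (Complex.I * (radialPotential n (T t) (T₁ t) θ₂ y * profile n (T t) (T₁ t) y -
        (4 * y * profileYY n (T t) (T₁ t) y + 2 * n * profileY n (T t) (T₁ t) y))) t := by
  have hw := smoothAbs_pos hpos y
  have hs := charRoot_pos hpos y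
  have hQ := coreDenom_pos hpos.le hle hy hw
  have dw := hasDerivAt_smoothAbs hT (hasDerivAt_const t y) hpos
  have ds := hasDerivAt_charRoot hT (hasDerivAt_const t y) hpos
  have dQ := hasDerivAt_coreDenom hT (hasDerivAt_const t y) hpos
  have dphase : HasDerivAt (fun t => phase (T t) (T₁ t) y) (phaseT (T t) (T₁ t) θ₂ y) t := by
    refine (hT₁.div (ds.const_mul 16) (by positivity)).congr_deriv ?_
    rw [phaseT]
    field_simp
    ring
  have damp : HasDerivAt (fun t => logAmplitude n (T t) y)
      (4 * y * (phaseYY (T t) (T₁ t) y + 2 * logAmplitudeY n (T t) y * phaseY (T t) (T₁ t) y) +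
        2 * n * phaseY (T t) (T₁ t) y) t := by
    refine (((dw.log hw.ne').div_const 2).sub ((dQ.log hQ.ne').const_mul
      (coreExponent n))).congr_deriv ?_
    rw [← continuity_equation hpos hle hy]
    field_simp
    ring
  refine (damp.ofReal_comp.add (dphase.ofReal_comp.const_mul Complex.I)).cexp.congr_deriv ?_
  simp only [profileY, profileYY, profile, radialPotential, Pi.add_apply]
  push_cast
  ring_nf
  simp only [Complex.I_sq, Complex.I_pow_three]
  ring

end equation

section potential_bounds
variable {n : ℕ} {θ θ₁ θ₂ y B : ℝ}

theorem abs_coreDenomY_div_mul_smoothAbs_le (hθ : 0 < θ) (hθ₁ : θ ≤ 1) (hy : 0 ≤ y) :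
    |coreDenomY θ y / coreDenom θ y| * smoothAbs θ y ≤ 120 * (1 - Real.log θ) := by
  have hQ := coreDenom_pos hθ.le hθ₁ hy (smoothAbs_pos hθ y)
  rw [abs_div, abs_of_pos hQ, div_mul_eq_mul_div, div_le_iff₀ hQ]
  exact abs_coreDenomY_mul_smoothAbs_le hθ hθ₁ hy

theorem abs_coreDenomYY_div_sub_sq_mul_smoothAbs_sq_le (hθ : 0 < θ) (hθ₁ : θ ≤ 1) (hy : 0 ≤ y) :
    |coreDenomYY θ y / coreDenom θ y - (coreDenomY θ y / coreDenom θ y) ^ 2| *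
      smoothAbs θ y ^ 2 ≤ 15120 * (1 - Real.log θ) ^ 2 := by
  have hQ := coreDenom_pos hθ.le hθ₁ hy (smoothAbs_pos hθ y)
  have hw := smoothAbs_nonneg θ y
  have hL : 1 ≤ (1 - Real.log θ) ^ 2 :=
    one_le_pow₀ (by linarith [Real.log_nonpos hθ.le hθ₁])
  have hYY : |coreDenomYY θ y / coreDenom θ y| * smoothAbs θ y ^ 2 ≤ 720 := by
    rw [abs_div, abs_of_pos hQ, div_mul_eq_mul_div, div_le_iff₀ hQ]
    exact abs_coreDenomYY_mul_smoothAbs_sq_le hθ hθ₁ hy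
  have hY := abs_coreDenomY_div_mul_smoothAbs_le hθ hθ₁ hy
  calc _ ≤ (|coreDenomYY θ y / coreDenom θ y| + |(coreDenomY θ y / coreDenom θ y) ^ 2|) *
        smoothAbs θ y ^ 2 := by gcongr; exact abs_sub _ _
    _ = |coreDenomYY θ y / coreDenom θ y| * smoothAbs θ y ^ 2 +
        (|coreDenomY θ y / coreDenom θ y| * smoothAbs θ y) ^ 2 := by rw [abs_pow]; ring
    _ ≤ 720 + (120 * (1 - Real.log θ)) ^ 2 := by gcongr
    _ ≤ 15120 * (1 - Real.log θ) ^ 2 := by linarith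

theorem abs_logAmplitudeY_mul_smoothAbs_le (hθ : 0 < θ) (hθ₁ : θ ≤ 1) (hy : 0 ≤ y) :
    |logAmplitudeY n θ y| * smoothAbs θ y ≤ (1 + 120 * coreExponent n) * (1 - Real.log θ) := by
  have hw := smoothAbs_pos hθ y
  have hκ := coreExponent_pos n
  have hL : 1 ≤ 1 - Real.log θ := by linarith [Real.log_nonpos hθ.le hθ₁]
  have h₁ : |y / (2 * smoothAbs θ y ^ 2)| * smoothAbs θ y ≤ 1 - Real.log θ := by
    rw [abs_of_nonneg (by positivity), div_mul_eq_mul_div, div_le_iff₀ (by positivity)]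
    nlinarith [le_smoothAbs hθ.le y]
  have h₂ := abs_coreDenomY_div_mul_smoothAbs_le hθ hθ₁ hy
  calc |logAmplitudeY n θ y| * smoothAbs θ y
      ≤ (|y / (2 * smoothAbs θ y ^ 2)| + |coreExponent n * (coreDenomY θ y / coreDenom θ y)|) *
          smoothAbs θ y := mul_le_mul_of_nonneg_right (abs_sub _ _) hw.le
    _ = |y / (2 * smoothAbs θ y ^ 2)| * smoothAbs θ y + coreExponent n *
          (|coreDenomY θ y / coreDenom θ y| * smoothAbs θ y) := by
        rw [abs_mul, abs_of_pos hκ]; ring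
    _ ≤ (1 - Real.log θ) + coreExponent n * (120 * (1 - Real.log θ)) := by gcongr
    _ = (1 + 120 * coreExponent n) * (1 - Real.log θ) := by ring

theorem abs_logAmplitudeYY_mul_smoothAbs_sq_le (hθ : 0 < θ) (hθ₁ : θ ≤ 1) (hy : 0 ≤ y) :
    |logAmplitudeYY n θ y| * smoothAbs θ y ^ 2 ≤
      (1 + 15120 * coreExponent n) * (1 - Real.log θ) ^ 2 := by
  have hw := smoothAbs_pos hθ y
  have hκ := coreExponent_pos n
  have hL : 1 ≤ (1 - Real.log θ) ^ 2 :=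
    one_le_pow₀ (by linarith [Real.log_nonpos hθ.le hθ₁])
  have h₁ : |1 / (2 * smoothAbs θ y ^ 2) - y ^ 2 / smoothAbs θ y ^ 4| * smoothAbs θ y ^ 2 ≤ 1 := by
    have hy₁ : y ^ 2 / smoothAbs θ y ^ 2 ∈ Icc 0 1 :=
      ⟨by positivity, div_le_one_of_le₀ (by rw [smoothAbs_sq hθ.le]; linarith) (sq_nonneg _)⟩
    rw [← abs_of_pos (pow_pos hw 2), ← abs_mul, abs_of_pos (pow_pos hw 2), show
      (1 / (2 * smoothAbs θ y ^ 2) - y ^ 2 / smoothAbs θ y ^ 4) * smoothAbs θ y ^ 2 =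
        1 / 2 - y ^ 2 / smoothAbs θ y ^ 2 by field_simp, abs_le]
    constructor <;> linarith [hy₁.1, hy₁.2]
  have h₂ := abs_coreDenomYY_div_sub_sq_mul_smoothAbs_sq_le hθ hθ₁ hy
  calc |logAmplitudeYY n θ y| * smoothAbs θ y ^ 2
      ≤ (|1 / (2 * smoothAbs θ y ^ 2) - y ^ 2 / smoothAbs θ y ^ 4| + |coreExponent n *
          (coreDenomYY θ y / coreDenom θ y - (coreDenomY θ y / coreDenom θ y) ^ 2)|) *
          smoothAbs θ y ^ 2 := mul_le_mul_of_nonneg_right (abs_sub _ _) (by positivity)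
    _ = |1 / (2 * smoothAbs θ y ^ 2) - y ^ 2 / smoothAbs θ y ^ 4| * smoothAbs θ y ^ 2 +
          coreExponent n * (|coreDenomYY θ y / coreDenom θ y -
            (coreDenomY θ y / coreDenom θ y) ^ 2| * smoothAbs θ y ^ 2) := by
        rw [abs_mul, abs_of_pos hκ]; ring
    _ ≤ (1 - Real.log θ) ^ 2 + coreExponent n * (15120 * (1 - Real.log θ) ^ 2) := by
        gcongr
        exact h₁.trans hL
    _ = (1 + 15120 * coreExponent n) * (1 - Real.log θ) ^ 2 := by ring

theorem sqrt_le_charRoot (hy : 0 ≤ y) : √θ ≤ charRoot θ y :=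
  (sqrt_le_smoothAbs θ y).trans (smoothAbs_le_charRoot hy)

theorem abs_phaseY_mul_smoothAbs_le (hθ : 0 < θ) (hy : 0 ≤ y) (h₁ : |θ₁| ≤ B * √θ) :
    |phaseY θ θ₁ y| * smoothAbs θ y ≤ B := by
  have hw := smoothAbs_pos hθ y
  have hs := charRoot_pos hθ y
  have hB : 0 ≤ B := nonneg_of_mul_nonneg_left ((abs_nonneg _).trans h₁) (Real.sqrt_pos.2 hθ)
  have hle : |θ₁| ≤ B * charRoot θ y :=
    h₁.trans (mul_le_mul_of_nonneg_left (sqrt_le_charRoot hy) hB)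
  rw [phaseY, abs_div, abs_neg, abs_of_pos (by positivity : 0 < 16 * charRoot θ y * smoothAbs θ y),
    div_mul_eq_mul_div, mul_div_mul_right _ _ hw.ne', div_le_iff₀ (by positivity)]
  nlinarith

theorem abs_phaseYY_mul_smoothAbs_sq_le (hθ : 0 < θ) (h₁ : |θ₁| ≤ B * √θ) :
    |phaseYY θ θ₁ y| * smoothAbs θ y ^ 2 ≤ B := by
  have hw := smoothAbs_pos hθ y
  have hB : 0 ≤ B := nonneg_of_mul_nonneg_left ((abs_nonneg _).trans h₁) (Real.sqrt_pos.2 hθ)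
  have hle : |θ₁| ≤ B * smoothAbs θ y :=
    h₁.trans (mul_le_mul_of_nonneg_left (sqrt_le_smoothAbs θ y) hB)
  rw [phaseYY, abs_div, abs_of_pos (by positivity : 0 < 16 * smoothAbs θ y ^ 3),
    div_mul_eq_mul_div, div_le_iff₀ (by positivity)]
  nlinarith [mul_le_mul_of_nonneg_right hle (sq_nonneg (smoothAbs θ y)),
    mul_nonneg hB (pow_nonneg hw.le 3)]

theorem abs_phaseT_mul_smoothAbs_le (hθ : 0 < θ) (hy : 0 ≤ y) (h₁ : |θ₁| ≤ B * √θ)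
    (h₂ : |θ₂| ≤ B) : |phaseT θ θ₁ θ₂ y| * smoothAbs θ y ≤ B + B ^ 2 := by
  have hw := smoothAbs_pos hθ y
  have hs := charRoot_pos hθ y
  have hws := smoothAbs_le_charRoot (θ := θ) hy
  have hB : 0 ≤ B := (abs_nonneg _).trans h₂
  have hfst : |θ₂ / (16 * charRoot θ y)| * smoothAbs θ y ≤ B := by
    rw [abs_div, abs_of_pos (by positivity : 0 < 16 * charRoot θ y), div_mul_eq_mul_div,
      div_le_iff₀ (by positivity)]
    nlinarith [mul_le_mul h₂ hws hw.le hB, mul_nonneg hB hs.le]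
  have hsnd : |θ₁ ^ 2 / (32 * charRoot θ y ^ 2 * smoothAbs θ y)| * smoothAbs θ y ≤ B ^ 2 := by
    have hle : θ₁ ^ 2 ≤ (B * charRoot θ y) ^ 2 := sq_le_sq' (by
      linarith [neg_abs_le θ₁, mul_le_mul_of_nonneg_left (sqrt_le_charRoot (θ := θ) hy) hB])
      ((le_abs_self _).trans (h₁.trans (mul_le_mul_of_nonneg_left (sqrt_le_charRoot hy) hB)))
    rw [abs_of_nonneg (by positivity), div_mul_eq_mul_div, mul_div_mul_right _ _ hw.ne',
      div_le_iff₀ (by positivity)]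
    nlinarith [mul_nonneg (sq_nonneg B) (sq_nonneg (charRoot θ y))]
  calc |phaseT θ θ₁ θ₂ y| * smoothAbs θ y
      ≤ (|θ₂ / (16 * charRoot θ y)| + |θ₁ ^ 2 / (32 * charRoot θ y ^ 2 * smoothAbs θ y)|) *
          smoothAbs θ y := mul_le_mul_of_nonneg_right (abs_sub _ _) hw.le
    _ ≤ B + B ^ 2 := by rw [add_mul]; exact add_le_add hfst hsnd

theorem abs_radialPotential_mul_smoothAbs_le (hθ : 0 < θ) (hθ₁ : θ ≤ 1) (hy : 0 ≤ y)
    (h₁ : |θ₁| ≤ B * √θ) (h₂ : |θ₂| ≤ B) :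
    |radialPotential n θ θ₁ θ₂ y| * smoothAbs θ y ≤
      4 * ((1 + 15120 * coreExponent n) * (1 - Real.log θ) ^ 2 +
        ((1 + 120 * coreExponent n) * (1 - Real.log θ)) ^ 2 + B ^ 2) +
        2 * n * ((1 + 120 * coreExponent n) * (1 - Real.log θ)) + (B + B ^ 2) := by
  have hw := smoothAbs_nonneg θ y
  have hyw := le_smoothAbs hθ.le y
  have hY := abs_logAmplitudeY_mul_smoothAbs_le (n := n) hθ hθ₁ hy
  have hYY := abs_logAmplitudeYY_mul_smoothAbs_sq_le (n := n) hθ hθ₁ hy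
  have hφ := abs_phaseY_mul_smoothAbs_le hθ hy h₁
  have hφT := abs_phaseT_mul_smoothAbs_le hθ hy h₁ h₂
  rw [radialPotential]
  generalize smoothAbs θ y = w at *
  refine (mul_le_mul_of_nonneg_right (abs_add_three _ _ _) hw).trans ?_
  rw [add_mul, add_mul]
  refine add_le_add (add_le_add ?_ ?_) hφT
  · rw [abs_mul, abs_of_nonneg (by positivity)]
    calc _ ≤ 4 * w * (|logAmplitudeYY n θ y| + |logAmplitudeY n θ y| ^ 2 +
          |phaseY θ θ₁ y| ^ 2) * w := by
          gcongr
          refine (abs_sub _ _).trans (add_le_add ((abs_add_le _ _).trans ?_) ?_)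
          · rw [abs_pow]
          · rw [abs_pow]
      _ = 4 * (|logAmplitudeYY n θ y| * w ^ 2 + (|logAmplitudeY n θ y| * w) ^ 2 +
          (|phaseY θ θ₁ y| * w) ^ 2) := by ring
      _ ≤ _ := by gcongr
  · rw [abs_mul, abs_of_nonneg (by positivity : (0 : ℝ) ≤ 2 * n), mul_assoc]
    gcongr

theorem exists_abs_radialPotential_le (n : ℕ) (B : ℝ) :
    ∃ C, 0 ≤ C ∧ ∀ {θ θ₁ θ₂ y : ℝ}, 0 < θ → θ ≤ 1 → 0 ≤ y → |θ₁| ≤ B * √θ → |θ₂| ≤ B →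
      |radialPotential n θ θ₁ θ₂ y| ≤ C * (1 - Real.log θ) ^ 2 / smoothAbs θ y := by
  set a := 1 + 120 * coreExponent n
  set b := 1 + 15120 * coreExponent n
  have ha : 0 ≤ a := by linarith [coreExponent_pos n]
  have hb : 0 ≤ b := by linarith [coreExponent_pos n]
  refine ⟨4 * (b + a ^ 2 + B ^ 2) + 2 * n * a + (|B| + B ^ 2), by positivity, ?_⟩
  intro θ θ₁ θ₂ y hθ hθ₁ hy h₁ h₂
  have hL : 1 ≤ 1 - Real.log θ := by linarith [Real.log_nonpos hθ.le hθ₁]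
  have hLL : 1 - Real.log θ ≤ (1 - Real.log θ) ^ 2 := by nlinarith
  have hL₂ : 1 ≤ (1 - Real.log θ) ^ 2 := hL.trans hLL
  rw [le_div_iff₀ (smoothAbs_pos hθ y)]
  refine (abs_radialPotential_mul_smoothAbs_le (n := n) hθ hθ₁ hy h₁ h₂).trans ?_
  calc _ ≤ 4 * (b * (1 - Real.log θ) ^ 2 + (a * (1 - Real.log θ)) ^ 2 +
            B ^ 2 * (1 - Real.log θ) ^ 2) + 2 * n * (a * (1 - Real.log θ) ^ 2) +
          (|B| + B ^ 2) * (1 - Real.log θ) ^ 2 := by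
        gcongr
        · exact le_mul_of_one_le_right (sq_nonneg B) hL₂
        · exact (add_le_add_left (le_abs_self B) _).trans
            (le_mul_of_one_le_right (by positivity) hL₂)
    _ = _ := by ring

theorem norm_ofReal_add_I_mul_le (a b : ℝ) : ‖(a : ℂ) + Complex.I * b‖ ≤ |a| + |b| := by
  simpa using norm_add_le (a : ℂ) (Complex.I * b)

theorem exists_norm_profileY_mul_smoothAbs_le (n : ℕ) (B : ℝ) :
    ∃ C, 0 ≤ C ∧ ∀ {θ θ₁ y : ℝ}, 0 < θ → θ ≤ 1 → 0 ≤ y → |θ₁| ≤ B * √θ →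
      ‖profileY n θ θ₁ y‖ * smoothAbs θ y ≤ C * (1 - Real.log θ) * ‖profile n θ θ₁ y‖ := by
  have hκ := coreExponent_pos n
  refine ⟨1 + 120 * coreExponent n + |B|, by positivity, fun {θ θ₁ y} hθ hθ₁ hy h₁ => ?_⟩
  have hL : 1 ≤ 1 - Real.log θ := by linarith [Real.log_nonpos hθ.le hθ₁]
  have hY := abs_logAmplitudeY_mul_smoothAbs_le (n := n) hθ hθ₁ hy
  have hφ := (abs_phaseY_mul_smoothAbs_le hθ hy h₁).trans (le_abs_self B)
  have hB := le_mul_of_one_le_right (abs_nonneg B) hL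
  rw [profileY, norm_mul, mul_right_comm]
  refine mul_le_mul_of_nonneg_right ?_ (norm_nonneg _)
  exact (mul_le_mul_of_nonneg_right (norm_ofReal_add_I_mul_le _ _)
    (smoothAbs_pos hθ y).le).trans (by linarith)

theorem exists_norm_profileYY_mul_smoothAbs_sq_le (n : ℕ) (B : ℝ) :
    ∃ C, 0 ≤ C ∧ ∀ {θ θ₁ y : ℝ}, 0 < θ → θ ≤ 1 → 0 ≤ y → |θ₁| ≤ B * √θ →
      ‖profileYY n θ θ₁ y‖ * smoothAbs θ y ^ 2 ≤
        C * (1 - Real.log θ) ^ 2 * ‖profile n θ θ₁ y‖ := by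
  set a := 1 + 120 * coreExponent n
  set b := 1 + 15120 * coreExponent n
  have hb : 0 ≤ b := by linarith [coreExponent_pos n]
  refine ⟨b + |B| + (a + |B|) ^ 2, by positivity, fun {θ θ₁ y} hθ hθ₁ hy h₁ => ?_⟩
  have hw := smoothAbs_pos hθ y
  have hL : 1 ≤ 1 - Real.log θ := by linarith [Real.log_nonpos hθ.le hθ₁]
  have hY := abs_logAmplitudeY_mul_smoothAbs_le (n := n) hθ hθ₁ hy
  have hYY := abs_logAmplitudeYY_mul_smoothAbs_sq_le (n := n) hθ hθ₁ hy
  have hφ := (abs_phaseY_mul_smoothAbs_le hθ hy h₁).trans (le_abs_self B)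
  have hφφ := (abs_phaseYY_mul_smoothAbs_sq_le (y := y) hθ h₁).trans (le_abs_self B)
  have hB := le_mul_of_one_le_right (abs_nonneg B) hL
  have hB₂ := le_mul_of_one_le_right (abs_nonneg B) (one_le_pow₀ hL (n := 2))
  have hfst : ‖(logAmplitudeY n θ y : ℂ) + Complex.I * phaseY θ θ₁ y‖ * smoothAbs θ y ≤
      (a + |B|) * (1 - Real.log θ) :=
    (mul_le_mul_of_nonneg_right (norm_ofReal_add_I_mul_le _ _) hw.le).trans (by linarith)
  have hsnd : ‖(logAmplitudeYY n θ y : ℂ) + Complex.I * phaseYY θ θ₁ y‖ * smoothAbs θ y ^ 2 ≤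
      (b + |B|) * (1 - Real.log θ) ^ 2 :=
    (mul_le_mul_of_nonneg_right (norm_ofReal_add_I_mul_le _ _) (sq_nonneg _)).trans (by linarith)
  rw [profileYY, norm_mul, mul_right_comm]
  refine mul_le_mul_of_nonneg_right ?_ (norm_nonneg _)
  generalize (logAmplitudeY n θ y : ℂ) + Complex.I * phaseY θ θ₁ y = z₁ at *
  generalize (logAmplitudeYY n θ y : ℂ) + Complex.I * phaseYY θ θ₁ y = z₂ at *
  calc ‖z₂ + z₁ ^ 2‖ * smoothAbs θ y ^ 2
      ≤ (‖z₂‖ + ‖z₁‖ ^ 2) * smoothAbs θ y ^ 2 := by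
        gcongr
        exact (norm_add_le _ _).trans_eq (by rw [norm_pow])
    _ = ‖z₂‖ * smoothAbs θ y ^ 2 + (‖z₁‖ * smoothAbs θ y) ^ 2 := by ring
    _ ≤ (b + |B|) * (1 - Real.log θ) ^ 2 + ((a + |B|) * (1 - Real.log θ)) ^ 2 := by gcongr
    _ = _ := by ring

end potential_bounds

section amplitude_bounds
variable {n : ℕ} {θ θ₁ y : ℝ}

theorem norm_profile (n : ℕ) (θ θ₁ y : ℝ) :
    ‖profile n θ θ₁ y‖ = Real.exp (logAmplitude n θ y) := by
  simp [profile, Complex.norm_exp]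

theorem norm_profile_eq_mul (hw : 0 < smoothAbs θ y) (hQ : 0 < coreDenom θ y) :
    ‖profile n θ θ₁ y‖ = √(smoothAbs θ y) * coreDenom θ y ^ (-coreExponent n) := by
  rw [norm_profile, logAmplitude, sub_eq_add_neg, Real.exp_add, Real.rpow_def_of_pos hQ,
    ← Real.log_sqrt hw.le, Real.exp_log (Real.sqrt_pos.2 hw)]
  ring_nf

theorem sqrt_mul_rpow_neg_coreExponent {w : ℝ} (hw : 0 < w) (n : ℕ) :
    √w * w ^ (-coreExponent n) = w ^ (-(n / 4 : ℝ)) := by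
  rw [Real.sqrt_eq_rpow, ← Real.rpow_add hw, coreExponent]
  ring_nf

theorem norm_profile_le (hθ : 0 ≤ θ) (hθ₁ : θ ≤ 1) (hy : 0 ≤ y) (hw : 0 < smoothAbs θ y) :
    ‖profile n θ θ₁ y‖ ≤ 20 ^ coreExponent n *
      (smoothAbs θ y ^ (-(n / 4 : ℝ)) * (1 + smoothAbs θ y) ^ (-coreExponent n)) := by
  have hQ : (20 : ℝ)⁻¹ * (smoothAbs θ y * (1 + smoothAbs θ y)) ≤ coreDenom θ y := by
    linarith [smoothAbs_mul_one_add_le hθ hθ₁ hy hw]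
  rw [norm_profile_eq_mul hw (coreDenom_pos hθ hθ₁ hy hw)]
  calc √(smoothAbs θ y) * coreDenom θ y ^ (-coreExponent n)
      ≤ √(smoothAbs θ y) * ((20 : ℝ)⁻¹ * (smoothAbs θ y * (1 + smoothAbs θ y))) ^
          (-coreExponent n) := by
        gcongr 1
        exact Real.rpow_le_rpow_of_nonpos (by positivity) hQ (neg_nonpos.2 (coreExponent_pos n).le)
    _ = 20 ^ coreExponent n * (smoothAbs θ y ^ (-(n / 4 : ℝ)) *
          (1 + smoothAbs θ y) ^ (-coreExponent n)) := by
        rw [Real.mul_rpow (by positivity) (by positivity), Real.mul_rpow hw.le (by positivity),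
          Real.inv_rpow (by norm_num), Real.rpow_neg (by norm_num : (0 : ℝ) ≤ 20), inv_inv,
          ← sqrt_mul_rpow_neg_coreExponent hw]
        ring

theorem norm_profile_le_of_le_smoothAbs {v : ℝ} (hθ : 0 ≤ θ) (hθ₁ : θ ≤ 1) (hy : 0 ≤ y)
    (hv : 0 < v) (hvw : v ≤ smoothAbs θ y) :
    ‖profile n θ θ₁ y‖ ≤ 20 ^ coreExponent n *
      (v ^ (-(n / 4 : ℝ)) * (1 + v) ^ (-coreExponent n)) := by
  have hw := hv.trans_le hvw
  refine (norm_profile_le hθ hθ₁ hy hw).trans ?_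
  have hn : -(n / 4 : ℝ) ≤ 0 := neg_nonpos.2 (by positivity)
  have hκ := neg_nonpos.2 (coreExponent_pos n).le
  gcongr 20 ^ coreExponent n * (?_ * ?_)
  · exact Real.rpow_le_rpow_of_nonpos hv hvw hn
  · exact Real.rpow_le_rpow_of_nonpos (by positivity) (by linarith) hκ

theorem half_mul_one_add_le_smoothAbs {ε : ℝ} (hε : 0 < ε) (hεθ : ε ^ 2 ≤ θ) (hθ₁ : θ ≤ 1)
    (y : ℝ) : ε / 2 * (1 + y) ≤ smoothAbs θ y := by
  have hθ : 0 ≤ θ := (sq_nonneg ε).trans hεθ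
  have hετ : ε ≤ √θ := Real.le_sqrt_of_sq_le hεθ
  have hτ₁ : √θ ≤ 1 := Real.sqrt_le_one.2 hθ₁
  nlinarith [sqrt_le_smoothAbs θ y, le_smoothAbs hθ y]

theorem norm_profile_le_of_sq_le_theta {ε : ℝ} (hε : 0 < ε) (hεθ : ε ^ 2 ≤ θ) (hθ₁ : θ ≤ 1)
    (hy : 0 ≤ y) :
    ‖profile n θ θ₁ y‖ ≤ 20 ^ coreExponent n * (ε / 2) ^ (-((n + 1) / 2 : ℝ)) *
      (1 + y) ^ (-((n + 1) / 2 : ℝ)) := by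
  have hθ : 0 ≤ θ := (sq_nonneg ε).trans hεθ
  have hv : 0 < ε / 2 * (1 + y) := by positivity
  have hvw := half_mul_one_add_le_smoothAbs hε hεθ hθ₁ y
  have hsum : -((n + 1) / 2 : ℝ) = -(n / 4) + -coreExponent n := by rw [coreExponent]; ring
  refine (norm_profile_le_of_le_smoothAbs hθ hθ₁ hy hv hvw).trans ?_
  rw [mul_assoc, ← Real.mul_rpow (by positivity) (by positivity), hsum, Real.rpow_add hv]
  gcongr 20 ^ coreExponent n * (_ * ?_)
  exact Real.rpow_le_rpow_of_nonpos hv (by linarith) (neg_nonpos.2 (coreExponent_pos n).le)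

theorem exists_one_add_pow_mul_le (n : ℕ) {ε C : ℝ} (hε : 0 < ε) (hC : 0 ≤ C) (j k : ℕ) :
    ∃ C', ∀ {θ θ₁ y a : ℝ}, ε ^ 2 ≤ θ → θ ≤ 1 → 0 ≤ y → 0 ≤ a →
      a * smoothAbs θ y ^ j ≤ C * (1 - Real.log θ) ^ k * ‖profile n θ θ₁ y‖ →
      (1 + y) ^ j * a ≤ C' * (1 + y) ^ (-((n + 1) / 2 : ℝ)) := by
  refine ⟨(2 / ε) ^ j * (C * (1 - Real.log (ε ^ 2)) ^ k *
    (20 ^ coreExponent n * (ε / 2) ^ (-((n + 1) / 2 : ℝ)))), fun {θ θ₁ y a} hεθ hθ₁ hy ha h => ?_⟩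
  have hε₂ : 0 < ε ^ 2 := by positivity
  have hL : 0 ≤ 1 - Real.log θ := by
    linarith [Real.log_nonpos (hε₂.le.trans hεθ) hθ₁]
  have hLε : 1 - Real.log θ ≤ 1 - Real.log (ε ^ 2) := by linarith [Real.log_le_log hε₂ hεθ]
  have hle := half_mul_one_add_le_smoothAbs hε hεθ hθ₁ y
  calc (1 + y) ^ j * a = (2 / ε) ^ j * (a * (ε / 2 * (1 + y)) ^ j) := by
        rw [mul_pow, div_pow, div_pow]
        field_simp
    _ ≤ (2 / ε) ^ j * (C * (1 - Real.log θ) ^ k * ‖profile n θ θ₁ y‖) := by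
        refine mul_le_mul_of_nonneg_left (le_trans ?_ h) (by positivity)
        gcongr
    _ ≤ (2 / ε) ^ j * (C * (1 - Real.log (ε ^ 2)) ^ k * (20 ^ coreExponent n *
          (ε / 2) ^ (-((n + 1) / 2 : ℝ)) * (1 + y) ^ (-((n + 1) / 2 : ℝ)))) := by
        gcongr
        · exact mul_nonneg hC (pow_nonneg (hL.trans hLε) k)
        · exact norm_profile_le_of_sq_le_theta hε hεθ hθ₁ hy
    _ = _ := by ring

theorem norm_profile_le_of_le_sq (hn : 2 ≤ n) (hθ : 0 ≤ θ) (hθ₁ : θ ≤ 1) (hy : 0 < y)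
    (h : θ ≤ y ^ 2) :
    ‖profile n θ θ₁ y‖ ≤
      2 * 4 ^ coreExponent n * (y ^ (-(n / 4 : ℝ)) * (1 + |Real.log y|)⁻¹) := by
  have hw := smoothAbs_pos_of_pos hθ hy
  have hl : 1 ≤ 1 + |Real.log y| := by linarith [abs_nonneg (Real.log y)]
  have hκ : 1 ≤ coreExponent n := by
    have : (2 : ℝ) ≤ n := mod_cast hn
    rw [coreExponent]
    linarith
  have hQ : (4 : ℝ)⁻¹ * (y * (1 + |Real.log y|)) ≤ coreDenom θ y := by
    linarith [le_coreDenom_of_le_sq hθ hy h]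
  have hsqrt : √(smoothAbs θ y) ≤ 2 * √y := by
    rw [show (2 : ℝ) = √4 by rw [show (4 : ℝ) = 2 ^ 2 by norm_num]; simp,
      ← Real.sqrt_mul (by norm_num)]
    exact Real.sqrt_le_sqrt (by linarith [smoothAbs_le_of_le_sq hy.le h])
  have hQ₀ := coreDenom_pos hθ hθ₁ hy.le hw
  rw [norm_profile_eq_mul hw hQ₀]
  calc √(smoothAbs θ y) * coreDenom θ y ^ (-coreExponent n)
      ≤ 2 * √y * ((4 : ℝ)⁻¹ * (y * (1 + |Real.log y|))) ^ (-coreExponent n) := by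
        gcongr 1
        exact Real.rpow_le_rpow_of_nonpos (by positivity) hQ (neg_nonpos.2 (coreExponent_pos n).le)
    _ = 2 * 4 ^ coreExponent n * (y ^ (-(n / 4 : ℝ)) *
          (1 + |Real.log y|) ^ (-coreExponent n)) := by
        rw [Real.mul_rpow (by positivity) (by positivity), Real.mul_rpow hy.le (by positivity),
          Real.inv_rpow (by norm_num), Real.rpow_neg (by norm_num : (0 : ℝ) ≤ 4), inv_inv,
          ← sqrt_mul_rpow_neg_coreExponent hy]
        ring
    _ ≤ 2 * 4 ^ coreExponent n * (y ^ (-(n / 4 : ℝ)) * (1 + |Real.log y|)⁻¹) := by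
        gcongr
        rw [← Real.rpow_neg_one]
        exact Real.rpow_le_rpow_of_exponent_le hl (neg_le_neg hκ)

theorem norm_profile_sq_le_of_sq_le (hθ : 0 < θ) (hθ₁ : θ ≤ 1) (hy : 0 < y) (h : y ^ 2 ≤ θ) :
    ‖profile n θ θ₁ y‖ ^ 2 ≤ 6 * (√(1 - Real.log θ))⁻¹ * √θ ^ (-(n / 2 : ℝ)) * √(√θ / y) := by
  have hw := smoothAbs_pos hθ y
  have hτ := Real.sqrt_pos.2 hθ
  have hL : 0 < 1 - Real.log θ := by linarith [Real.log_nonpos hθ.le hθ₁]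
  have hQ := coreDenom_pos hθ.le hθ₁ hy.le hw
  have hQle := le_coreDenom_of_sq_le hθ hθ₁ hy.le h
  have hyL : 0 < y * (1 - Real.log θ) := by positivity
  have hQτ : √θ ≤ coreDenom θ y := by linarith [sqrt_le_smoothAbs θ y]
  have hQy : y * (1 - Real.log θ) / 16 ≤ coreDenom θ y := by linarith
  have hsq : ‖profile n θ θ₁ y‖ ^ 2 =
      smoothAbs θ y * (coreDenom θ y ^ (-((n + 1) / 2 : ℝ)) * (√(coreDenom θ y))⁻¹) := by
    rw [norm_profile_eq_mul hw hQ, mul_pow, Real.sq_sqrt hw.le, Real.sqrt_eq_rpow,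
      ← Real.rpow_neg hQ.le, ← Real.rpow_add hQ, ← Real.rpow_mul_natCast hQ.le, coreExponent]
    ring_nf
  have hτn : √θ * √θ ^ (-((n + 1) / 2 : ℝ)) = √θ ^ (-(n / 2 : ℝ)) * √(√θ) := by
    rw [Real.sqrt_eq_rpow (√θ), ← Real.rpow_add hτ]
    nth_rewrite 1 [← Real.rpow_one √θ]
    rw [← Real.rpow_add hτ]
    ring_nf
  have hpow : coreDenom θ y ^ (-((n + 1) / 2 : ℝ)) ≤ √θ ^ (-((n + 1) / 2 : ℝ)) :=
    Real.rpow_le_rpow_of_nonpos hτ hQτ (neg_nonpos.2 (by positivity))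
  have h16 : √16 = (4 : ℝ) := by rw [show (16 : ℝ) = 4 ^ 2 by norm_num]; simp
  rw [hsq]
  calc _ ≤ 3 / 2 * √θ * (√θ ^ (-((n + 1) / 2 : ℝ)) * (√(y * (1 - Real.log θ) / 16))⁻¹) := by
        gcongr ?_ * (?_ * (√?_)⁻¹)
        exact smoothAbs_le_of_sq_le h
    _ = 6 * (√(1 - Real.log θ))⁻¹ * √θ ^ (-(n / 2 : ℝ)) * √(√θ / y) := by
        rw [mul_assoc, ← mul_assoc √θ, hτn, Real.sqrt_div hyL.le, Real.sqrt_mul hy.le, h16,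
          Real.sqrt_div hτ.le]
        field_simp
        norm_num

theorem le_norm_profile_of_sq_le (hθ : 0 < θ) (hθ₁ : θ ≤ 1) (hy : 0 ≤ y) (h : y ^ 2 ≤ θ) :
    5 ^ (-coreExponent n) * (√θ ^ (-(n / 4 : ℝ)) * (1 - Real.log θ) ^ (-coreExponent n)) ≤
      ‖profile n θ θ₁ y‖ := by
  have hw := smoothAbs_pos hθ y
  have hτ := Real.sqrt_pos.2 hθ
  have hL : 0 < 1 - Real.log θ := by linarith [Real.log_nonpos hθ.le hθ₁]
  have hQ := coreDenom_pos hθ.le hθ₁ hy hw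
  rw [norm_profile_eq_mul hw hQ]
  calc _ = √(√θ) * (5 * (√θ * (1 - Real.log θ))) ^ (-coreExponent n) := by
        rw [Real.mul_rpow (by norm_num) (by positivity), Real.mul_rpow hτ.le hL.le,
          ← sqrt_mul_rpow_neg_coreExponent hτ]
        ring
    _ ≤ √(smoothAbs θ y) * coreDenom θ y ^ (-coreExponent n) := by
        gcongr 1
        · exact Real.sqrt_le_sqrt (sqrt_le_smoothAbs θ y)
        · exact Real.rpow_le_rpow_of_nonpos hQ (coreDenom_le_of_sq_le hθ hθ₁ hy h)
            (neg_nonpos.2 (coreExponent_pos n).le)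

end amplitude_bounds

section radial_integrability
variable {E : Type*} [NormedAddCommGroup E] [NormedSpace ℝ E] [FiniteDimensional ℝ E]
  [MeasurableSpace E] [BorelSpace E] {μ : Measure E} [μ.IsAddHaarMeasure]

theorem integrable_norm_rpow_mul_one_add_norm_sq_rpow {a b : ℝ} (ha₀ : 0 ≤ a) (hb₀ : 0 ≤ b)
    (ha : a < finrank ℝ E) (hb : finrank ℝ E < a + 2 * b) :
    Integrable (fun x : E => ‖x‖ ^ (-a) * (1 + ‖x‖ ^ 2) ^ (-b)) μ := by
  have hdim : 1 ≤ finrank ℝ E := Nat.one_le_iff_ne_zero.2 fun h => by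
    rw [h, Nat.cast_zero] at ha
    exact ha.not_ge ha₀
  have hnear : IntegrableOn (fun x : E => ‖x‖ ^ (-a)) (Metric.ball 0 1) μ :=
    integrableOn_ball_of_norm_le_rpow hdim ha (C := 1)
      (ae_of_all _ fun x => by rw [one_mul, Real.norm_of_nonneg (by positivity)])
      (measurable_norm.pow_const (-a)).aestronglyMeasurable
  have hfar : Integrable (fun x : E => 2 ^ (a / 2) * (1 + ‖x‖ ^ 2) ^ (-(a + 2 * b) / 2)) μ :=
    (integrable_rpow_neg_one_add_norm_sq hb).const_mul _
  refine Integrable.mono' ((hnear.integrable_indicator measurableSet_ball).add hfar)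
    (by fun_prop) (ae_of_all _ fun x => ?_)
  have hx : 0 < 1 + ‖x‖ ^ 2 := by positivity
  rw [Real.norm_of_nonneg (by positivity), Pi.add_apply]
  by_cases h : x ∈ Metric.ball (0 : E) 1
  · rw [indicator_of_mem h]
    refine (mul_le_of_le_one_right (by positivity) ?_).trans
      (le_add_of_nonneg_right (by positivity))
    exact Real.rpow_le_one_of_one_le_of_nonpos (by linarith [sq_nonneg ‖x‖]) (neg_nonpos.2 hb₀)
  · rw [indicator_of_notMem h, zero_add]
    have hx₁ : 1 ≤ ‖x‖ := by simpa using h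
    calc ‖x‖ ^ (-a) * (1 + ‖x‖ ^ 2) ^ (-b)
        = (‖x‖ ^ 2) ^ (-(a / 2)) * (1 + ‖x‖ ^ 2) ^ (-b) := by
          rw [← Real.rpow_natCast_mul (norm_nonneg x)]
          ring_nf
      _ ≤ (2⁻¹ * (1 + ‖x‖ ^ 2)) ^ (-(a / 2)) * (1 + ‖x‖ ^ 2) ^ (-b) := by
          gcongr 1
          exact Real.rpow_le_rpow_of_nonpos (by positivity) (by nlinarith) (by linarith)
      _ = 2 ^ (a / 2) * (1 + ‖x‖ ^ 2) ^ (-(a + 2 * b) / 2) := by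
          rw [Real.mul_rpow (by norm_num) hx.le, mul_assoc, ← Real.rpow_add hx,
            Real.inv_rpow (by norm_num), Real.rpow_neg (by norm_num : (0 : ℝ) ≤ 2), inv_inv]
          ring_nf

theorem integrable_norm_rpow_mul_inv_one_add_abs_log_sq [Nontrivial E] :
    Integrable (fun x : E => ‖x‖ ^ (-(finrank ℝ E : ℝ)) * ((1 + |Real.log ‖x‖|) ^ 2)⁻¹) μ := by
  rw [integrable_fun_norm_addHaar μ
    (f := fun r => r ^ (-(finrank ℝ E : ℝ)) * ((1 + |Real.log r|) ^ 2)⁻¹), ← Real.range_exp,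
    ← image_univ, integrableOn_image_iff_integrableOn_abs_deriv_smul MeasurableSet.univ
      (fun v _ => (Real.hasDerivAt_exp v).hasDerivWithinAt) Real.exp_injective.injOn]
  have h : Integrable (fun v : ℝ => (1 + ‖v‖) ^ (-2 : ℝ)) := integrable_one_add_norm (by simp)
  refine h.integrableOn.congr_fun (fun v _ => ?_) MeasurableSet.univ
  have hdim : Real.exp v * Real.exp v ^ (finrank ℝ E - 1) *
      Real.exp v ^ (-(finrank ℝ E : ℝ)) = 1 := by
    rw [← pow_succ', Nat.sub_add_cancel Module.finrank_pos, ← Real.rpow_natCast,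
      ← Real.rpow_add (Real.exp_pos v), add_neg_cancel, Real.rpow_zero]
  simp only [smul_eq_mul, abs_of_pos (Real.exp_pos v), Real.log_exp, Real.norm_eq_abs]
  rw [← mul_assoc, ← mul_assoc, hdim, one_mul, Real.rpow_neg (by positivity), Real.rpow_two]

theorem eLpNorm_comp_inv_smul {F : Type*} [NormedAddCommGroup F] {c : ℝ} (hc : 0 < c) (f : E → F)
    (p : ℝ≥0∞) :
    eLpNorm (fun x => f (c⁻¹ • x)) p μ =
      ENNReal.ofReal (c ^ (finrank ℝ E / p.toReal)) * eLpNorm f p μ := by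
  have hemb : MeasurableEmbedding fun x : E => c⁻¹ • x :=
    (Homeomorph.smulOfNeZero c⁻¹ (inv_ne_zero hc.ne')).measurableEmbedding
  have hpos : 0 < c ^ finrank ℝ E := pow_pos hc _
  calc eLpNorm (fun x => f (c⁻¹ • x)) p μ = eLpNorm f p (μ.map (c⁻¹ • ·)) :=
        (hemb.eLpNorm_map_measure (g := f)).symm
    _ = ENNReal.ofReal (c ^ (finrank ℝ E / p.toReal)) * eLpNorm f p μ := by
        rw [Measure.map_addHaar_smul μ (inv_ne_zero hc.ne'), inv_pow, inv_inv, abs_of_pos hpos,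
          eLpNorm_smul_measure_of_ne_zero (ENNReal.ofReal_pos.2 hpos).ne', smul_eq_mul,
          ENNReal.ofReal_rpow_of_pos hpos, ← Real.rpow_natCast_mul hc.le, ENNReal.toReal_div,
          ENNReal.toReal_one, mul_one_div]

end radial_integrability

section fourier
open scoped RealInnerProductSpace
variable {U U₁ U₂ : ℝ → ℂ}

section derivatives
variable {E : Type*} [NormedAddCommGroup E] [InnerProductSpace ℝ E]

theorem hasFDerivAt_comp_norm_sq (hU : ∀ y, 0 ≤ y → HasDerivAt U (U₁ y) y) (x : E) :
    HasFDerivAt (fun x : E => U (‖x‖ ^ 2)) ((innerSL ℝ x).smulRight (2 * U₁ (‖x‖ ^ 2))) x := by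
  refine ((hU _ (sq_nonneg ‖x‖)).hasFDerivAt.comp x
    (hasStrictFDerivAt_norm_sq x).hasFDerivAt).congr_fderiv ?_
  ext
  simp [mul_left_comm]

theorem hasFDerivAt_inner_mul_comp_norm_sq (hU₁ : ∀ y, 0 ≤ y → HasDerivAt U₁ (U₂ y) y) (v x : E) :
    HasFDerivAt (fun x : E => 2 * (⟪x, v⟫ : ℂ) * U₁ (‖x‖ ^ 2))
      ((2 * (⟪x, v⟫ : ℂ)) • (innerSL ℝ x).smulRight (2 * U₂ (‖x‖ ^ 2)) +
        (innerSL ℝ v).smulRight (2 * U₁ (‖x‖ ^ 2))) x := by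
  have hinner : HasFDerivAt (fun x : E => (2 * ⟪x, v⟫ : ℂ))
      ((innerSL ℝ v).smulRight (2 : ℂ)) x := by
    refine ((((Complex.ofRealCLM.comp (innerSL ℝ v)).hasFDerivAt (x := x)).const_mul
      (2 : ℂ)).congr_fderiv ?_).congr_of_eventuallyEq (.of_forall fun x => ?_)
    · ext; simp [mul_comm]
    · simp [real_inner_comm]
  refine (hinner.mul (hasFDerivAt_comp_norm_sq hU₁ x)).congr_fderiv ?_
  ext z
  simp
  ring

theorem fderiv_inner_mul_comp_norm_sq_apply (hU₁ : ∀ y, 0 ≤ y → HasDerivAt U₁ (U₂ y) y)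
    (v x : E) :
    fderiv ℝ (fun x : E => 2 * (⟪x, v⟫ : ℂ) * U₁ (‖x‖ ^ 2)) x v =
      4 * (⟪x, v⟫ : ℂ) ^ 2 * U₂ (‖x‖ ^ 2) + 2 * (‖v‖ : ℂ) ^ 2 * U₁ (‖x‖ ^ 2) := by
  rw [(hasFDerivAt_inner_mul_comp_norm_sq hU₁ v x).fderiv]
  simp
  ring

end derivatives

variable {E : Type*} [NormedAddCommGroup E] [InnerProductSpace ℝ E] [FiniteDimensional ℝ E]
  [MeasurableSpace E] [BorelSpace E]

theorem integrable_fderiv_comp_norm_sq (hU : ∀ y, 0 ≤ y → HasDerivAt U (U₁ y) y)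
    (hint₁' : Integrable (fun x : E => ‖x‖ * U₁ (‖x‖ ^ 2))) :
    Integrable (fderiv ℝ fun x : E => U (‖x‖ ^ 2)) := by
  refine (hint₁'.norm.const_mul 2).mono' (measurable_fderiv ℝ _).aestronglyMeasurable
    (.of_forall fun x => le_of_eq ?_)
  rw [(hasFDerivAt_comp_norm_sq hU x).fderiv, ContinuousLinearMap.norm_smulRight_apply,
    innerSL_apply_norm]
  simp only [norm_mul, Complex.norm_ofNat, Complex.norm_real, norm_norm]
  ring

theorem integrable_fderiv_inner_mul_comp_norm_sq (hU₁ : ∀ y, 0 ≤ y → HasDerivAt U₁ (U₂ y) y)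
    (hint₁ : Integrable (fun x : E => U₁ (‖x‖ ^ 2)))
    (hint₂ : Integrable (fun x : E => (‖x‖ : ℂ) ^ 2 * U₂ (‖x‖ ^ 2))) (v : E) :
    Integrable (fderiv ℝ fun x : E => 2 * (⟪x, v⟫ : ℂ) * U₁ (‖x‖ ^ 2)) := by
  refine ((hint₂.norm.const_mul (4 * ‖v‖)).add (hint₁.norm.const_mul (2 * ‖v‖))).mono'
    (measurable_fderiv ℝ _).aestronglyMeasurable (.of_forall fun x => ?_)
  rw [(hasFDerivAt_inner_mul_comp_norm_sq hU₁ v x).fderiv]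
  refine (norm_add_le _ _).trans (add_le_add ?_ (le_of_eq ?_))
  · rw [norm_smul, ContinuousLinearMap.norm_smulRight_apply, innerSL_apply_norm]
    simp only [norm_mul, Complex.norm_ofNat, Complex.norm_real, norm_pow, norm_norm]
    nlinarith [mul_le_mul_of_nonneg_right (norm_inner_le_norm (𝕜 := ℝ) x v)
      (by positivity : 0 ≤ ‖x‖ * ‖U₂ (‖x‖ ^ 2)‖)]
  · rw [ContinuousLinearMap.norm_smulRight_apply, innerSL_apply_norm]
    simp only [norm_mul, Complex.norm_ofNat]
    ring

theorem fourierInv_fderiv_apply {f : E → ℂ} (hf : Integrable f) (hdiff : Differentiable ℝ f)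
    (hf' : Integrable (fderiv ℝ f)) (v ξ : E) :
    𝓕⁻ (fun x => fderiv ℝ f x v) ξ = -(2 * Real.pi * Complex.I * ⟪v, ξ⟫) * 𝓕⁻ f ξ := by
  rw [Real.fourierInv_eq_fourier_neg, Real.fourierInv_eq_fourier_neg,
    ← Real.fourier_continuousLinearMap_apply hf', Real.fourier_fderiv hf hdiff hf']
  simp [mul_assoc, innerSL_apply_apply ℝ ξ v, real_inner_comm]

theorem integral_mul_fourierInv {f g : E → ℂ} (hf : Integrable f) (hg : Integrable g) :
    ∫ x, f x * 𝓕⁻ g x = ∫ ξ, 𝓕⁻ f ξ * g ξ := by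
  have hflip : (-innerₗ E).flip = -innerₗ E := by ext; simp [real_inner_comm]
  have h := VectorFourier.integral_fourierIntegral_smul_eq_flip (L := -innerₗ E)
    Real.continuous_fourierChar continuous_inner.neg hf hg
  rw [hflip] at h
  exact h.symm

theorem integrable_fourierChar_smul {f : E → ℂ} (hf : Integrable f) (ξ : E) :
    Integrable (fun x => Real.fourierChar ⟪x, ξ⟫ • f x) := by
  simpa using (Real.fourierIntegral_convergent_iff (-ξ)).2 hf

theorem fourierInv_const_mul_sub {f g : E → ℂ} (hf : Integrable f) (hg : Integrable g) (c : ℂ)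
    (ξ : E) : 𝓕⁻ (fun x => c * (f x - g x)) ξ = c * (𝓕⁻ f ξ - 𝓕⁻ g ξ) := by
  simp only [Real.fourierInv_eq]
  rw [← integral_sub (integrable_fourierChar_smul hf ξ) (integrable_fourierChar_smul hg ξ),
    ← integral_const_mul]
  refine integral_congr_ae (ae_of_all _ fun x => ?_)
  simp only [Circle.smul_def, smul_eq_mul]
  ring

theorem fourierInv_radial_fderiv_fderiv (hU : ∀ y, 0 ≤ y → HasDerivAt U (U₁ y) y)
    (hU₁ : ∀ y, 0 ≤ y → HasDerivAt U₁ (U₂ y) y)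
    (hint : Integrable (fun x : E => U (‖x‖ ^ 2)))
    (hint₁ : Integrable (fun x : E => U₁ (‖x‖ ^ 2)))
    (hint₁' : Integrable (fun x : E => ‖x‖ * U₁ (‖x‖ ^ 2)))
    (hint₂ : Integrable (fun x : E => (‖x‖ : ℂ) ^ 2 * U₂ (‖x‖ ^ 2))) (v ξ : E) :
    𝓕⁻ (fun x => fderiv ℝ (fun x : E => 2 * (⟪x, v⟫ : ℂ) * U₁ (‖x‖ ^ 2)) x v) ξ =
      -(2 * Real.pi * ⟪ξ, v⟫) ^ 2 * 𝓕⁻ (fun x => U (‖x‖ ^ 2) : E → ℂ) ξ := by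
  have hd := hasFDerivAt_comp_norm_sq (E := E) hU
  have hfderiv := integrable_fderiv_comp_norm_sq hU hint₁'
  have hfirst : (fun x => fderiv ℝ (fun x : E => U (‖x‖ ^ 2)) x v) =
      fun x : E => 2 * (⟪x, v⟫ : ℂ) * U₁ (‖x‖ ^ 2) := by
    ext x
    simp only [(hd x).fderiv, ContinuousLinearMap.smulRight_apply, innerSL_apply_apply,
      Complex.real_smul]
    ring
  rw [fourierInv_fderiv_apply _
      (fun x => (hasFDerivAt_inner_mul_comp_norm_sq hU₁ v x).differentiableAt)
      (integrable_fderiv_inner_mul_comp_norm_sq hU₁ hint₁ hint₂ v), ← hfirst,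
    fourierInv_fderiv_apply hint (fun x => (hd x).differentiableAt) hfderiv, real_inner_comm]
  · linear_combination (2 * Real.pi * (⟪ξ, v⟫ : ℂ)) ^ 2 *
      𝓕⁻ (fun x => U (‖x‖ ^ 2) : E → ℂ) ξ * Complex.I_sq
  · simpa only [← hfirst] using hfderiv.apply_continuousLinearMap v

theorem fourierInv_radial_laplacian (hU : ∀ y, 0 ≤ y → HasDerivAt U (U₁ y) y)
    (hU₁ : ∀ y, 0 ≤ y → HasDerivAt U₁ (U₂ y) y)
    (hint : Integrable (fun x : E => U (‖x‖ ^ 2)))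
    (hint₁ : Integrable (fun x : E => U₁ (‖x‖ ^ 2)))
    (hint₁' : Integrable (fun x : E => ‖x‖ * U₁ (‖x‖ ^ 2)))
    (hint₂ : Integrable (fun x : E => (‖x‖ : ℂ) ^ 2 * U₂ (‖x‖ ^ 2))) (ξ : E) :
    𝓕⁻ (fun x => 4 * (‖x‖ : ℂ) ^ 2 * U₂ (‖x‖ ^ 2) +
      2 * finrank ℝ E * U₁ (‖x‖ ^ 2) : E → ℂ) ξ =
      -(2 * Real.pi * ‖ξ‖) ^ 2 * 𝓕⁻ (fun x => U (‖x‖ ^ 2) : E → ℂ) ξ := by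
  set b := stdOrthonormalBasis ℝ E
  have hparseval (x : E) : (‖x‖ : ℂ) ^ 2 = ∑ i, (⟪x, b i⟫ : ℂ) ^ 2 := by
    exact_mod_cast (b.sum_sq_inner_left x).symm
  have hsum (x : E) : 4 * (‖x‖ : ℂ) ^ 2 * U₂ (‖x‖ ^ 2) + 2 * finrank ℝ E * U₁ (‖x‖ ^ 2) =
      ∑ i, fderiv ℝ (fun x : E => 2 * (⟪x, b i⟫ : ℂ) * U₁ (‖x‖ ^ 2)) x (b i) := by
    simp_rw [fderiv_inner_mul_comp_norm_sq_apply hU₁]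
    rw [Finset.sum_add_distrib, ← Finset.sum_mul, ← Finset.mul_sum, ← hparseval]
    simp only [b.norm_eq_one, Finset.sum_const, Finset.card_univ, Fintype.card_fin, nsmul_eq_mul]
    push_cast
    ring
  have hfderiv (i) := (integrable_fderiv_inner_mul_comp_norm_sq hU₁ hint₁ hint₂
    (b i)).apply_continuousLinearMap (b i)
  rw [Real.fourierInv_eq]
  simp_rw [hsum, Finset.smul_sum]
  rw [integral_finsetSum _ fun i _ => integrable_fourierChar_smul (hfderiv i) ξ]
  simp_rw [← Real.fourierInv_eq,
    fourierInv_radial_fderiv_fderiv hU hU₁ hint hint₁ hint₁' hint₂, mul_pow, hparseval]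
  rw [← Finset.sum_mul, Finset.sum_neg_distrib, Finset.mul_sum]

end fourier

section duhamel

theorem eq_cexp_mul_add_integral {f g : ℝ → ℂ} {a : ℂ} {t : ℝ} (ht : 0 ≤ t)
    (hf : ContinuousOn f (Icc 0 t)) (hderiv : ∀ τ ∈ Ioo 0 t, HasDerivAt f (a * f τ + g τ) τ)
    (hg : IntegrableOn g (Ioo 0 t)) :
    f t = Complex.exp (a * t) * f 0 + ∫ τ in Ioo 0 t, Complex.exp (a * (t - τ)) * g τ := by
  have hexp (τ : ℝ) :
      HasDerivAt (fun τ : ℝ => Complex.exp (a * (t - τ))) (-a * Complex.exp (a * (t - τ))) τ := by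
    refine (((hasDerivAt_id (τ : ℂ)).const_sub (t : ℂ)).const_mul a).cexp.comp_ofReal.congr_deriv ?_
    simp [mul_comm]
  have hFTC := intervalIntegral.integral_eq_sub_of_hasDerivAt_of_le ht
    (f := fun τ => Complex.exp (a * (t - τ)) * f τ) (f' := fun τ => Complex.exp (a * (t - τ)) * g τ)
    (.mul (by fun_prop) hf)
    (fun τ hτ => ((hexp τ).mul (hderiv τ hτ)).congr_deriv (by ring))
    (((intervalIntegrable_iff_integrableOn_Ioo_of_le ht).2 hg).continuousOn_mul (by fun_prop))
  rw [intervalIntegral.integral_of_le ht, integral_Ioc_eq_integral_Ioo] at hFTC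
  simp [hFTC]

theorem continuous_fourierChar_inner {E : Type*} [NormedAddCommGroup E] [InnerProductSpace ℝ E] :
    Continuous (fun z : E × E => (Real.fourierChar (inner ℝ z.1 z.2) : ℂ)) :=
  continuous_subtype_val.comp (Real.continuous_fourierChar.comp continuous_inner)

section fourier_coefficients
variable {α E : Type*} [NormedAddCommGroup E] [InnerProductSpace ℝ E] [FiniteDimensional ℝ E]
  [MeasurableSpace E] [BorelSpace E] [MeasurableSpace α] {μ : Measure α}

open scoped RealInnerProductSpace

theorem norm_fourierInv_le (f : E → ℂ) (ξ : E) : ‖𝓕⁻ f ξ‖ ≤ ∫ x, ‖f x‖ :=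
  VectorFourier.norm_fourierIntegral_le_integral_norm _ _ _ _ _

theorem continuous_fourierInv {f : E → ℂ} (hf : Integrable f) : Continuous (𝓕⁻ f) :=
  VectorFourier.fourierIntegral_continuous Real.continuous_fourierChar continuous_inner.neg hf

theorem integrable_fourierInv_slice [SFinite μ] {F : α → E → ℂ}
    (hF : Integrable (Function.uncurry F) (μ.prod volume)) (ξ : E) :
    Integrable (fun a => 𝓕⁻ (F a) ξ) μ := by
  have hmul : Integrable (fun z : α × E => Real.fourierChar ⟪z.2, ξ⟫ • F z.1 z.2)
      (μ.prod volume) := by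
    refine hF.mono (AEStronglyMeasurable.smul ?_ hF.1) (.of_forall fun z => ?_)
    · exact (continuous_fourierChar_inner.comp (.prodMk_left ξ)).aestronglyMeasurable.comp_snd
    · simp [Function.uncurry]
  simpa only [Real.fourierInv_eq] using hmul.integral_prod_left

theorem integrable_fourierInv_mul [SFinite μ] {F : α → E → ℂ} {h : E → ℂ}
    (hF : Integrable (Function.uncurry F) (μ.prod volume)) (hh : Integrable h) :
    Integrable (fun z : α × E => 𝓕⁻ (F z.1) z.2 * h z.2) (μ.prod volume) := by
  have hmeas : AEStronglyMeasurable (fun z : α × E => 𝓕⁻ (F z.1) z.2) (μ.prod volume) := by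
    simp only [Real.fourierInv_eq]
    refine AEStronglyMeasurable.integral_prod_right' (ν := (volume : Measure E))
      (f := fun z : (α × E) × E => Real.fourierChar ⟪z.2, z.1.2⟫ • F z.1.1 z.2) (.smul ?_ ?_)
    · exact (continuous_fourierChar_inner.stronglyMeasurable.comp_measurable
        (by fun_prop : Measurable fun z : (α × E) × E => (z.2, z.1.2))).aestronglyMeasurable
    · exact hF.1.comp_quasiMeasurePreserving
        (QuasiMeasurePreserving.prodMap Measure.quasiMeasurePreserving_fst (.id volume))
  refine ((hF.norm.integral_prod_left).mul_prod hh.norm).mono'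
    (hmeas.mul hh.1.comp_snd) (.of_forall fun z => ?_)
  rw [norm_mul]
  exact mul_le_mul_of_nonneg_right (norm_fourierInv_le _ _) (norm_nonneg _)

theorem hasDerivAt_fourierInv_of_dominated {f f' : ℝ → E → ℂ} {bound : E → ℝ} {I : Set ℝ} {t : ℝ}
    {ξ : E} (hI : I ∈ 𝓝 t) (hf : ∀ τ, AEStronglyMeasurable (f τ)) (hint : Integrable (f t))
    (hf' : AEStronglyMeasurable (f' t)) (h_bound : ∀ τ ∈ I, ∀ x, ‖f' τ x‖ ≤ bound x)
    (hbound : Integrable bound)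
    (hderiv : ∀ τ ∈ I, ∀ x, HasDerivAt (fun τ => f τ x) (f' τ x) τ) :
    HasDerivAt (fun τ => 𝓕⁻ (f τ) ξ) (𝓕⁻ (f' t) ξ) t := by
  have hchar : AEStronglyMeasurable fun x : E => (Real.fourierChar ⟪x, ξ⟫ : ℂ) :=
    (continuous_fourierChar_inner.comp (.prodMk_left ξ)).aestronglyMeasurable
  simp only [Real.fourierInv_eq]
  exact (hasDerivAt_integral_of_dominated_loc_of_deriv_le hI
    (F := fun τ x => Real.fourierChar ⟪x, ξ⟫ • f τ x)
    (F' := fun τ x => Real.fourierChar ⟪x, ξ⟫ • f' τ x)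
    (.of_forall fun τ => hchar.mul (hf τ)) (integrable_fourierChar_smul hint ξ) (hchar.mul hf')
    (ae_of_all _ fun x τ hτ => (Circle.norm_smul _ _).trans_le (h_bound τ hτ x)) hbound
    (ae_of_all _ fun x τ hτ => (hderiv τ hτ x).const_smul _)).2

end fourier_coefficients

variable {n : ℕ} (φ : 𝓢(EuclideanSpace ℝ (Fin n), ℂ))

/-- The symbol of the Fourier multiplier `e^{-itΔ}`. -/
noncomputable def freeSymbol (t : ℝ) (ξ : EuclideanSpace ℝ (Fin n)) : ℂ :=
  Complex.exp (Complex.I * (((2 * Real.pi * ‖ξ‖) ^ 2 * t : ℝ) : ℂ))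

theorem norm_freeSymbol (t : ℝ) (ξ : EuclideanSpace ℝ (Fin n)) : ‖freeSymbol t ξ‖ = 1 := by
  rw [freeSymbol, mul_comm]
  exact Complex.norm_exp_ofReal_mul_I _

theorem continuous_freeSymbol :
    Continuous (fun z : ℝ × EuclideanSpace ℝ (Fin n) => freeSymbol z.1 z.2) := by
  unfold freeSymbol
  fun_prop

theorem integrable_freeSymbol_mul_fourier (t : ℝ) :
    Integrable (fun ξ => freeSymbol t ξ * 𝓕 (φ : EuclideanSpace ℝ (Fin n) → ℂ) ξ) := by
  rw [← SchwartzMap.fourier_coe]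
  exact (𝓕 φ).integrable.bdd_mul (c := 1)
    (continuous_freeSymbol.comp (.prodMk_right t)).aestronglyMeasurable
    (.of_forall fun ξ => (norm_freeSymbol t ξ).le)

theorem freeEvolution_eq_fourierInv (t : ℝ) : freeEvolution t φ =
    𝓕⁻ (fun ξ => freeSymbol t ξ * 𝓕 (φ : EuclideanSpace ℝ (Fin n) → ℂ) ξ) :=
  rfl

theorem freeEvolution_zero : freeEvolution 0 φ = φ := by
  have hφ : Integrable (𝓕 (φ : EuclideanSpace ℝ (Fin n) → ℂ)) := by
    simpa [freeSymbol] using integrable_freeSymbol_mul_fourier φ 0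
  simpa [freeEvolution] using φ.continuous.fourierInv_fourier_eq φ.integrable hφ

theorem integral_mul_freeEvolution {f : EuclideanSpace ℝ (Fin n) → ℂ} (hf : Integrable f) (t : ℝ) :
    ∫ x, f x * freeEvolution t φ x =
      ∫ ξ, 𝓕⁻ f ξ * (freeSymbol t ξ * 𝓕 (φ : EuclideanSpace ℝ (Fin n) → ℂ) ξ) :=
  integral_mul_fourierInv hf (integrable_freeSymbol_mul_fourier φ t)

theorem norm_freeEvolution_le (t : ℝ) (x : EuclideanSpace ℝ (Fin n)) :
    ‖freeEvolution t φ x‖ ≤ ∫ ξ, ‖𝓕 (φ : EuclideanSpace ℝ (Fin n) → ℂ) ξ‖ := by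
  simpa only [freeEvolution_eq_fourierInv, norm_mul, norm_freeSymbol, one_mul] using
    norm_fourierInv_le (fun ξ => freeSymbol t ξ * 𝓕 (φ : _ → ℂ) ξ) x

theorem stronglyMeasurable_freeEvolution : StronglyMeasurable
    (fun z : ℝ × EuclideanSpace ℝ (Fin n) => freeEvolution z.1 φ z.2) := by
  have hφ : Continuous (𝓕 (φ : EuclideanSpace ℝ (Fin n) → ℂ)) := by
    rw [← SchwartzMap.fourier_coe]
    exact (𝓕 φ).continuous
  have hcont : Continuous (fun z : (ℝ × EuclideanSpace ℝ (Fin n)) × EuclideanSpace ℝ (Fin n) =>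
      Real.fourierChar (inner ℝ z.2 z.1.2) •
        (freeSymbol z.1.1 z.2 * 𝓕 (φ : EuclideanSpace ℝ (Fin n) → ℂ) z.2)) :=
    (Real.continuous_fourierChar.comp (continuous_snd.inner (by fun_prop))).smul
      ((continuous_freeSymbol.comp (by fun_prop : Continuous fun z :
        (ℝ × EuclideanSpace ℝ (Fin n)) × EuclideanSpace ℝ (Fin n) => (z.1.1, z.2))).mul
        (hφ.comp continuous_snd))
  simpa only [freeEvolution_eq_fourierInv, Real.fourierInv_eq] using
    hcont.stronglyMeasurable.integral_prod_right' (ν := volume)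

variable {φ}

theorem integrable_mul_freeEvolution_sub {F : ℝ → EuclideanSpace ℝ (Fin n) → ℂ} {μ : Measure ℝ}
    (hF : Integrable (Function.uncurry F) (μ.prod volume)) (t : ℝ) :
    Integrable (fun z : ℝ × EuclideanSpace ℝ (Fin n) => F z.1 z.2 * freeEvolution (t - z.1) φ z.2)
      (μ.prod volume) :=
  hF.mul_bdd ((stronglyMeasurable_freeEvolution φ).comp_measurable
    (by fun_prop : Measurable fun z : ℝ × EuclideanSpace ℝ (Fin n) =>
      (t - z.1, z.2))).aestronglyMeasurable
    (.of_forall fun z => norm_freeEvolution_le φ (t - z.1) z.2)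

theorem integrable_freeSymbol_sub_mul {F : ℝ → EuclideanSpace ℝ (Fin n) → ℂ}
    {μ : Measure ℝ} [SFinite μ] (hF : Integrable (Function.uncurry F) (μ.prod volume)) (t : ℝ) :
    Integrable (fun z : ℝ × EuclideanSpace ℝ (Fin n) =>
      freeSymbol (t - z.1) z.2 * 𝓕⁻ (F z.1) z.2 * 𝓕 (φ : _ → ℂ) z.2) (μ.prod volume) := by
  have hφ : Integrable (𝓕 (φ : _ → ℂ)) := (SchwartzMap.fourier_coe φ).symm ▸ (𝓕 φ).integrable
  simpa only [mul_assoc, Function.comp_apply] using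
    (integrable_fourierInv_mul hF hφ).bdd_mul (c := 1)
    (continuous_freeSymbol.comp
      (by fun_prop : Continuous fun z : ℝ × EuclideanSpace ℝ (Fin n) =>
        (t - z.1, z.2))).aestronglyMeasurable
    (.of_forall fun z => (norm_freeSymbol _ _).le)

theorem integral_integral_mul_freeEvolution_sub {F : ℝ → EuclideanSpace ℝ (Fin n) → ℂ}
    {μ : Measure ℝ} [SFinite μ] (hF : Integrable (Function.uncurry F) (μ.prod volume)) (t : ℝ) :
    ∫ τ, (∫ x, F τ x * freeEvolution (t - τ) φ x) ∂μ =
      ∫ ξ, (∫ τ, freeSymbol (t - τ) ξ * 𝓕⁻ (F τ) ξ ∂μ) * 𝓕 (φ : _ → ℂ) ξ := by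
  calc ∫ τ, (∫ x, F τ x * freeEvolution (t - τ) φ x) ∂μ
      = ∫ τ, (∫ ξ, freeSymbol (t - τ) ξ * 𝓕⁻ (F τ) ξ * 𝓕 (φ : _ → ℂ) ξ) ∂μ := by
        refine integral_congr_ae ?_
        filter_upwards [hF.prod_right_ae] with τ hτ
        rw [integral_mul_freeEvolution φ (f := F τ) hτ]
        exact integral_congr_ae (.of_forall fun ξ => by ring)
    _ = ∫ ξ, (∫ τ, freeSymbol (t - τ) ξ * 𝓕⁻ (F τ) ξ * 𝓕 (φ : _ → ℂ) ξ ∂μ) :=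
        integral_integral_swap (integrable_freeSymbol_sub_mul hF t)
    _ = _ := by simp_rw [integral_mul_const]

theorem integral_mul_eq_duhamel {u F : ℝ → EuclideanSpace ℝ (Fin n) → ℂ} {t : ℝ} (ht : 0 ≤ t)
    (hu : ∀ τ ∈ Icc 0 t, Integrable (u τ))
    (hF : Integrable (Function.uncurry F) ((volume.restrict (Ioo 0 t)).prod volume))
    (hcont : ∀ ξ, ContinuousOn (fun τ => 𝓕⁻ (u τ) ξ) (Icc 0 t))
    (hderiv : ∀ ξ, ∀ τ ∈ Ioo 0 t, HasDerivAt (fun τ => 𝓕⁻ (u τ) ξ)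
      (Complex.I * ((2 * Real.pi * ‖ξ‖) ^ 2 * 𝓕⁻ (u τ) ξ + 𝓕⁻ (F τ) ξ)) τ) :
    ∫ x, u t x * φ x = (∫ x, u 0 x * freeEvolution t φ x) +
      Complex.I * ∫ τ in Ioo 0 t, ∫ x, F τ x * freeEvolution (t - τ) φ x := by
  have hcoeff (ξ) : 𝓕⁻ (u t) ξ = freeSymbol t ξ * 𝓕⁻ (u 0) ξ +
      Complex.I * ∫ τ in Ioo 0 t, freeSymbol (t - τ) ξ * 𝓕⁻ (F τ) ξ := by
    rw [eq_cexp_mul_add_integral (f := fun τ => 𝓕⁻ (u τ) ξ)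
      (g := fun τ => Complex.I * 𝓕⁻ (F τ) ξ) (a := Complex.I * (2 * Real.pi * ‖ξ‖) ^ 2) ht
      (hcont ξ) (fun τ hτ => (hderiv ξ τ hτ).congr_deriv (by ring))
      ((integrable_fourierInv_slice hF ξ).const_mul _), ← integral_const_mul]
    simp only [freeSymbol]
    push_cast
    simp only [mul_assoc, mul_left_comm]
  have hu₀ := hu 0 (left_mem_Icc.2 ht)
  have hfree : Integrable fun ξ => 𝓕⁻ (u 0) ξ * (freeSymbol t ξ * 𝓕 (φ : _ → ℂ) ξ) :=
    (integrable_freeSymbol_mul_fourier φ t).bdd_mul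
      (continuous_fourierInv hu₀).aestronglyMeasurable (.of_forall (norm_fourierInv_le (u 0)))
  have hforced : Integrable fun ξ =>
      (∫ τ in Ioo 0 t, freeSymbol (t - τ) ξ * 𝓕⁻ (F τ) ξ) * 𝓕 (φ : _ → ℂ) ξ := by
    simpa only [integral_mul_const] using
      (integrable_freeSymbol_sub_mul (φ := φ) hF t).integral_prod_right
  calc ∫ x, u t x * φ x = ∫ ξ, 𝓕⁻ (u t) ξ * 𝓕 (φ : _ → ℂ) ξ := by
        simpa [freeEvolution_zero, freeSymbol] using
          integral_mul_freeEvolution φ (hu t (right_mem_Icc.2 ht)) 0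
    _ = ∫ ξ, (𝓕⁻ (u 0) ξ * (freeSymbol t ξ * 𝓕 (φ : _ → ℂ) ξ) + Complex.I *
          ((∫ τ in Ioo 0 t, freeSymbol (t - τ) ξ * 𝓕⁻ (F τ) ξ) * 𝓕 (φ : _ → ℂ) ξ)) := by
        simp only [hcoeff]
        congr! 2
        ring
    _ = _ := by
        rw [integral_add hfree (hforced.const_mul _), integral_const_mul,
          ← integral_mul_freeEvolution φ hu₀, integral_integral_mul_freeEvolution_sub hF]

theorem isIntegralSolution_of_hasDerivAt_fourierInv {T : ℝ}
    {V : ℝ → EuclideanSpace ℝ (Fin n) → ℝ} {u : ℝ → EuclideanSpace ℝ (Fin n) → ℂ}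
    (hu : ∀ t ∈ Icc 0 T, Integrable (u t))
    (hVu : Integrable (Function.uncurry fun t x => (V t x : ℂ) * u t x)
      ((volume.restrict (Ioo 0 T)).prod volume))
    (hcont : ∀ ξ, ContinuousOn (fun t => 𝓕⁻ (u t) ξ) (Icc 0 T))
    (hderiv : ∀ ξ, ∀ t ∈ Ioo 0 T, HasDerivAt (fun t => 𝓕⁻ (u t) ξ)
      (Complex.I * ((2 * Real.pi * ‖ξ‖) ^ 2 * 𝓕⁻ (u t) ξ + 𝓕⁻ (fun x => (V t x : ℂ) * u t x) ξ))
      t) :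
    IsIntegralSolution T V u := by
  intro t ht φ
  have hVu' := hVu.mono_measure (Measure.prod_mono
    (Measure.restrict_mono (Ioo_subset_Ioo_right ht.2) le_rfl) (le_refl volume))
  exact ⟨integrable_mul_freeEvolution_sub hVu' t, integral_mul_eq_duhamel ht.1
    (fun τ hτ => hu τ (Icc_subset_Icc_right ht.2 hτ)) hVu'
    (fun ξ => (hcont ξ).mono (Icc_subset_Icc_right ht.2))
    fun ξ τ hτ => hderiv ξ τ (Ioo_subset_Ioo_right ht.2 hτ)⟩

end duhamel

/-- The time dependence `θ(t)` of the regularization. The solution concentrates at spatial scale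
`θ(t)^(1/4) = (1 - t)^(α/2)` as `t → 1`. -/
noncomputable def blowUpScale (α t : ℝ) : ℝ := (1 - t) ^ (2 * α)

/-- The derivative of `blowUpScale α`. -/
noncomputable def blowUpScaleT (α t : ℝ) : ℝ := -(2 * α) * (1 - t) ^ (2 * α - 1)

/-- The second derivative of `blowUpScale α`. -/
noncomputable def blowUpScaleTT (α t : ℝ) : ℝ := 2 * α * (2 * α - 1) * (1 - t) ^ (2 * α - 2)

/-- The solution `u` of the theorem, for a parameter `α` slightly larger than `1`. -/
noncomputable def blowUpSolution (n : ℕ) (α t : ℝ) (x : EuclideanSpace ℝ (Fin n)) : ℂ :=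
  profile n (blowUpScale α t) (blowUpScaleT α t) (‖x‖ ^ 2)

/-- The potential `V` of the theorem, for a parameter `α` slightly larger than `1`. -/
noncomputable def blowUpPotential (n : ℕ) (α t : ℝ) (x : EuclideanSpace ℝ (Fin n)) : ℝ :=
  radialPotential n (blowUpScale α t) (blowUpScaleT α t) (blowUpScaleTT α t) (‖x‖ ^ 2)

section scale
variable {α t T : ℝ}

theorem continuous_blowUpScale (hα : 0 ≤ α) : Continuous (blowUpScale α) :=
  (continuous_const.sub continuous_id).rpow_const fun _ => .inr (by linarith)

theorem continuous_blowUpScaleT (hα : 1 ≤ α) : Continuous (blowUpScaleT α) :=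
  ((continuous_const.sub continuous_id).rpow_const fun _ => .inr (by linarith)).const_mul _

theorem hasDerivAt_blowUpScale (ht : t < 1) :
    HasDerivAt (blowUpScale α) (blowUpScaleT α t) t := by
  refine (((hasDerivAt_id t).const_sub 1).rpow_const (.inl (sub_pos.2 ht).ne')).congr_deriv ?_
  rw [blowUpScaleT, id]
  ring

theorem hasDerivAt_blowUpScaleT (ht : t < 1) :
    HasDerivAt (blowUpScaleT α) (blowUpScaleTT α t) t := by
  refine ((((hasDerivAt_id t).const_sub 1).rpow_const
    (.inl (sub_pos.2 ht).ne')).const_mul (-(2 * α))).congr_deriv ?_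
  rw [blowUpScaleTT, id]
  ring_nf

theorem blowUpScale_nonneg (ht : t ≤ 1) : 0 ≤ blowUpScale α t :=
  Real.rpow_nonneg (sub_nonneg.2 ht) _

theorem blowUpScale_pos (ht : t < 1) : 0 < blowUpScale α t :=
  Real.rpow_pos_of_pos (sub_pos.2 ht) _

theorem blowUpScale_le_one (hα : 0 ≤ α) (ht : t ∈ Icc 0 1) : blowUpScale α t ≤ 1 :=
  Real.rpow_le_one (sub_nonneg.2 ht.2) (by linarith [ht.1]) (by linarith)

theorem sqrt_blowUpScale (ht : t ≤ 1) : √(blowUpScale α t) = (1 - t) ^ α := by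
  rw [blowUpScale, Real.sqrt_eq_rpow, ← Real.rpow_mul (sub_nonneg.2 ht)]
  ring_nf

theorem log_blowUpScale (ht : t < 1) : Real.log (blowUpScale α t) = 2 * α * Real.log (1 - t) :=
  Real.log_rpow (sub_pos.2 ht) _

theorem abs_blowUpScaleT_le (hα : 1 ≤ α) (ht : t ∈ Icc 0 1) :
    |blowUpScaleT α t| ≤ 4 * α ^ 2 * √(blowUpScale α t) := by
  have h := sub_nonneg.2 ht.2
  rw [sqrt_blowUpScale ht.2, blowUpScaleT, abs_mul, abs_neg, abs_of_nonneg (by positivity),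
    abs_of_nonneg (Real.rpow_nonneg h _)]
  exact mul_le_mul (by nlinarith)
    (Real.rpow_le_rpow_of_exponent_ge_of_imp h (by linarith [ht.1]) (by linarith)
      fun _ _ => by linarith) (by positivity) (by positivity)

theorem abs_blowUpScaleTT_le (hα : 1 ≤ α) (ht : t ∈ Icc 0 1) :
    |blowUpScaleTT α t| ≤ 4 * α ^ 2 := by
  have h := sub_nonneg.2 ht.2
  have hle : (1 - t) ^ (2 * α - 2) ≤ 1 :=
    Real.rpow_le_one h (by linarith [ht.1]) (by linarith)
  have hB : 0 ≤ 2 * α * (2 * α - 1) := mul_nonneg (by linarith) (by linarith)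
  rw [blowUpScaleTT, abs_of_nonneg (mul_nonneg hB (Real.rpow_nonneg h _))]
  nlinarith [mul_le_mul_of_nonneg_left hle hB]

theorem sq_le_blowUpScale (hα : 0 ≤ α) (ht : t ≤ T) (hT : T ≤ 1) :
    ((1 - T) ^ α) ^ 2 ≤ blowUpScale α t := by
  rw [blowUpScale, mul_comm, Real.rpow_mul (by linarith), Real.rpow_two]
  gcongr

end scale

section slices
variable {n : ℕ} {α t T : ℝ}

theorem measurable_blowUpSolution :
    Measurable (Function.uncurry (blowUpSolution n α)) := by
  have := (expNegInvGlue.contDiff (n := 0)).continuous.measurable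
  unfold Function.uncurry blowUpSolution profile logAmplitude phase coreDenom charRoot smoothAbs
    blowUpScale blowUpScaleT
  fun_prop

theorem measurable_blowUpPotential :
    Measurable (Function.uncurry (blowUpPotential n α)) := by
  have := (expNegInvGlue.contDiff (n := 0)).continuous.measurable
  unfold Function.uncurry blowUpPotential radialPotential logAmplitudeYY logAmplitudeY phaseY phaseT
    coreDenomYY coreDenomY coreDenom charRoot smoothAbs blowUpScale blowUpScaleT blowUpScaleTT
  fun_prop

theorem norm_blowUpSolution_le (hα : 0 ≤ α) (ht : t ∈ Icc 0 1) {x : EuclideanSpace ℝ (Fin n)}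
    (hx : x ≠ 0) :
    ‖blowUpSolution n α t x‖ ≤ 20 ^ coreExponent n *
      (‖x‖ ^ (-(n / 2 : ℝ)) * (1 + ‖x‖ ^ 2) ^ (-coreExponent n)) := by
  have hθ := blowUpScale_nonneg (α := α) ht.2
  have h := norm_profile_le_of_le_smoothAbs (n := n) (θ₁ := blowUpScaleT α t) hθ
    (blowUpScale_le_one hα ht) (sq_nonneg ‖x‖) (by positivity) (le_smoothAbs hθ (‖x‖ ^ 2))
  rwa [← Real.rpow_natCast_mul (norm_nonneg x), show ((2 : ℕ) : ℝ) * -(n / 4) = -(n / 2 : ℝ) by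
    push_cast; ring] at h

theorem exists_norm_blowUpSolution_le (n : ℕ) (hα : 0 ≤ α) (hT : T < 1) :
    ∃ C, 0 ≤ C ∧ ∀ t ∈ Icc 0 T, ∀ x,
      ‖blowUpSolution n α t x‖ ≤ C * (1 + ‖x‖ ^ 2) ^ (-((n + 1) / 2 : ℝ)) := by
  have hε : 0 < (1 - T) ^ α := Real.rpow_pos_of_pos (sub_pos.2 hT) _
  exact ⟨_, by positivity, fun t ht x => norm_profile_le_of_sq_le_theta hε
    (sq_le_blowUpScale hα ht.2 hT.le) (blowUpScale_le_one hα ⟨ht.1, ht.2.trans hT.le⟩)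
    (sq_nonneg _)⟩

theorem integrable_one_add_norm_sq_rpow_neg (n : ℕ) :
    Integrable (fun x : EuclideanSpace ℝ (Fin n) => (1 + ‖x‖ ^ 2) ^ (-((n + 1) / 2 : ℝ))) := by
  rw [← neg_div]
  exact integrable_rpow_neg_one_add_norm_sq (by simp)

theorem integrable_norm_blowUpSolution_majorant (hn : n ≠ 0) :
    Integrable (fun x : EuclideanSpace ℝ (Fin n) => 20 ^ coreExponent n *
      (‖x‖ ^ (-(n / 2 : ℝ)) * (1 + ‖x‖ ^ 2) ^ (-coreExponent n))) := by
  have hn' : (0 : ℝ) < n := by positivity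
  refine (integrable_norm_rpow_mul_one_add_norm_sq_rpow (by positivity)
    (coreExponent_pos n).le ?_ ?_).const_mul _
  · rw [finrank_euclideanSpace_fin]
    linarith
  · rw [finrank_euclideanSpace_fin, coreExponent]
    linarith

theorem ae_norm_blowUpSolution_le (hn : n ≠ 0) (hα : 0 ≤ α) (ht : t ∈ Icc 0 1) :
    ∀ᵐ x : EuclideanSpace ℝ (Fin n), ‖blowUpSolution n α t x‖ ≤ 20 ^ coreExponent n *
      (‖x‖ ^ (-(n / 2 : ℝ)) * (1 + ‖x‖ ^ 2) ^ (-coreExponent n)) := by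
  have : NeZero n := ⟨hn⟩
  filter_upwards [Measure.ae_ne volume 0] with x hx using norm_blowUpSolution_le hα ht hx

theorem integrable_blowUpSolution (hn : n ≠ 0) (hα : 0 ≤ α) (ht : t ∈ Icc 0 1) :
    Integrable (blowUpSolution n α t) :=
  (integrable_norm_blowUpSolution_majorant hn).mono'
    (measurable_blowUpSolution.of_uncurry_left).aestronglyMeasurable
    (ae_norm_blowUpSolution_le hn hα ht)

theorem continuousOn_profile {y : ℝ} (hy : 0 < y) :
    ContinuousOn (fun z : ℝ × ℝ => profile n z.1 z.2 y) (Icc 0 1 ×ˢ univ) := by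
  have hw : Continuous fun z : ℝ × ℝ => smoothAbs z.1 y := by unfold smoothAbs; fun_prop
  have hw₀ : ∀ z ∈ Icc (0 : ℝ) 1 ×ˢ (univ : Set ℝ), 0 < smoothAbs z.1 y :=
    fun z hz => smoothAbs_pos_of_pos hz.1.1 hy
  have hs : Continuous fun z : ℝ × ℝ => charRoot z.1 y := continuous_const.add hw
  have hs₀ : ∀ z ∈ Icc (0 : ℝ) 1 ×ˢ (univ : Set ℝ), charRoot z.1 y ≠ 0 :=
    fun z hz => (add_pos hy (hw₀ z hz)).ne'
  have hquot : ContinuousOn (fun z : ℝ × ℝ => expNegInvGlue (y / smoothAbs z.1 y))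
      (Icc 0 1 ×ˢ univ) :=
    (expNegInvGlue.contDiff (n := 0)).continuous.comp_continuousOn
      (continuousOn_const.div hw.continuousOn fun z hz => (hw₀ z hz).ne')
  have hQ : ContinuousOn (fun z : ℝ × ℝ => coreDenom z.1 y) (Icc 0 1 ×ˢ univ) :=
    (hw.continuousOn.add ((continuousOn_const.sub (hs.continuousOn.log hs₀)).const_mul y)).add
      ((hs.const_mul y).continuousOn.mul hquot)
  have hA : ContinuousOn (fun z : ℝ × ℝ => logAmplitude n z.1 y) (Icc 0 1 ×ˢ univ) :=
    ((hw.continuousOn.log fun z hz => (hw₀ z hz).ne').div_const 2).sub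
      ((hQ.log fun z hz => (coreDenom_pos hz.1.1 hz.1.2 hy.le (hw₀ z hz)).ne').const_mul _)
  have hφ : ContinuousOn (fun z : ℝ × ℝ => phase z.1 z.2 y) (Icc 0 1 ×ˢ univ) :=
    continuousOn_snd.div (hs.const_mul 16).continuousOn fun z hz =>
      mul_ne_zero (by norm_num) (hs₀ z hz)
  unfold profile
  fun_prop

theorem continuousOn_blowUpSolution (hα : 1 ≤ α) {x : EuclideanSpace ℝ (Fin n)} (hx : x ≠ 0) :
    ContinuousOn (fun t => blowUpSolution n α t x) (Icc 0 1) := by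
  have hc : Continuous fun t => (blowUpScale α t, blowUpScaleT α t) :=
    (continuous_blowUpScale (by linarith)).prodMk (continuous_blowUpScaleT hα)
  have hmaps : MapsTo (fun t => (blowUpScale α t, blowUpScaleT α t)) (Icc 0 1)
      (Icc 0 1 ×ˢ univ) := fun t ht =>
    ⟨⟨blowUpScale_nonneg ht.2, blowUpScale_le_one (by linarith) ht⟩, mem_univ _⟩
  have hx₂ : 0 < ‖x‖ ^ 2 := by positivity
  exact ((continuousOn_profile hx₂).comp hc.continuousOn hmaps).congr fun _ _ => rfl

theorem continuousOn_fourierInv_blowUpSolution (hn : n ≠ 0) (hα : 1 ≤ α)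
    (ξ : EuclideanSpace ℝ (Fin n)) :
    ContinuousOn (fun t => 𝓕⁻ (blowUpSolution n α t) ξ) (Icc 0 1) := by
  have : NeZero n := ⟨hn⟩
  simp only [Real.fourierInv_eq]
  refine continuousOn_of_dominated (fun t _ => ?_) (fun t ht => ?_)
    (integrable_norm_blowUpSolution_majorant hn) ?_
  · exact (continuous_fourierChar_inner.comp (.prodMk_left ξ)).aestronglyMeasurable.mul
      measurable_blowUpSolution.of_uncurry_left.aestronglyMeasurable
  · simpa only [Circle.norm_smul] using ae_norm_blowUpSolution_le hn (by linarith) ht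
  · filter_upwards [Measure.ae_ne volume 0] with x hx
    exact (continuousOn_blowUpSolution hα hx).const_smul _

end slices

/-- The Laplacian of `blowUpSolution n α t`. -/
noncomputable def blowUpLaplacian (n : ℕ) (α t : ℝ) (x : EuclideanSpace ℝ (Fin n)) : ℂ :=
  4 * (‖x‖ : ℂ) ^ 2 * profileYY n (blowUpScale α t) (blowUpScaleT α t) (‖x‖ ^ 2) +
    2 * n * profileY n (blowUpScale α t) (blowUpScaleT α t) (‖x‖ ^ 2)

section fourier_equation
variable {n : ℕ} {α t T : ℝ}

theorem exists_one_add_mul_norm_profileY_blowUpScale_le (n : ℕ) (hα : 1 ≤ α) (hT : T < 1) :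
    ∃ C, ∀ t ∈ Icc 0 T, ∀ x : EuclideanSpace ℝ (Fin n),
      (1 + ‖x‖ ^ 2) * ‖profileY n (blowUpScale α t) (blowUpScaleT α t) (‖x‖ ^ 2)‖ ≤
        C * (1 + ‖x‖ ^ 2) ^ (-((n + 1) / 2 : ℝ)) := by
  obtain ⟨C, hC₀, hC⟩ := exists_norm_profileY_mul_smoothAbs_le n (4 * α ^ 2)
  obtain ⟨C', hC'⟩ := exists_one_add_pow_mul_le n
    (Real.rpow_pos_of_pos (sub_pos.2 hT) α) hC₀ 1 1
  refine ⟨C', fun t ht x => ?_⟩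
  have ht₁ : t ∈ Icc (0 : ℝ) 1 := ⟨ht.1, ht.2.trans hT.le⟩
  have hle := blowUpScale_le_one (zero_le_one.trans hα) ht₁
  have h := hC (blowUpScale_pos (ht.2.trans_lt hT)) hle (sq_nonneg ‖x‖)
    (abs_blowUpScaleT_le hα ht₁)
  rw [← pow_one (smoothAbs _ _), ← pow_one (1 - Real.log _)] at h
  simpa only [pow_one] using hC' (sq_le_blowUpScale (by linarith) ht.2 hT.le) hle (sq_nonneg ‖x‖)
    (norm_nonneg _) h

theorem exists_one_add_sq_mul_norm_profileYY_blowUpScale_le (n : ℕ) (hα : 1 ≤ α) (hT : T < 1) :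
    ∃ C, ∀ t ∈ Icc 0 T, ∀ x : EuclideanSpace ℝ (Fin n),
      (1 + ‖x‖ ^ 2) ^ 2 * ‖profileYY n (blowUpScale α t) (blowUpScaleT α t) (‖x‖ ^ 2)‖ ≤
        C * (1 + ‖x‖ ^ 2) ^ (-((n + 1) / 2 : ℝ)) := by
  obtain ⟨C, hC₀, hC⟩ := exists_norm_profileYY_mul_smoothAbs_sq_le n (4 * α ^ 2)
  obtain ⟨C', hC'⟩ := exists_one_add_pow_mul_le n
    (Real.rpow_pos_of_pos (sub_pos.2 hT) α) hC₀ 2 2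
  refine ⟨C', fun t ht x => ?_⟩
  have ht₁ : t ∈ Icc (0 : ℝ) 1 := ⟨ht.1, ht.2.trans hT.le⟩
  have hle := blowUpScale_le_one (zero_le_one.trans hα) ht₁
  exact hC' (sq_le_blowUpScale (by linarith) ht.2 hT.le) hle (sq_nonneg ‖x‖) (norm_nonneg _)
    (hC (blowUpScale_pos (ht.2.trans_lt hT)) hle (sq_nonneg ‖x‖) (abs_blowUpScaleT_le hα ht₁))

theorem exists_abs_blowUpPotential_le (n : ℕ) (hα : 1 ≤ α) :
    ∃ C, 0 ≤ C ∧ ∀ t ∈ Ico 0 1, ∀ x, |blowUpPotential n α t x| ≤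
      C * (1 - Real.log (blowUpScale α t)) ^ 2 / smoothAbs (blowUpScale α t) (‖x‖ ^ 2) := by
  obtain ⟨C, hC₀, hC⟩ := exists_abs_radialPotential_le n (4 * α ^ 2)
  refine ⟨C, hC₀, fun t ht x => ?_⟩
  have ht₁ := Ico_subset_Icc_self ht
  exact hC (blowUpScale_pos ht.2) (blowUpScale_le_one (zero_le_one.trans hα) ht₁)
    (sq_nonneg ‖x‖) (abs_blowUpScaleT_le hα ht₁) (abs_blowUpScaleTT_le hα ht₁)

theorem exists_norm_blowUpPotential_mul_blowUpSolution_le (n : ℕ) (hα : 1 ≤ α) (hT : T < 1) :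
    ∃ C, ∀ t ∈ Icc 0 T, ∀ x : EuclideanSpace ℝ (Fin n),
      ‖(blowUpPotential n α t x : ℂ) * blowUpSolution n α t x‖ ≤
        C * (1 + ‖x‖ ^ 2) ^ (-((n + 1) / 2 : ℝ)) := by
  obtain ⟨C, hC₀, hC⟩ := exists_abs_blowUpPotential_le n hα
  obtain ⟨C', hC'⟩ := exists_one_add_pow_mul_le n
    (Real.rpow_pos_of_pos (sub_pos.2 hT) α) hC₀ 1 2
  refine ⟨C', fun t ht x => ?_⟩
  have ht₁ : t < 1 := ht.2.trans_lt hT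
  have hw := smoothAbs_pos (blowUpScale_pos (α := α) ht₁) (‖x‖ ^ 2)
  have hle := (le_div_iff₀ hw).1 (hC t ⟨ht.1, ht₁⟩ x)
  rw [norm_mul, Complex.norm_real, Real.norm_eq_abs]
  refine (le_mul_of_one_le_left (by positivity) ?_).trans
    (hC' (sq_le_blowUpScale (by linarith) ht.2 hT.le)
      (blowUpScale_le_one (by linarith) ⟨ht.1, ht₁.le⟩) (sq_nonneg ‖x‖) (by positivity)
      (θ₁ := blowUpScaleT α t) ?_)
  · rw [pow_one]
    linarith [sq_nonneg ‖x‖]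
  · rw [pow_one, mul_right_comm]
    exact mul_le_mul_of_nonneg_right hle (norm_nonneg _)

theorem integrable_of_norm_le_one_add_norm_sq_rpow {f : EuclideanSpace ℝ (Fin n) → ℂ} {C : ℝ}
    (hf : Measurable f) (h : ∀ x, ‖f x‖ ≤ C * (1 + ‖x‖ ^ 2) ^ (-((n + 1) / 2 : ℝ))) :
    Integrable f :=
  ((integrable_one_add_norm_sq_rpow_neg n).const_mul C).mono' hf.aestronglyMeasurable
    (ae_of_all _ h)

theorem measurable_blowUpPotential_mul_blowUpSolution : Measurable
    (Function.uncurry fun t x => (blowUpPotential n α t x : ℂ) * blowUpSolution n α t x) :=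
  (Complex.measurable_ofReal.comp measurable_blowUpPotential).mul measurable_blowUpSolution

theorem measurable_profileY_comp (n : ℕ) (θ θ₁ : ℝ) :
    Measurable fun x : EuclideanSpace ℝ (Fin n) => profileY n θ θ₁ (‖x‖ ^ 2) := by
  have := (expNegInvGlue.contDiff (n := 0)).continuous.measurable
  unfold profileY profile logAmplitudeY logAmplitude phaseY phase coreDenomY coreDenom charRoot
    smoothAbs
  fun_prop

theorem measurable_profileYY_comp (n : ℕ) (θ θ₁ : ℝ) :
    Measurable fun x : EuclideanSpace ℝ (Fin n) => profileYY n θ θ₁ (‖x‖ ^ 2) := by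
  have := (expNegInvGlue.contDiff (n := 0)).continuous.measurable
  unfold profileYY profile logAmplitudeYY logAmplitudeY logAmplitude phaseYY phaseY phase
    coreDenomYY coreDenomY coreDenom charRoot smoothAbs
  fun_prop

theorem measurable_blowUpLaplacian : Measurable (blowUpLaplacian n α t) := by
  have := measurable_profileY_comp n (blowUpScale α t) (blowUpScaleT α t)
  have := measurable_profileYY_comp n (blowUpScale α t) (blowUpScaleT α t)
  unfold blowUpLaplacian
  fun_prop

theorem exists_norm_blowUpLaplacian_le (n : ℕ) (hα : 1 ≤ α) (hT : T < 1) :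
    ∃ C, ∀ t ∈ Icc 0 T, ∀ x : EuclideanSpace ℝ (Fin n),
      ‖blowUpLaplacian n α t x‖ ≤ C * (1 + ‖x‖ ^ 2) ^ (-((n + 1) / 2 : ℝ)) := by
  obtain ⟨C₁, hC₁⟩ := exists_one_add_mul_norm_profileY_blowUpScale_le n hα hT
  obtain ⟨C₂, hC₂⟩ := exists_one_add_sq_mul_norm_profileYY_blowUpScale_le n hα hT
  refine ⟨4 * C₂ + 2 * n * C₁, fun t ht x => ?_⟩
  have hx := sq_nonneg ‖x‖
  have h₁ := (le_mul_of_one_le_left (norm_nonneg _) (by linarith)).trans (hC₁ t ht x)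
  have h₂ := (mul_le_mul_of_nonneg_right (by nlinarith : ‖x‖ ^ 2 ≤ (1 + ‖x‖ ^ 2) ^ 2)
    (norm_nonneg _)).trans (hC₂ t ht x)
  calc ‖blowUpLaplacian n α t x‖
      ≤ 4 * (‖x‖ ^ 2 * ‖profileYY n (blowUpScale α t) (blowUpScaleT α t) (‖x‖ ^ 2)‖) +
          2 * n * ‖profileY n (blowUpScale α t) (blowUpScaleT α t) (‖x‖ ^ 2)‖ := by
        refine (norm_add_le _ _).trans_eq ?_
        simp [mul_assoc]
    _ ≤ 4 * (C₂ * (1 + ‖x‖ ^ 2) ^ (-((n + 1) / 2 : ℝ))) +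
          2 * n * (C₁ * (1 + ‖x‖ ^ 2) ^ (-((n + 1) / 2 : ℝ))) := by gcongr
    _ = _ := by ring

theorem fourierInv_blowUpLaplacian (hα : 1 ≤ α) (ht : t ∈ Ico 0 1)
    (ξ : EuclideanSpace ℝ (Fin n)) :
    𝓕⁻ (blowUpLaplacian n α t) ξ =
      -(2 * Real.pi * ‖ξ‖) ^ 2 * 𝓕⁻ (blowUpSolution n α t) ξ := by
  have hθ := blowUpScale_pos (α := α) ht.2
  have hle := blowUpScale_le_one (zero_le_one.trans hα) (Ico_subset_Icc_self ht)
  obtain ⟨C₀, -, hC₀⟩ := exists_norm_blowUpSolution_le n (zero_le_one.trans hα) ht.2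
  obtain ⟨C₁, hC₁⟩ := exists_one_add_mul_norm_profileY_blowUpScale_le n hα ht.2
  obtain ⟨C₂, hC₂⟩ := exists_one_add_sq_mul_norm_profileYY_blowUpScale_le n hα ht.2
  have htt : t ∈ Icc 0 t := ⟨ht.1, le_rfl⟩
  have hmeas := measurable_profileY_comp n (blowUpScale α t) (blowUpScaleT α t)
  have hmeas₂ := measurable_profileYY_comp n (blowUpScale α t) (blowUpScaleT α t)
  have h := fourierInv_radial_laplacian (E := EuclideanSpace ℝ (Fin n))
    (fun y hy => hasDerivAt_profile (θ₁ := blowUpScaleT α t) hθ hle hy)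
    (fun y hy => hasDerivAt_profileY hθ hle hy)
    (integrable_of_norm_le_one_add_norm_sq_rpow
      measurable_blowUpSolution.of_uncurry_left (hC₀ t htt))
    (integrable_of_norm_le_one_add_norm_sq_rpow hmeas fun x =>
      (le_mul_of_one_le_left (norm_nonneg _) (by nlinarith)).trans (hC₁ t htt x))
    (integrable_of_norm_le_one_add_norm_sq_rpow (by fun_prop) fun x => by
      rw [norm_mul, Complex.norm_real, norm_norm]
      exact (mul_le_mul_of_nonneg_right (by nlinarith) (norm_nonneg _)).trans (hC₁ t htt x))
    (integrable_of_norm_le_one_add_norm_sq_rpow (by fun_prop) fun x => by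
      rw [norm_mul, norm_pow, Complex.norm_real, norm_norm]
      exact (mul_le_mul_of_nonneg_right (by nlinarith) (norm_nonneg _)).trans (hC₂ t htt x)) ξ
  rw [finrank_euclideanSpace_fin] at h
  exact h

theorem hasDerivAt_blowUpSolution (hα : 0 ≤ α) (ht : t ∈ Ico 0 1)
    (x : EuclideanSpace ℝ (Fin n)) :
    HasDerivAt (fun t => blowUpSolution n α t x) (Complex.I *
      (blowUpPotential n α t x * blowUpSolution n α t x - blowUpLaplacian n α t x)) t := by
  have h := hasDerivAt_profile_comp (n := n) (hasDerivAt_blowUpScale (α := α) ht.2)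
    (hasDerivAt_blowUpScaleT ht.2) (blowUpScale_pos ht.2)
    (blowUpScale_le_one hα (Ico_subset_Icc_self ht)) (sq_nonneg ‖x‖)
  rw [Complex.ofReal_pow] at h
  exact h

theorem hasDerivAt_fourierInv_blowUpSolution (hα : 1 ≤ α) (ht : t ∈ Ioo 0 1)
    (ξ : EuclideanSpace ℝ (Fin n)) :
    HasDerivAt (fun t => 𝓕⁻ (blowUpSolution n α t) ξ)
      (Complex.I * ((2 * Real.pi * ‖ξ‖) ^ 2 * 𝓕⁻ (blowUpSolution n α t) ξ +
        𝓕⁻ (fun x => (blowUpPotential n α t x : ℂ) * blowUpSolution n α t x) ξ)) t := by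
  obtain ⟨T, htT, hT⟩ := exists_between ht.2
  have ht' : t ∈ Icc 0 T := ⟨ht.1.le, htT.le⟩
  obtain ⟨C₀, -, hC₀⟩ := exists_norm_blowUpSolution_le n (zero_le_one.trans hα) hT
  obtain ⟨C₁, hC₁⟩ := exists_norm_blowUpPotential_mul_blowUpSolution_le n hα hT
  obtain ⟨C₂, hC₂⟩ := exists_norm_blowUpLaplacian_le n hα hT
  have hu (τ) : Measurable (blowUpSolution n α τ) := measurable_blowUpSolution.of_uncurry_left
  have hVu : Measurable fun x => (blowUpPotential n α t x : ℂ) * blowUpSolution n α t x :=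
    measurable_blowUpPotential_mul_blowUpSolution.of_uncurry_left
  have hVu_int := integrable_of_norm_le_one_add_norm_sq_rpow hVu (hC₁ t ht')
  have hlap_int :=
    integrable_of_norm_le_one_add_norm_sq_rpow measurable_blowUpLaplacian (hC₂ t ht')
  have h := hasDerivAt_fourierInv_of_dominated (ξ := ξ) (Ioo_mem_nhds ht.1 htT)
    (fun τ => (hu τ).aestronglyMeasurable)
    (integrable_of_norm_le_one_add_norm_sq_rpow (hu t) (hC₀ t ht'))
    (f' := fun τ x => Complex.I *
      (blowUpPotential n α τ x * blowUpSolution n α τ x - blowUpLaplacian n α τ x))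
    ((hVu.sub measurable_blowUpLaplacian).const_mul _).aestronglyMeasurable
    (bound := fun x => (C₁ + C₂) * (1 + ‖x‖ ^ 2) ^ (-((n + 1) / 2 : ℝ)))
    (fun τ hτ x => ?_) ((integrable_one_add_norm_sq_rpow_neg n).const_mul _)
    fun τ hτ x => hasDerivAt_blowUpSolution (by linarith) ⟨hτ.1.le, hτ.2.trans hT⟩ x
  · refine h.congr_deriv ?_
    rw [fourierInv_const_mul_sub hVu_int hlap_int,
      fourierInv_blowUpLaplacian hα (Ioo_subset_Ico_self ht)]
    ring
  · have hτ' := Ioo_subset_Icc_self hτ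
    rw [norm_mul, Complex.norm_I, one_mul, add_mul]
    exact (norm_sub_le _ _).trans (add_le_add (hC₁ τ hτ' x) (hC₂ τ hτ' x))

end fourier_equation

section integral_solution
variable {n : ℕ} {α β : ℝ}

theorem integrableOn_one_sub_rpow_iff :
    IntegrableOn (fun t : ℝ => (1 - t) ^ β) (Ioo 0 1) ↔ -1 < β := by
  have hpre : (fun t : ℝ => 1 - t) ⁻¹' Ioo 0 1 = Ioo 0 1 := by simp
  have h := (volume.measurePreserving_sub_left (1 : ℝ)).integrableOn_comp_preimage
    (Homeomorph.subLeft (1 : ℝ)).measurableEmbedding (f := fun t => t ^ β) (s := Ioo 0 1)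
  rw [hpre] at h
  exact h.trans (intervalIntegral.integrableOn_Ioo_rpow_iff zero_lt_one)

theorem one_le_one_sub_log_blowUpScale {t : ℝ} (hα : 0 ≤ α) (ht : t ∈ Icc 0 1) :
    1 ≤ 1 - Real.log (blowUpScale α t) := by
  linarith [Real.log_nonpos (blowUpScale_nonneg ht.2) (blowUpScale_le_one hα ht)]

theorem exists_one_sub_log_blowUpScale_le {δ : ℝ} (hα : 0 ≤ α) (hδ : 0 < δ) :
    ∃ C, 0 < C ∧ ∀ t ∈ Ico 0 1, 1 - Real.log (blowUpScale α t) ≤ C * (1 - t) ^ (-δ) := by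
  refine ⟨1 + 2 * α / δ, by positivity, fun t ht => ?_⟩
  have ht₁ := sub_pos.2 ht.2
  have hlog : -Real.log (1 - t) ≤ (1 - t) ^ (-δ) / δ := by
    rw [← Real.log_inv, Real.rpow_neg ht₁.le, ← Real.inv_rpow ht₁.le]
    exact Real.log_le_rpow_div (inv_nonneg.2 ht₁.le) hδ
  have hone : 1 ≤ (1 - t) ^ (-δ) :=
    Real.one_le_rpow_of_pos_of_le_one_of_nonpos ht₁ (by linarith [ht.1]) (by linarith)
  calc 1 - Real.log (blowUpScale α t) = 1 + 2 * α * -Real.log (1 - t) := by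
        rw [log_blowUpScale ht.2]
        ring
    _ ≤ (1 - t) ^ (-δ) + 2 * α * ((1 - t) ^ (-δ) / δ) := by gcongr
    _ = _ := by ring

theorem integrableOn_log_blowUpScale_rpow_mul {k : ℝ} (hα : 0 ≤ α) (hk : 0 ≤ k) (hβ : β < 1) :
    IntegrableOn (fun t => (1 - Real.log (blowUpScale α t)) ^ k * (1 - t) ^ (-β)) (Ioo 0 1) := by
  set δ := (1 - β) / (2 * (k + 1)) with hδ
  have hβ' : 0 < 1 - β := sub_pos.2 hβ
  have hδ₀ : 0 < δ := by positivity
  have hδk : δ * k + β < 1 := by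
    have h : δ * (2 * (k + 1)) = 1 - β := by rw [hδ]; field_simp
    nlinarith
  obtain ⟨C, hC₀, hC⟩ := exists_one_sub_log_blowUpScale_le hα hδ₀
  have hmeas : Measurable fun t => (1 - Real.log (blowUpScale α t)) ^ k * (1 - t) ^ (-β) := by
    unfold blowUpScale
    fun_prop
  refine ((integrableOn_one_sub_rpow_iff (β := -(δ * k + β)).2 (by linarith)).const_mul
    (C ^ k)).mono' hmeas.aestronglyMeasurable
      (ae_restrict_of_forall_mem measurableSet_Ioo fun t ht => ?_)
  have ht₁ := sub_pos.2 ht.2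
  have hL := zero_le_one.trans (one_le_one_sub_log_blowUpScale hα (Ioo_subset_Icc_self ht))
  rw [Real.norm_of_nonneg (by positivity)]
  calc (1 - Real.log (blowUpScale α t)) ^ k * (1 - t) ^ (-β)
      ≤ (C * (1 - t) ^ (-δ)) ^ k * (1 - t) ^ (-β) := by
        gcongr
        exact hC t (Ioo_subset_Ico_self ht)
    _ = C ^ k * (1 - t) ^ (-(δ * k + β)) := by
        rw [Real.mul_rpow hC₀.le (by positivity), ← Real.rpow_mul ht₁.le, mul_assoc,
          ← Real.rpow_add ht₁]
        ring_nf

theorem inv_mul_rpow_neg_mul_le {w τ y e m κ : ℝ} (hτ : 0 < τ) (hy : 0 < y) (hτw : τ ≤ w)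
    (hyw : y ≤ w) (he₀ : 0 ≤ e) (he₁ : e ≤ 1) (hm : 0 ≤ m) (hκ : 0 ≤ κ) :
    w⁻¹ * (w ^ (-m) * (1 + w) ^ (-κ)) ≤ τ ^ (-e) * (y ^ (-(1 - e + m)) * (1 + y) ^ (-κ)) := by
  have hw := hτ.trans_le hτw
  have hsplit : w⁻¹ * w ^ (-m) = w ^ (-e) * w ^ (-(1 - e + m)) := by
    rw [← Real.rpow_neg_one, ← Real.rpow_add hw, ← Real.rpow_add hw]
    ring_nf
  rw [← mul_assoc, hsplit, mul_assoc]
  gcongr ?_ * (?_ * ?_)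
  · exact Real.rpow_le_rpow_of_nonpos hτ hτw (by linarith)
  · exact Real.rpow_le_rpow_of_nonpos hy hyw (by linarith)
  · exact Real.rpow_le_rpow_of_nonpos (by positivity) (by linarith) (by linarith)

theorem exists_norm_blowUpPotential_mul_blowUpSolution_le_mul {e : ℝ} (n : ℕ) (hα : 1 ≤ α)
    (he₀ : 0 ≤ e) (he₁ : e ≤ 1) :
    ∃ C, ∀ t ∈ Ico 0 1, ∀ x : EuclideanSpace ℝ (Fin n), x ≠ 0 →
      ‖(blowUpPotential n α t x : ℂ) * blowUpSolution n α t x‖ ≤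
        C * ((1 - Real.log (blowUpScale α t)) ^ (2 : ℝ) * (1 - t) ^ (-(α * e))) *
          (‖x‖ ^ (-(2 * (1 - e) + n / 2)) * (1 + ‖x‖ ^ 2) ^ (-coreExponent n)) := by
  obtain ⟨C, hC₀, hC⟩ := exists_abs_blowUpPotential_le n hα
  refine ⟨C * 20 ^ coreExponent n, fun t ht x hx => ?_⟩
  have hθ := blowUpScale_pos (α := α) ht.2
  have hle := blowUpScale_le_one (zero_le_one.trans hα) (Ico_subset_Icc_self ht)
  have hy : 0 < ‖x‖ ^ 2 := by positivity
  have ht₁ := sub_pos.2 ht.2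
  set w := smoothAbs (blowUpScale α t) (‖x‖ ^ 2)
  have hw : 0 < w := smoothAbs_pos hθ _
  have hτw : (1 - t) ^ α ≤ w := by
    rw [← sqrt_blowUpScale ht.2.le]
    exact sqrt_le_smoothAbs _ _
  rw [norm_mul, Complex.norm_real, Real.norm_eq_abs]
  calc |blowUpPotential n α t x| * ‖blowUpSolution n α t x‖
      ≤ C * (1 - Real.log (blowUpScale α t)) ^ 2 / w * (20 ^ coreExponent n *
          (w ^ (-(n / 4 : ℝ)) * (1 + w) ^ (-coreExponent n))) :=
        mul_le_mul (hC t ht x) (norm_profile_le hθ.le hle hy.le hw) (norm_nonneg _) (by positivity)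
    _ = C * 20 ^ coreExponent n * (1 - Real.log (blowUpScale α t)) ^ 2 *
          (w⁻¹ * (w ^ (-(n / 4 : ℝ)) * (1 + w) ^ (-coreExponent n))) := by ring
    _ ≤ C * 20 ^ coreExponent n * (1 - Real.log (blowUpScale α t)) ^ 2 *
          (((1 - t) ^ α) ^ (-e) * ((‖x‖ ^ 2) ^ (-(1 - e + n / 4)) *
            (1 + ‖x‖ ^ 2) ^ (-coreExponent n))) :=
        mul_le_mul_of_nonneg_left (inv_mul_rpow_neg_mul_le (Real.rpow_pos_of_pos ht₁ α) hy hτw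
          (le_smoothAbs hθ.le _) he₀ he₁ (by positivity) (coreExponent_pos n).le) (by positivity)
    _ = _ := by
        rw [← Real.rpow_mul ht₁.le, ← Real.rpow_natCast_mul (norm_nonneg x), Real.rpow_two]
        push_cast
        ring_nf

theorem integrable_blowUpPotential_mul_blowUpSolution (hn : 2 ≤ n) (hα₁ : 1 ≤ α) (hα₂ : α < 2) :
    Integrable (Function.uncurry fun t x =>
      (blowUpPotential n α t x : ℂ) * blowUpSolution n α t x)
      ((volume.restrict (Ioo 0 1)).prod volume) := by
  have : NeZero n := ⟨by lia⟩
  have hn' : (2 : ℝ) ≤ n := mod_cast hn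
  obtain ⟨e, he₂, heα⟩ := exists_between (one_div_lt_one_div_of_lt (by linarith) hα₂)
  have he₁ : e ≤ 1 := heα.le.trans (div_le_self zero_le_one hα₁)
  have hαe : α * e < 1 := by rwa [lt_div_iff₀' (by linarith)] at heα
  have he₀ : 0 ≤ e := by linarith
  obtain ⟨C, hC⟩ := exists_norm_blowUpPotential_mul_blowUpSolution_le_mul n hα₁ he₀ he₁
  have hspace : Integrable fun x : EuclideanSpace ℝ (Fin n) =>
      ‖x‖ ^ (-(2 * (1 - e) + n / 2)) * (1 + ‖x‖ ^ 2) ^ (-coreExponent n) := by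
    refine integrable_norm_rpow_mul_one_add_norm_sq_rpow ?_ (coreExponent_pos n).le ?_ ?_
    · linarith
    · rw [finrank_euclideanSpace_fin]
      linarith
    · rw [finrank_euclideanSpace_fin, coreExponent]
      linarith
  have htime := (integrableOn_log_blowUpScale_rpow_mul (α := α) (by linarith) zero_le_two
    hαe).const_mul C
  refine (htime.mul_prod hspace).mono'
    measurable_blowUpPotential_mul_blowUpSolution.aestronglyMeasurable ?_
  have hx : ∀ᵐ z : ℝ × EuclideanSpace ℝ (Fin n) ∂(volume.restrict (Ioo 0 1)).prod volume,
      z.2 ≠ 0 := Measure.quasiMeasurePreserving_snd.ae (Measure.ae_ne volume 0)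
  have ht : ∀ᵐ z : ℝ × EuclideanSpace ℝ (Fin n) ∂(volume.restrict (Ioo 0 1)).prod volume,
      z.1 ∈ Ioo 0 1 := Measure.quasiMeasurePreserving_fst.ae (ae_restrict_mem measurableSet_Ioo)
  filter_upwards [hx, ht] with z hz₂ hz₁ using hC z.1 (Ioo_subset_Ico_self hz₁) z.2 hz₂

theorem isIntegralSolution_blowUpSolution (hn : 2 ≤ n) (hα₁ : 1 ≤ α) (hα₂ : α < 2) :
    IsIntegralSolution 1 (blowUpPotential n α) (blowUpSolution n α) :=
  isIntegralSolution_of_hasDerivAt_fourierInv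
    (fun _ ht => integrable_blowUpSolution (by lia) (by linarith) ht)
    (integrable_blowUpPotential_mul_blowUpSolution hn hα₁ hα₂)
    (continuousOn_fourierInv_blowUpSolution (by lia) hα₁)
    (fun ξ _ ht => hasDerivAt_fourierInv_blowUpSolution hα₁ ht ξ)

end integral_solution

section decay
variable {E : Type*} [NormedAddCommGroup E] [NormedSpace ℝ E] [FiniteDimensional ℝ E]
  [MeasurableSpace E] [BorelSpace E] {μ : Measure E} [μ.IsAddHaarMeasure] {p : ℝ≥0∞}

theorem memLp_one_add_norm_sq_rpow_neg {b : ℝ} (hp₀ : p ≠ 0) (hp : p ≠ ∞)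
    (hb : finrank ℝ E < 2 * b * p.toReal) :
    MemLp (fun x : E => (1 + ‖x‖ ^ 2) ^ (-b)) p μ := by
  have hmeas : AEStronglyMeasurable (fun x : E => (1 + ‖x‖ ^ 2) ^ (-b)) μ :=
    Measurable.aestronglyMeasurable (by fun_prop)
  rw [← integrable_norm_rpow_iff hmeas hp₀ hp]
  refine (integrable_rpow_neg_one_add_norm_sq hb).congr (ae_of_all _ fun x => ?_)
  beta_reduce
  rw [Real.norm_of_nonneg (by positivity), ← Real.rpow_mul (by positivity)]
  ring_nf

theorem memLp_inv_smoothAbs_norm_sq (hp₀ : p ≠ 0) (hp : p ≠ ∞)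
    (h : finrank ℝ E < 2 * p.toReal) :
    MemLp (fun x : E => (smoothAbs 1 (‖x‖ ^ 2))⁻¹) p μ := by
  have hmeas : AEStronglyMeasurable (fun x : E => (smoothAbs 1 (‖x‖ ^ 2))⁻¹) μ := by
    unfold smoothAbs
    exact Measurable.aestronglyMeasurable (by fun_prop)
  refine (memLp_one_add_norm_sq_rpow_neg (b := 1) hp₀ hp (by simpa)).of_le_mul (c := 2) hmeas
    (ae_of_all _ fun x => ?_)
  have hle : 1 / 2 * (1 + ‖x‖ ^ 2) ≤ smoothAbs 1 (‖x‖ ^ 2) :=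
    half_mul_one_add_le_smoothAbs one_pos (by norm_num) le_rfl _
  rw [norm_inv, Real.norm_of_nonneg (smoothAbs_nonneg _ _), Real.norm_of_nonneg (by positivity),
    Real.rpow_neg_one]
  calc (smoothAbs 1 (‖x‖ ^ 2))⁻¹ ≤ (1 / 2 * (1 + ‖x‖ ^ 2))⁻¹ := by gcongr
    _ = 2 * (1 + ‖x‖ ^ 2)⁻¹ := by rw [mul_inv, one_div, inv_inv]

theorem smoothAbs_pow_four {E : Type*} [NormedAddCommGroup E] [NormedSpace ℝ E] {σ : ℝ}
    (hσ : 0 < σ) (x : E) :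
    smoothAbs (σ ^ 4) (‖x‖ ^ 2) = σ ^ 2 * smoothAbs 1 (‖σ⁻¹ • x‖ ^ 2) := by
  rw [smoothAbs, smoothAbs, ← Real.sqrt_sq (sq_nonneg σ), ← Real.sqrt_mul (by positivity),
    norm_smul, Real.norm_of_nonneg (inv_nonneg.2 hσ.le)]
  congr 1
  field_simp

theorem eLpNorm_inv_smoothAbs_norm_sq {σ : ℝ} (hσ : 0 < σ) (p : ℝ≥0∞) :
    eLpNorm (fun x : E => (smoothAbs (σ ^ 4) (‖x‖ ^ 2))⁻¹) p μ =
      ENNReal.ofReal (σ ^ (finrank ℝ E / p.toReal - 2)) *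
        eLpNorm (fun x : E => (smoothAbs 1 (‖x‖ ^ 2))⁻¹) p μ := by
  have hσ₂ : 0 ≤ (σ ^ 2)⁻¹ := by positivity
  have hsmul : (fun x : E => (smoothAbs (σ ^ 4) (‖x‖ ^ 2))⁻¹) =
      (σ ^ 2)⁻¹ • fun x => (smoothAbs 1 (‖σ⁻¹ • x‖ ^ 2))⁻¹ := by
    funext x
    rw [smoothAbs_pow_four hσ, mul_inv, Pi.smul_apply, smul_eq_mul]
  rw [hsmul, eLpNorm_const_smul,
    eLpNorm_comp_inv_smul hσ (fun x => (smoothAbs 1 (‖x‖ ^ 2))⁻¹), ← mul_assoc,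
    Real.enorm_of_nonneg hσ₂, ← ENNReal.ofReal_mul hσ₂, Real.rpow_sub hσ, Real.rpow_two,
    div_eq_inv_mul (_ ^ _)]

end decay

section mixed_norm
variable {n : ℕ} {F : Type*} [NormedAddCommGroup F] {I : Set ℝ} {p q : ℝ≥0∞}
  {f : ℝ → EuclideanSpace ℝ (Fin n) → F} {g : ℝ → ℝ}

theorem memMixed_of_eLpNorm_le (hI : MeasurableSet I) (hp₀ : p ≠ 0) (hp : p ≠ ∞)
    (hf : AEStronglyMeasurable (Function.uncurry f) ((volume.restrict I).prod volume))
    (hg : IntegrableOn (fun t => g t ^ p.toReal) I) (hg₀ : ∀ t ∈ I, 0 ≤ g t)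
    (h : ∀ t ∈ I, eLpNorm (f t) q volume ≤ ENNReal.ofReal (g t)) : MemMixed I p q f := by
  refine ⟨hf, (eLpNorm_lt_top_iff_lintegral_rpow_enorm_lt_top hp₀ hp).2
    ((setLIntegral_mono' hI fun t ht => ?_).trans_lt hg.lintegral_lt_top)⟩
  rw [enorm_eq_self, ← ENNReal.ofReal_rpow_of_nonneg (hg₀ t ht) ENNReal.toReal_nonneg]
  exact ENNReal.rpow_le_rpow (h t ht) ENNReal.toReal_nonneg

theorem MemMixed.integrableOn_rpow (hf : MemMixed I p q f) (hI : MeasurableSet I) (hp₀ : p ≠ 0)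
    (hp : p ≠ ∞) (hg : Measurable g) (hg₀ : ∀ t ∈ I, 0 ≤ g t)
    (h : ∀ t ∈ I, ENNReal.ofReal (g t) ≤ eLpNorm (f t) q volume) :
    IntegrableOn (fun t => g t ^ p.toReal) I := by
  refine ⟨(hg.pow_const _).aestronglyMeasurable, (hasFiniteIntegral_iff_ofReal
    (ae_restrict_of_forall_mem hI fun t ht => Real.rpow_nonneg (hg₀ t ht) _)).2
    ((setLIntegral_mono' hI fun t ht => ?_).trans_lt
      ((eLpNorm_lt_top_iff_lintegral_rpow_enorm_lt_top hp₀ hp).1 hf.2))⟩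
  rw [enorm_eq_self, ← ENNReal.ofReal_rpow_of_nonneg (hg₀ t ht) ENNReal.toReal_nonneg]
  exact ENNReal.rpow_le_rpow (h t ht) ENNReal.toReal_nonneg

end mixed_norm

/-- The spatial scale `θ(t)^(1/4)` at which the solution concentrates as `t → 1`. -/
noncomputable def blowUpRadius (α t : ℝ) : ℝ := (1 - t) ^ (α / 2)

section potential
variable {n : ℕ} {α r s t : ℝ}

theorem blowUpRadius_pos (ht : t < 1) : 0 < blowUpRadius α t :=
  Real.rpow_pos_of_pos (sub_pos.2 ht) _

theorem blowUpScale_eq_pow_four (ht : t ≤ 1) : blowUpScale α t = blowUpRadius α t ^ 4 := by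
  rw [blowUpScale, blowUpRadius, ← Real.rpow_mul_natCast (sub_nonneg.2 ht)]
  push_cast
  ring_nf

theorem exists_eLpNorm_blowUpPotential_le (hα : 1 ≤ α) (hs : n / 2 < s) :
    ∃ C, 0 ≤ C ∧ ∀ t ∈ Ico 0 1, eLpNorm (blowUpPotential n α t) (ENNReal.ofReal s) volume ≤
      ENNReal.ofReal (C * ((1 - Real.log (blowUpScale α t)) ^ 2 *
        (1 - t) ^ (-(α * (1 - n / (2 * s)))))) := by
  have hs₀ : 0 < s := (by positivity : (0 : ℝ) ≤ n / 2).trans_lt hs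
  obtain ⟨C, hC₀, hC⟩ := exists_abs_blowUpPotential_le n hα
  set K := eLpNorm (fun x : EuclideanSpace ℝ (Fin n) => (smoothAbs 1 (‖x‖ ^ 2))⁻¹)
    (ENNReal.ofReal s) volume
  have hK : K ≠ ∞ := (memLp_inv_smoothAbs_norm_sq (by simpa) ENNReal.ofReal_ne_top (by
    rw [finrank_euclideanSpace_fin, ENNReal.toReal_ofReal hs₀.le]
    linarith)).eLpNorm_ne_top
  refine ⟨C * K.toReal, by positivity, fun t ht => ?_⟩
  have ht₁ := sub_pos.2 ht.2
  have hσ := blowUpRadius_pos (α := α) ht.2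
  have hM : 0 ≤ C * (1 - Real.log (blowUpScale α t)) ^ 2 := by positivity
  calc eLpNorm (blowUpPotential n α t) (ENNReal.ofReal s) volume
      ≤ ENNReal.ofReal (C * (1 - Real.log (blowUpScale α t)) ^ 2) *
          eLpNorm (fun x : EuclideanSpace ℝ (Fin n) =>
            (smoothAbs (blowUpScale α t) (‖x‖ ^ 2))⁻¹) (ENNReal.ofReal s) volume := by
        refine eLpNorm_le_mul_eLpNorm_of_ae_le_mul (ae_of_all _ fun x => ?_) _
        rw [norm_inv, Real.norm_of_nonneg (smoothAbs_nonneg _ _), ← div_eq_mul_inv]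
        exact hC t ht x
    _ = ENNReal.ofReal (C * (1 - Real.log (blowUpScale α t)) ^ 2) *
          (ENNReal.ofReal (blowUpRadius α t ^ (n / s - 2)) * ENNReal.ofReal K.toReal) := by
        rw [blowUpScale_eq_pow_four ht.2.le, eLpNorm_inv_smoothAbs_norm_sq hσ,
          finrank_euclideanSpace_fin, ENNReal.toReal_ofReal hs₀.le, ENNReal.ofReal_toReal hK]
    _ = _ := by
        rw [← ENNReal.ofReal_mul (by positivity), ← ENNReal.ofReal_mul hM, blowUpRadius,
          ← Real.rpow_mul ht₁.le,
          show α / 2 * (n / s - 2) = -(α * (1 - n / (2 * s))) by field_simp; ring]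
        ring_nf

theorem memMixed_blowUpPotential (hα : 1 ≤ α) (hr : 0 < r) (hs : n / 2 < s)
    (hrs : α * (1 - n / (2 * s)) * r < 1) :
    MemMixed (Ioo 0 1) (ENNReal.ofReal r) (ENNReal.ofReal s) (blowUpPotential n α) := by
  obtain ⟨C, hC₀, hC⟩ := exists_eLpNorm_blowUpPotential_le hα hs
  have hα₀ : 0 ≤ α := by linarith
  refine memMixed_of_eLpNorm_le measurableSet_Ioo (by simpa) ENNReal.ofReal_ne_top
    measurable_blowUpPotential.aestronglyMeasurable ?_ (fun t ht => ?_)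
    fun t ht => hC t (Ioo_subset_Ico_self ht)
  · refine IntegrableOn.congr_fun ((integrableOn_log_blowUpScale_rpow_mul hα₀
      (by positivity : 0 ≤ 2 * r) hrs).const_mul (C ^ r)) (fun t ht => ?_) measurableSet_Ioo
    have ht₁ := sub_pos.2 ht.2
    have hL := zero_le_one.trans (one_le_one_sub_log_blowUpScale hα₀ (Ioo_subset_Icc_self ht))
    rw [ENNReal.toReal_ofReal hr.le, Real.mul_rpow hC₀ (by positivity),
      Real.mul_rpow (by positivity) (by positivity), ← Real.rpow_two, ← Real.rpow_mul hL,
      ← Real.rpow_mul ht₁.le, neg_mul]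
  · have ht₁ := sub_pos.2 ht.2
    positivity

end potential

section lp_convergence

theorem tendsto_eLpNorm_sub_of_dominated {ι X F : Type*} [MeasurableSpace X] {μ : Measure X}
    [NormedAddCommGroup F] {l : Filter ι} [l.IsCountablyGenerated] {p : ℝ≥0∞} (hp₀ : p ≠ 0)
    (hp : p ≠ ∞) {f : ι → X → F} {g : X → F} {bound : X → ℝ}
    (hf : ∀ i, AEStronglyMeasurable (f i) μ) (hg : MemLp g p μ) (hbound : MemLp bound p μ)
    (h_le : ∀ᶠ i in l, ∀ᵐ x ∂μ, ‖f i x‖ ≤ bound x)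
    (h_lim : ∀ᵐ x ∂μ, Tendsto (fun i => f i x) l (𝓝 (g x))) :
    Tendsto (fun i => eLpNorm (f i - g) p μ) l (𝓝 0) := by
  have hp₁ : 0 < p.toReal := ENNReal.toReal_pos hp₀ hp
  have hmaj : MemLp (fun x => bound x + ‖g x‖) p μ := hbound.add hg.norm
  have hint : Tendsto (fun i => ∫⁻ x, ‖(f i - g) x‖ₑ ^ p.toReal ∂μ) l (𝓝 0) := by
    rw [← lintegral_zero (μ := μ)]
    refine tendsto_lintegral_filter_of_dominated_convergence' _
      (.of_forall fun i => ((hf i).sub hg.1).enorm.pow_const _) ?_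
      (lintegral_rpow_enorm_lt_top_of_eLpNorm_lt_top hp₀ hp hmaj.2).ne ?_
    · filter_upwards [h_le] with i hi
      filter_upwards [hi] with x hx
      refine ENNReal.rpow_le_rpow (enorm_le_iff_norm_le.2 ?_) hp₁.le
      calc ‖f i x - g x‖ ≤ ‖f i x‖ + ‖g x‖ := norm_sub_le _ _
        _ ≤ bound x + ‖g x‖ := by gcongr
        _ ≤ ‖bound x + ‖g x‖‖ := le_abs_self _
    · filter_upwards [h_lim] with x hx
      have h := ((ENNReal.continuous_rpow_const (y := p.toReal)).tendsto 0).comp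
        (tendsto_iff_enorm_sub_tendsto_zero.1 hx)
      rwa [ENNReal.zero_rpow_of_pos hp₁] at h
  have h := ((ENNReal.continuous_rpow_const (y := 1 / p.toReal)).tendsto 0).comp hint
  rw [ENNReal.zero_rpow_of_pos (by positivity)] at h
  exact h.congr fun i => (eLpNorm_eq_lintegral_rpow_enorm_toReal hp₀ hp).symm

theorem memContL2_of_tendsto_eLpNorm {n : ℕ} {I : Set ℝ} {u : ℝ → EuclideanSpace ℝ (Fin n) → ℂ}
    (hu : AEStronglyMeasurable (Function.uncurry u) ((volume.restrict I).prod volume))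
    (hmem : ∀ t ∈ I, MemLp (u t) 2 volume)
    (hlim : ∀ t₀ ∈ I, Tendsto (fun t => eLpNorm (u t - u t₀) 2 volume) (𝓝[I] t₀) (𝓝 0)) :
    MemContL2 I u := by
  classical
  refine ⟨hu, fun t => if ht : t ∈ I then (hmem t ht).toLp _ else 0, fun t₀ ht₀ => ?_,
    fun t ht => ?_⟩
  · rw [ContinuousWithinAt, Lp.tendsto_Lp_iff_tendsto_eLpNorm']
    refine (hlim t₀ ht₀).congr' (eventually_nhdsWithin_of_forall fun t ht => ?_)
    beta_reduce
    rw [dif_pos ht, dif_pos ht₀]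
    exact eLpNorm_congr_ae ((hmem t ht).coeFn_toLp.sub (hmem t₀ ht₀).coeFn_toLp).symm
  · beta_reduce
    rw [dif_pos ht]
    exact (hmem t ht).coeFn_toLp

end lp_convergence

section lp_majorants
variable {E : Type*} [NormedAddCommGroup E] [NormedSpace ℝ E] [FiniteDimensional ℝ E]
  [MeasurableSpace E] [BorelSpace E] {μ : Measure E} [μ.IsAddHaarMeasure]

theorem memLp_two_norm_rpow_mul_inv_one_add_abs_log [Nontrivial E] :
    MemLp (fun x : E => ‖x‖ ^ (-(finrank ℝ E / 2 : ℝ)) * (1 + |Real.log ‖x‖|)⁻¹) 2 μ := by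
  refine (memLp_two_iff_integrable_sq (Measurable.aestronglyMeasurable (by fun_prop))).2
    (integrable_norm_rpow_mul_inv_one_add_abs_log_sq.congr (ae_of_all _ fun x => ?_))
  beta_reduce
  rw [mul_pow, inv_pow, ← Real.rpow_mul_natCast (norm_nonneg x)]
  push_cast
  ring_nf

theorem memLp_two_indicator_ball_norm_rpow (hE : 2 ≤ finrank ℝ E) :
    MemLp ((Metric.ball (0 : E) 1).indicator fun x => ‖x‖ ^ (-(1 / 2) : ℝ)) 2 μ := by
  rw [memLp_indicator_iff_restrict measurableSet_ball, memLp_two_iff_integrable_sq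
    (measurable_norm.pow_const _).aestronglyMeasurable]
  refine integrableOn_ball_of_norm_le_rpow (E := E) (C := 1) (α := 1) (by lia)
    (by exact_mod_cast hE) (ae_of_all _ fun x => ?_)
    ((measurable_norm.pow_const _).pow_const 2).aestronglyMeasurable
  rw [← Real.rpow_mul_natCast (norm_nonneg x), Real.norm_of_nonneg (by positivity)]
  norm_num

end lp_majorants

section l2_continuity
variable {n : ℕ} {α t t₀ : ℝ}

theorem memLp_one_add_norm_sq_rpow_neg_half_succ {p : ℝ≥0∞} (hp₁ : 1 ≤ p) (hp : p ≠ ∞) :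
    MemLp (fun x : EuclideanSpace ℝ (Fin n) => (1 + ‖x‖ ^ 2) ^ (-((n + 1) / 2 : ℝ))) p volume := by
  refine memLp_one_add_norm_sq_rpow_neg (zero_lt_one.trans_le hp₁).ne' hp ?_
  have : 1 ≤ p.toReal := by rwa [← ENNReal.toReal_one, ENNReal.toReal_le_toReal (by simp) hp]
  rw [finrank_euclideanSpace_fin]
  nlinarith

theorem sqrt_blowUpScale_eq_sq (ht : t ≤ 1) : √(blowUpScale α t) = blowUpRadius α t ^ 2 := by
  rw [blowUpScale_eq_pow_four ht, show blowUpRadius α t ^ 4 = (blowUpRadius α t ^ 2) ^ 2 by ring,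
    Real.sqrt_sq (sq_nonneg _)]

theorem norm_blowUpSolution_le_of_blowUpRadius_le (hn : 2 ≤ n) (hα : 0 ≤ α) (ht : t ∈ Icc 0 1)
    {x : EuclideanSpace ℝ (Fin n)} (hx : x ≠ 0) (h : blowUpRadius α t ≤ ‖x‖) :
    ‖blowUpSolution n α t x‖ ≤
      2 * 4 ^ coreExponent n * (‖x‖ ^ (-(n / 2 : ℝ)) * (1 + |Real.log ‖x‖|)⁻¹) := by
  have hσ : 0 ≤ blowUpRadius α t := Real.rpow_nonneg (sub_nonneg.2 ht.2) _
  have hle : blowUpScale α t ≤ (‖x‖ ^ 2) ^ 2 := by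
    rw [blowUpScale_eq_pow_four ht.2, ← pow_mul]
    gcongr
  have hlog : |Real.log ‖x‖| ≤ |Real.log (‖x‖ ^ 2)| := by
    rw [Real.log_pow, abs_mul]
    push_cast
    rw [abs_two]
    linarith [abs_nonneg (Real.log ‖x‖)]
  refine (norm_profile_le_of_le_sq hn (blowUpScale_nonneg ht.2) (blowUpScale_le_one hα ht)
    (by positivity) hle).trans ?_
  rw [← Real.rpow_natCast_mul (norm_nonneg x)]
  push_cast
  rw [show (2 : ℝ) * -(n / 4) = -(n / 2) by ring]
  gcongr

theorem norm_blowUpSolution_le_of_norm_le_blowUpRadius (hα : 0 ≤ α) (ht : t ∈ Ico 0 1)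
    {x : EuclideanSpace ℝ (Fin n)} (hx : x ≠ 0) (h : ‖x‖ ≤ blowUpRadius α t) :
    ‖blowUpSolution n α t x‖ ≤ √6 * (1 - Real.log (blowUpScale α t)) ^ (-(1 / 4) : ℝ) *
      blowUpRadius α t ^ (-(n / 2 : ℝ)) * ‖(blowUpRadius α t)⁻¹ • x‖ ^ (-(1 / 2) : ℝ) := by
  have hσ := blowUpRadius_pos (α := α) ht.2
  have hL := zero_lt_one.trans_le (one_le_one_sub_log_blowUpScale hα (Ico_subset_Icc_self ht))
  have hle : (‖x‖ ^ 2) ^ 2 ≤ blowUpScale α t := by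
    rw [blowUpScale_eq_pow_four ht.2.le, ← pow_mul]
    gcongr
  have hsq := norm_profile_sq_le_of_sq_le (n := n) (θ₁ := blowUpScaleT α t)
    (blowUpScale_pos ht.2) (blowUpScale_le_one hα (Ico_subset_Icc_self ht)) (by positivity) hle
  refine (pow_le_pow_iff_left₀ (norm_nonneg _) (by positivity) two_ne_zero).1 (hsq.trans_eq ?_)
  rw [mul_pow, mul_pow, mul_pow, Real.sq_sqrt (by norm_num), ← Real.rpow_mul_natCast hL.le,
    ← Real.rpow_mul_natCast hσ.le, ← Real.rpow_mul_natCast (norm_nonneg _),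
    sqrt_blowUpScale_eq_sq ht.2.le, ← div_pow, Real.sqrt_sq (by positivity),
    ← Real.rpow_natCast_mul hσ.le, norm_smul, Real.norm_of_nonneg (inv_nonneg.2 hσ.le),
    Real.sqrt_eq_rpow, ← Real.rpow_neg hL.le,
    show (-(1 / 2) : ℝ) * (2 : ℕ) = -1 by norm_num, Real.rpow_neg_one, mul_inv, inv_inv,
    ← div_eq_mul_inv]
  push_cast
  ring_nf

theorem memLp_blowUpSolution (hn : 2 ≤ n) (hα : 0 < α) (ht : t ∈ Icc 0 1) :
    MemLp (blowUpSolution n α t) 2 volume := by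
  have hmeas := (measurable_blowUpSolution (n := n) (α := α)).of_uncurry_left (x := t)
  obtain ht₁ | rfl := ht.2.lt_or_eq
  · obtain ⟨C, -, hC⟩ := exists_norm_blowUpSolution_le n hα.le ht₁
    exact (memLp_one_add_norm_sq_rpow_neg_half_succ one_le_two ENNReal.ofNat_ne_top).of_le_mul
      hmeas.aestronglyMeasurable (ae_of_all _ fun x => by
        rw [Real.norm_of_nonneg (by positivity)]
        exact hC t ⟨ht.1, le_rfl⟩ x)
  · have : NeZero n := ⟨by lia⟩
    refine (memLp_two_norm_rpow_mul_inv_one_add_abs_log (E := EuclideanSpace ℝ (Fin n))).of_le_mul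
      (c := 2 * 4 ^ coreExponent n) hmeas.aestronglyMeasurable ?_
    filter_upwards [Measure.ae_ne volume 0] with x hx
    rw [Real.norm_of_nonneg (by positivity), finrank_euclideanSpace_fin]
    refine norm_blowUpSolution_le_of_blowUpRadius_le hn hα.le ht hx ?_
    rw [blowUpRadius, sub_self, Real.zero_rpow (by positivity)]
    exact norm_nonneg x

theorem tendsto_eLpNorm_blowUpSolution_sub_of_lt (hn : 2 ≤ n) (hα : 1 ≤ α) (ht₀ : t₀ ∈ Ico 0 1) :
    Tendsto (fun t => eLpNorm (blowUpSolution n α t - blowUpSolution n α t₀) 2 volume)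
      (𝓝[Icc 0 1] t₀) (𝓝 0) := by
  have : NeZero n := ⟨by lia⟩
  obtain ⟨T, htT, hT⟩ := exists_between ht₀.2
  obtain ⟨C, -, hC⟩ := exists_norm_blowUpSolution_le n (zero_le_one.trans hα) hT
  refine tendsto_eLpNorm_sub_of_dominated two_ne_zero ENNReal.ofNat_ne_top
    (fun t => measurable_blowUpSolution.of_uncurry_left.aestronglyMeasurable)
    (memLp_blowUpSolution hn (by linarith) (Ico_subset_Icc_self ht₀))
    ((memLp_one_add_norm_sq_rpow_neg_half_succ one_le_two ENNReal.ofNat_ne_top).const_mul C) ?_ ?_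
  · filter_upwards [self_mem_nhdsWithin, mem_nhdsWithin_of_mem_nhds (Iio_mem_nhds htT)]
      with t ht htT using ae_of_all _ (hC t ⟨ht.1, le_of_lt htT⟩)
  · filter_upwards [Measure.ae_ne volume 0] with x hx
      using continuousOn_blowUpSolution hα hx t₀ (Ico_subset_Icc_self ht₀)

theorem tendsto_blowUpRadius (hα : 0 < α) : Tendsto (blowUpRadius α) (𝓝[Ico 0 1] 1) (𝓝 0) := by
  have hc : Continuous (blowUpRadius α) :=
    (continuous_const.sub continuous_id).rpow_const fun _ => .inr (by positivity)
  have h := hc.tendsto 1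
  rw [blowUpRadius, sub_self, Real.zero_rpow (by positivity)] at h
  exact h.mono_left nhdsWithin_le_nhds

theorem tendsto_one_sub_log_blowUpScale (hα : 0 < α) :
    Tendsto (fun t => 1 - Real.log (blowUpScale α t)) (𝓝[Ico 0 1] 1) atTop := by
  have hθ : Tendsto (blowUpScale α) (𝓝[Ico 0 1] 1) (𝓝[>] 0) := by
    have h := (continuous_blowUpScale hα.le).tendsto 1
    rw [blowUpScale, sub_self, Real.zero_rpow (by positivity)] at h
    exact tendsto_nhdsWithin_iff.2 ⟨h.mono_left nhdsWithin_le_nhds,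
      eventually_nhdsWithin_of_forall fun t ht => blowUpScale_pos ht.2⟩
  exact tendsto_atTop_add_const_left _ 1
    (tendsto_neg_atBot_atTop.comp (Real.tendsto_log_nhdsGT_zero.comp hθ))

theorem tendsto_eLpNorm_indicator_compl_ball_blowUpSolution_sub (hn : 2 ≤ n) (hα : 1 ≤ α) :
    Tendsto (fun t => eLpNorm ((Metric.ball 0 (blowUpRadius α t))ᶜ.indicator
      (blowUpSolution n α t) - blowUpSolution n α 1) 2 volume) (𝓝[Ico 0 1] 1) (𝓝 0) := by
  have : NeZero n := ⟨by lia⟩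
  have hα₀ : 0 < α := by linarith
  have hbound : MemLp (fun x : EuclideanSpace ℝ (Fin n) => 2 * 4 ^ coreExponent n *
      (‖x‖ ^ (-(n / 2 : ℝ)) * (1 + |Real.log ‖x‖|)⁻¹)) 2 volume := by
    have h := memLp_two_norm_rpow_mul_inv_one_add_abs_log (E := EuclideanSpace ℝ (Fin n))
      (μ := volume)
    rw [finrank_euclideanSpace_fin] at h
    exact h.const_mul _
  refine tendsto_eLpNorm_sub_of_dominated two_ne_zero ENNReal.ofNat_ne_top
    (fun t => (measurable_blowUpSolution.of_uncurry_left.indicator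
      measurableSet_ball.compl).aestronglyMeasurable)
    (memLp_blowUpSolution hn hα₀ (right_mem_Icc.2 zero_le_one)) hbound ?_ ?_
  · filter_upwards [self_mem_nhdsWithin] with t ht
    filter_upwards [Measure.ae_ne volume 0] with x hx
    by_cases h : x ∈ Metric.ball 0 (blowUpRadius α t)
    · rw [indicator_of_notMem (by simpa using h), norm_zero]
      positivity
    · rw [indicator_of_mem h]
      exact norm_blowUpSolution_le_of_blowUpRadius_le hn hα₀.le (Ico_subset_Icc_self ht) hx
        (by simpa using h)
  · filter_upwards [Measure.ae_ne volume 0] with x hx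
    refine ((continuousOn_blowUpSolution hα hx 1 (right_mem_Icc.2 zero_le_one)).mono_left
      (nhdsWithin_mono _ Ico_subset_Icc_self)).congr' ?_
    filter_upwards [(tendsto_blowUpRadius hα₀).eventually_lt_const (norm_pos_iff.2 hx)] with t ht
    rw [indicator_of_mem (by simpa using ht.le)]

theorem eLpNorm_indicator_ball_blowUpSolution_le (hn : 2 ≤ n) (hα : 0 ≤ α) (ht : t ∈ Ico 0 1) :
    eLpNorm ((Metric.ball 0 (blowUpRadius α t)).indicator (blowUpSolution n α t)) 2 volume ≤
      ENNReal.ofReal (√6 * (1 - Real.log (blowUpScale α t)) ^ (-(1 / 4) : ℝ)) *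
        eLpNorm ((Metric.ball (0 : EuclideanSpace ℝ (Fin n)) 1).indicator
          fun x => ‖x‖ ^ (-(1 / 2) : ℝ)) 2 volume := by
  have : NeZero n := ⟨by lia⟩
  have hσ := blowUpRadius_pos (α := α) ht.2
  have hL := zero_lt_one.trans_le (one_le_one_sub_log_blowUpScale hα (Ico_subset_Icc_self ht))
  set σ := blowUpRadius α t
  set M := √6 * (1 - Real.log (blowUpScale α t)) ^ (-(1 / 4) : ℝ)
  set g := (Metric.ball (0 : EuclideanSpace ℝ (Fin n)) 1).indicator
    fun x => ‖x‖ ^ (-(1 / 2) : ℝ)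
  have hle : ∀ᵐ x, ‖(Metric.ball 0 σ).indicator (blowUpSolution n α t) x‖ ≤
      M * σ ^ (-(n / 2 : ℝ)) * ‖g (σ⁻¹ • x)‖ := by
    filter_upwards [Measure.ae_ne volume 0] with x hx
    by_cases h : x ∈ Metric.ball 0 σ
    · have hmem : σ⁻¹ • x ∈ Metric.ball (0 : EuclideanSpace ℝ (Fin n)) 1 := by
        rw [mem_ball_zero_iff] at h
        rwa [mem_ball_zero_iff, norm_smul, Real.norm_of_nonneg (inv_nonneg.2 hσ.le),
          inv_mul_lt_one₀ hσ]
      have hg : g (σ⁻¹ • x) = ‖σ⁻¹ • x‖ ^ (-(1 / 2) : ℝ) := indicator_of_mem hmem _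
      rw [indicator_of_mem h, hg, Real.norm_of_nonneg (by positivity)]
      exact norm_blowUpSolution_le_of_norm_le_blowUpRadius hα ht hx (mem_ball_zero_iff.1 h).le
    · rw [indicator_of_notMem h, norm_zero]
      positivity
  calc eLpNorm ((Metric.ball 0 σ).indicator (blowUpSolution n α t)) 2 volume
      ≤ ENNReal.ofReal (M * σ ^ (-(n / 2 : ℝ))) * eLpNorm (fun x => g (σ⁻¹ • x)) 2 volume :=
        eLpNorm_le_mul_eLpNorm_of_ae_le_mul hle 2
    _ = ENNReal.ofReal M * eLpNorm g 2 volume := by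
        rw [eLpNorm_comp_inv_smul hσ g, ← mul_assoc, ← ENNReal.ofReal_mul (by positivity),
          finrank_euclideanSpace_fin, ENNReal.toReal_ofNat, mul_assoc M, ← Real.rpow_add hσ,
          neg_add_cancel, Real.rpow_zero, mul_one]

theorem tendsto_eLpNorm_indicator_ball_blowUpSolution (hn : 2 ≤ n) (hα : 0 < α) :
    Tendsto (fun t => eLpNorm ((Metric.ball 0 (blowUpRadius α t)).indicator
      (blowUpSolution n α t)) 2 volume) (𝓝[Ico 0 1] 1) (𝓝 0) := by
  have hM := ((tendsto_rpow_neg_atTop (by norm_num : (0 : ℝ) < 1 / 4)).comp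
    (tendsto_one_sub_log_blowUpScale hα)).const_mul √6
  have h := ENNReal.Tendsto.mul_const (ENNReal.tendsto_ofReal hM)
    (.inr (memLp_two_indicator_ball_norm_rpow (E := EuclideanSpace ℝ (Fin n)) (μ := volume)
      (by rwa [finrank_euclideanSpace_fin])).eLpNorm_ne_top)
  rw [mul_zero, ENNReal.ofReal_zero, zero_mul] at h
  exact tendsto_of_tendsto_of_tendsto_of_le_of_le' tendsto_const_nhds h
    (.of_forall fun _ => zero_le)
    (eventually_nhdsWithin_of_forall fun t ht =>
      eLpNorm_indicator_ball_blowUpSolution_le hn hα.le ht)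

theorem tendsto_eLpNorm_blowUpSolution_sub_one (hn : 2 ≤ n) (hα : 1 ≤ α) :
    Tendsto (fun t => eLpNorm (blowUpSolution n α t - blowUpSolution n α 1) 2 volume)
      (𝓝[Ico 0 1] 1) (𝓝 0) := by
  have hmeas (t : ℝ) : Measurable (blowUpSolution n α t) :=
    measurable_blowUpSolution.of_uncurry_left
  have h := (tendsto_eLpNorm_indicator_ball_blowUpSolution hn (by linarith)).add
    (tendsto_eLpNorm_indicator_compl_ball_blowUpSolution_sub hn hα)
  rw [add_zero] at h
  refine tendsto_of_tendsto_of_tendsto_of_le_of_le tendsto_const_nhds h (fun _ => zero_le)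
    fun t => ?_
  beta_reduce
  nth_rewrite 1 [← indicator_self_add_compl (Metric.ball 0 (blowUpRadius α t))
    (blowUpSolution n α t)]
  rw [add_sub_assoc]
  exact eLpNorm_add_le ((hmeas t).indicator measurableSet_ball).aestronglyMeasurable
    (((hmeas t).indicator measurableSet_ball.compl).sub (hmeas 1)).aestronglyMeasurable one_le_two

theorem memContL2_blowUpSolution (hn : 2 ≤ n) (hα : 1 ≤ α) :
    MemContL2 (Icc 0 1) (blowUpSolution n α) := by
  refine memContL2_of_tendsto_eLpNorm measurable_blowUpSolution.aestronglyMeasurable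
    (fun t ht => memLp_blowUpSolution hn (by linarith) ht) fun t₀ ht₀ => ?_
  obtain h | rfl := ht₀.2.lt_or_eq
  · exact tendsto_eLpNorm_blowUpSolution_sub_of_lt hn hα ⟨ht₀.1, h⟩
  · rw [← Ico_insert_right zero_le_one, nhdsWithin_insert]
    refine Tendsto.sup (tendsto_pure_left.2 fun s hs => ?_)
      (tendsto_eLpNorm_blowUpSolution_sub_one hn hα)
    rw [sub_self, eLpNorm_zero]
    exact mem_of_mem_nhds hs

end l2_continuity

section strichartz_norms
variable {n : ℕ} {α T : ℝ} {p q : ℝ≥0∞}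

theorem SchrodingerAdmissible.ne_top (h : SchrodingerAdmissible n p q) (hn : 2 ≤ n) : q ≠ ∞ := by
  rintro rfl
  obtain ⟨heq, hp, -, hexcl⟩ := h
  rw [ENNReal.inv_top, mul_zero, add_zero] at heq
  have hle : (n : ℝ≥0∞) / 4 ≤ 2⁻¹ := heq ▸ ENNReal.inv_le_inv.2 hp
  have hn₂ : n = 2 := by
    refine le_antisymm ?_ hn
    have h := ENNReal.toReal_mono (by simp) hle
    rw [ENNReal.toReal_div, ENNReal.toReal_inv] at h
    have h' : (n : ℝ) ≤ 2 := by
      norm_num at h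
      linarith
    exact_mod_cast h'
  refine hexcl ⟨hn₂, ?_, rfl⟩
  rw [← inv_inj, heq, hn₂]
  refine (ENNReal.toReal_eq_toReal_iff' (ENNReal.div_ne_top (by simp) (by simp)) (by simp)).1 ?_
  norm_num

theorem SchrodingerAdmissible.inv_toReal (h : SchrodingerAdmissible n p q) :
    p.toReal⁻¹ = n / 4 - n / 2 / q.toReal := by
  have heq := congrArg ENNReal.toReal h.1
  have hp : p⁻¹ ≠ ∞ := ENNReal.inv_ne_top.2 (zero_lt_two.trans_le h.2.1).ne'
  have hq : q⁻¹ ≠ ∞ := ENNReal.inv_ne_top.2 (zero_lt_two.trans_le h.2.2.1).ne'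
  rw [ENNReal.toReal_add hp (ENNReal.mul_ne_top (ENNReal.div_ne_top (by simp) (by simp)) hq),
    ENNReal.toReal_mul, ENNReal.toReal_div, ENNReal.toReal_div, ENNReal.toReal_inv,
    ENNReal.toReal_inv, ENNReal.toReal_natCast, ENNReal.toReal_ofNat, ENNReal.toReal_ofNat] at heq
  rw [div_eq_mul_inv (n / 2 : ℝ) q.toReal]
  linarith

theorem memMixed_blowUpSolution (hα : 0 ≤ α) (hT : T < 1) (hp₀ : p ≠ 0) (hp : p ≠ ∞)
    (hq₁ : 1 ≤ q) (hq : q ≠ ∞) : MemMixed (Ioo 0 T) p q (blowUpSolution n α) := by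
  obtain ⟨C, hC₀, hC⟩ := exists_norm_blowUpSolution_le n hα hT
  have hmem := memLp_one_add_norm_sq_rpow_neg_half_succ (n := n) hq₁ hq
  set K := eLpNorm (fun x : EuclideanSpace ℝ (Fin n) => (1 + ‖x‖ ^ 2) ^ (-((n + 1) / 2 : ℝ)))
    q volume
  refine memMixed_of_eLpNorm_le (g := fun _ => C * K.toReal) measurableSet_Ioo hp₀ hp
    measurable_blowUpSolution.aestronglyMeasurable
    (integrableOn_const measure_Ioo_lt_top.ne) (fun _ _ => by positivity) fun t ht => ?_
  rw [ENNReal.ofReal_mul hC₀, ENNReal.ofReal_toReal hmem.eLpNorm_ne_top]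
  refine eLpNorm_le_mul_eLpNorm_of_ae_le_mul (ae_of_all _ fun x => ?_) q
  rw [Real.norm_of_nonneg (by positivity)]
  exact hC t (Ioo_subset_Icc_self ht) x

theorem ofReal_mul_rpow_mul_le_eLpNorm {E F : Type*} [NormedAddCommGroup E] [NormedSpace ℝ E]
    [FiniteDimensional ℝ E] [MeasurableSpace E] [BorelSpace E] {μ : Measure E}
    [μ.IsAddHaarMeasure] [NormedAddCommGroup F] {f : E → F} {c ρ : ℝ} (hq₀ : q ≠ 0) (hq : q ≠ ∞)
    (hρ : 0 < ρ) (hf : ∀ x ∈ Metric.ball 0 ρ, c ≤ ‖f x‖) :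
    ENNReal.ofReal c * ENNReal.ofReal (ρ ^ (finrank ℝ E / q.toReal)) *
      μ (Metric.ball 0 1) ^ (1 / q.toReal) ≤ eLpNorm f q μ := by
  have hpos : 0 < ρ ^ finrank ℝ E := pow_pos hρ _
  calc _ = ENNReal.ofReal c * μ (Metric.ball 0 ρ) ^ (1 / q.toReal) := by
        rw [Measure.addHaar_ball_of_pos μ 0 hρ, ENNReal.mul_rpow_of_nonneg _ _ (by positivity),
          ENNReal.ofReal_rpow_of_pos hpos, ← Real.rpow_natCast_mul hρ.le, mul_one_div, mul_assoc]
    _ ≤ eLpNorm ((Metric.ball 0 ρ).indicator fun _ => max c 0) q μ := by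
        rw [eLpNorm_indicator_const measurableSet_ball hq₀ hq,
          Real.enorm_of_nonneg (le_max_right _ _), ENNReal.ofReal_max, ENNReal.ofReal_zero,
          max_eq_left zero_le]
    _ ≤ eLpNorm f q μ := by
        refine eLpNorm_mono fun x => ?_
        by_cases hx : x ∈ Metric.ball 0 ρ
        · rw [indicator_of_mem hx, Real.norm_of_nonneg (le_max_right _ _)]
          exact max_le (hf x hx) (norm_nonneg _)
        · rw [indicator_of_notMem hx, norm_zero]
          exact norm_nonneg _

theorem le_norm_blowUpSolution_of_norm_le_blowUpRadius {t : ℝ} (hα : 0 ≤ α) (ht : t ∈ Ico 0 1)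
    {x : EuclideanSpace ℝ (Fin n)} (h : ‖x‖ ≤ blowUpRadius α t) :
    5 ^ (-coreExponent n) * (blowUpRadius α t ^ (-(n / 2 : ℝ)) *
      (1 - Real.log (blowUpScale α t)) ^ (-coreExponent n)) ≤ ‖blowUpSolution n α t x‖ := by
  have hle : (‖x‖ ^ 2) ^ 2 ≤ blowUpScale α t := by
    rw [blowUpScale_eq_pow_four ht.2.le, ← pow_mul]
    gcongr
  have hprofile := le_norm_profile_of_sq_le (n := n) (θ₁ := blowUpScaleT α t)
    (blowUpScale_pos ht.2) (blowUpScale_le_one hα (Ico_subset_Icc_self ht)) (sq_nonneg ‖x‖) hle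
  rw [sqrt_blowUpScale_eq_sq ht.2.le, ← Real.rpow_natCast_mul (blowUpRadius_pos ht.2).le,
    show ((2 : ℕ) : ℝ) * -(n / 4) = -(n / 2 : ℝ) by push_cast; ring] at hprofile
  exact hprofile

theorem exists_mul_rpow_le_one_sub_log_blowUpScale_rpow_neg {ε κ : ℝ} (hα : 0 ≤ α) (hε : 0 < ε)
    (hκ : 0 < κ) :
    ∃ c, 0 < c ∧ ∀ t ∈ Ico 0 1, c * (1 - t) ^ ε ≤ (1 - Real.log (blowUpScale α t)) ^ (-κ) := by
  obtain ⟨C, hC₀, hC⟩ := exists_one_sub_log_blowUpScale_le hα (div_pos hε hκ)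
  refine ⟨C ^ (-κ), by positivity, fun t ht => ?_⟩
  have ht₁ := sub_pos.2 ht.2
  have hL := zero_lt_one.trans_le (one_le_one_sub_log_blowUpScale hα (Ico_subset_Icc_self ht))
  have h := Real.rpow_le_rpow_of_nonpos hL (hC t ht) (neg_nonpos.2 hκ.le)
  rwa [Real.mul_rpow hC₀.le (by positivity), ← Real.rpow_mul ht₁.le, neg_mul_neg,
    div_mul_cancel₀ _ hκ.ne'] at h

theorem exists_mul_rpow_le_eLpNorm_blowUpSolution {γ : ℝ} (hα : 0 ≤ α) (hq₀ : q ≠ 0) (hq : q ≠ ∞)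
    (hγ : γ < α * (n / 4 - n / 2 / q.toReal)) :
    ∃ c, 0 < c ∧ ∀ t ∈ Ico 0 1,
      ENNReal.ofReal (c * (1 - t) ^ (-γ)) ≤ eLpNorm (blowUpSolution n α t) q volume := by
  obtain ⟨c, hc₀, hc⟩ := exists_mul_rpow_le_one_sub_log_blowUpScale_rpow_neg hα (sub_pos.2 hγ)
    (coreExponent_pos n)
  obtain ⟨m, hm₀, hm⟩ : ∃ m : ℝ, 0 < m ∧
      volume (Metric.ball (0 : EuclideanSpace ℝ (Fin n)) 1) ^ (1 / q.toReal) = .ofReal m := by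
    have hpos := ENNReal.rpow_pos (p := 1 / q.toReal) (Metric.measure_ball_pos volume
      (0 : EuclideanSpace ℝ (Fin n)) one_pos) measure_ball_lt_top.ne
    have hfin : volume (Metric.ball (0 : EuclideanSpace ℝ (Fin n)) 1) ^ (1 / q.toReal) ≠ ∞ :=
      ENNReal.rpow_ne_top_of_nonneg (by positivity) measure_ball_lt_top.ne
    exact ⟨_, ENNReal.toReal_pos hpos.ne' hfin, (ENNReal.ofReal_toReal hfin).symm⟩
  refine ⟨5 ^ (-coreExponent n) * c * m, by positivity, fun t ht => ?_⟩
  have ht₁ := sub_pos.2 ht.2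
  have hσ := blowUpRadius_pos (α := α) ht.2
  have hpow : (1 - t) ^ (-γ) = blowUpRadius α t ^ (-(n / 2 : ℝ)) *
      (1 - t) ^ (α * (n / 4 - n / 2 / q.toReal) - γ) * blowUpRadius α t ^ (n / q.toReal) := by
    rw [mul_right_comm, ← Real.rpow_add hσ, blowUpRadius, ← Real.rpow_mul ht₁.le,
      ← Real.rpow_add ht₁]
    ring_nf
  refine le_trans ?_ (ofReal_mul_rpow_mul_le_eLpNorm hq₀ hq hσ fun x hx =>
    le_norm_blowUpSolution_of_norm_le_blowUpRadius hα ht (mem_ball_zero_iff.1 hx).le)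
  rw [finrank_euclideanSpace_fin, ← ENNReal.ofReal_mul' (by positivity), hm,
    ← ENNReal.ofReal_mul' hm₀.le, hpow]
  refine ENNReal.ofReal_le_ofReal ?_
  calc _ = 5 ^ (-coreExponent n) * (blowUpRadius α t ^ (-(n / 2 : ℝ)) *
          (c * (1 - t) ^ (α * (n / 4 - n / 2 / q.toReal) - γ))) *
          blowUpRadius α t ^ (n / q.toReal) * m := by ring
    _ ≤ _ := by gcongr; exact hc t ht

theorem not_memMixed_blowUpSolution (hα : 1 < α) (hp₀ : p ≠ 0) (hp : p ≠ ∞) (hq₀ : q ≠ 0)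
    (hq : q ≠ ∞) (hpq : p.toReal⁻¹ = n / 4 - n / 2 / q.toReal) :
    ¬ MemMixed (Ioo 0 1) p q (blowUpSolution n α) := by
  intro hmem
  have hp₁ : 0 < p.toReal := ENNReal.toReal_pos hp₀ hp
  obtain ⟨c, hc₀, hc⟩ := exists_mul_rpow_le_eLpNorm_blowUpSolution (γ := p.toReal⁻¹)
    (zero_le_one.trans hα.le) hq₀ hq (by rw [← hpq]; exact lt_mul_of_one_lt_left (by positivity) hα)
  have hint := (hmem.integrableOn_rpow measurableSet_Ioo hp₀ hp (by fun_prop)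
    (fun t ht => mul_nonneg hc₀.le (Real.rpow_nonneg (sub_nonneg.2 ht.2.le) _))
    fun t ht => hc t (Ioo_subset_Ico_self ht)).const_mul (c ^ p.toReal)⁻¹
  refine (lt_irrefl (-1 : ℝ)) (integrableOn_one_sub_rpow_iff.1
    (IntegrableOn.congr_fun hint (fun t ht => ?_) measurableSet_Ioo))
  have ht₁ := sub_pos.2 ht.2
  rw [Real.mul_rpow hc₀.le (by positivity), ← Real.rpow_mul ht₁.le, neg_mul,
    inv_mul_cancel₀ hp₁.ne', inv_mul_cancel_left₀ (by positivity)]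

end strichartz_norms

theorem proposition1p4_general (n : ℕ) (hn : 2 ≤ n) (r s : ℝ) (hr : 0 < r)
    (hs : (n : ℝ) / 2 < s) (hrs : 1 < 1 / r + n / (2 * s)) :
    ∃ (V : ℝ → EuclideanSpace ℝ (Fin n) → ℝ) (u : ℝ → EuclideanSpace ℝ (Fin n) → ℂ),
      MemMixed (Ioo 0 1) (ENNReal.ofReal r) (ENNReal.ofReal s) V ∧
      MemContL2 (Icc 0 1) u ∧
      IsIntegralSolution 1 V u ∧
      ∀ p q : ℝ≥0∞, SchrodingerAdmissible n p q → p < ∞ →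
        (∀ T : ℝ, 0 < T → T < 1 → MemMixed (Ioo 0 T) p q u) ∧
        ¬ MemMixed (Ioo 0 1) p q u := by
  have hs₀ : 0 < s := (by positivity : (0 : ℝ) ≤ n / 2).trans_lt hs
  have hgap₀ : 0 < (1 - n / (2 * s)) * r :=
    mul_pos (sub_pos.2 ((div_lt_one (by positivity)).2 (by linarith))) hr
  have hgap₁ : (1 - n / (2 * s)) * r < 1 := (lt_div_iff₀ hr).1 (by linarith)
  obtain ⟨α, hα₁, hα⟩ := exists_between (lt_min one_lt_two ((one_lt_div hgap₀).2 hgap₁))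
  obtain ⟨hα₂, hαr⟩ := lt_min_iff.1 hα
  have hVr : α * (1 - n / (2 * s)) * r < 1 := by rwa [mul_assoc, ← lt_div_iff₀ hgap₀]
  refine ⟨blowUpPotential n α, blowUpSolution n α, memMixed_blowUpPotential hα₁.le hr hs hVr,
    memContL2_blowUpSolution hn hα₁.le, isIntegralSolution_blowUpSolution hn hα₁.le hα₂,
    fun p q hpq hp => ?_⟩
  have hp₀ : p ≠ 0 := (zero_lt_two.trans_le hpq.2.1).ne'
  have hq₁ : 1 ≤ q := one_le_two.trans hpq.2.2.1
  exact ⟨fun T _ hT =>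
      memMixed_blowUpSolution (zero_le_one.trans hα₁.le) hT hp₀ hp.ne hq₁ (hpq.ne_top hn),
    not_memMixed_blowUpSolution hα₁ hp₀ hp.ne (zero_lt_one.trans_le hq₁).ne' (hpq.ne_top hn)
      hpq.inv_toReal⟩

theorem proposition1p4 (n : ℕ) (hn : 2 ≤ n) (r s : ℝ) (hr : 1 ≤ r)
    (hs₁ : (n : ℝ) / 2 < s) (hs₂ : s < n) (hrs : 1 / (2 * r) + n / (2 * s) > 1) :
    ∃ (V : ℝ → EuclideanSpace ℝ (Fin n) → ℝ) (u : ℝ → EuclideanSpace ℝ (Fin n) → ℂ),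
      MemMixed (Ioo 0 1) (ENNReal.ofReal r) (ENNReal.ofReal s) V ∧
      MemContL2 (Icc 0 1) u ∧
      IsIntegralSolution 1 V u ∧
      ∀ p q : ℝ≥0∞, SchrodingerAdmissible n p q → p < ∞ →
        (∀ T : ℝ, 0 < T → T < 1 → MemMixed (Ioo 0 T) p q u) ∧
        ¬ MemMixed (Ioo 0 1) p q u :=
  proposition1p4_general n hn r s (by linarith) hs₁ (hrs.lt.trans_le (by gcongr; linarith))
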